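/- Let $A_1,\dots,A_N$ be non-singular real $2\times2$ matrices that are contracting ($\|A_i\|<1$ for the Euclidean operator norm), let $t_1,\dots,t_N\in\mathbb{R}^2$, and let $f_i(x)=A_ix+t_i$. For a $2\times 2$ matrix $A$ let $\alpha_1(A)\ge\alpha_2(A)$ be its singular values. Let $p=(p_1,\dots,p_N)$ be a probability vector, $\nu=p^{\mathbb{N}}$ the Bernoulli measure on $\Sigma^+=\{1,\dots,N\}^{\mathbb{N}}$, and $\mu=\pi_*\nu$ the corresponding self-affine measure, where $\pi(i_0,i_1,\dots)=\lim_{n\to\infty}f_{i_0}\circ\cdots\circ f_{i_n}(0)$ (so $\mu=\sum_ip_i\,\mu\circ f_i^{-1}$). Put $h_\nu=-\sum_ip_i\log p_i$, and let $\chi_s\le\chi_{ss}$ be the Lyapunov exponents: for $\nu$-a.e. $(i_0,i_1,\dots)$, $$\lim_{n\to\infty}\tfrac1n\log\alpha_1(A_{i_0}\cdots A_{i_{n-1}})=-\chi_s,\qquad \lim_{n\to\infty}\tfrac1n\log\alpha_2(A_{i_0}\cdots A_{i_{n-1}})=-\chi_{ss}.$$ Let $$\dim_{\mathrm{Lyap}}\mu=\min\Big\{2,\frac{h_\nu}{\chi_s},\,1+\frac{h_\nu-\chi_s}{\chi_{ss}}\Big\},$$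 and for a Borel measure $m$ on a metric space let $\dim_Hm=\inf\{\dim_HE:m(E^c)=0\}$. Assume that: (1) (dominated splitting) there are $C,\delta>0$ such that $\alpha_1(A_{i_1}\cdots A_{i_n})\ge Ce^{\delta n}\,\alpha_2(A_{i_1}\cdots A_{i_n})$ for all $n$ and all $i_1,\dots,i_n\in\{1,\dots,N\}$; (2) (strong separation condition) there is a non-empty bounded open set $\mathcal{O}\subset\mathbb{R}^2$ such that $f_i(\overline{\mathcal{O}})\subseteq\mathcal{O}$ for all $i$ and $f_i(\overline{\mathcal{O}})\cap f_j(\overline{\mathcal{O}})=\emptyset$ for all $i\ne j$; (3) $\dim_H\nu_{ss}\ge\min\{1,\dim_{\mathrm{Lyap}}\mu\}$. Here $\nu_{ss}=(e_{ss})_*\nu$ is the distribution on the projective line $\mathbf{P}^1$ of the strong stable directions, defined as follows. By (1) there is a unique pair of families of lines $e_s(\mathbf{i}),e_{ss}(\mathbf{i})\in\mathbf{P}^1$, indexed by $\mathbf{i}\in\{1,\dots,N\}^{\mathbb{Z}}$, such that $A_{i_0}e_\ast(\mathbf{i})=e_\ast(\sigma\mathbf{i})$ for $\ast\in\{s,ss\}$,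 where $\sigma$ is the left shift, and such that for some $C',\delta'>0$, $$\|A_{i_{n-1}}\cdots A_{i_0}|e_s(\mathbf{i})\|\ge C'e^{\delta'n}\,\|A_{i_{n-1}}\cdots A_{i_0}|e_{ss}(\mathbf{i})\|\quad\text{for all }\mathbf{i}\text{ and all }n\ge1;$$ the line $e_{ss}(\mathbf{i})$ depends only on $(i_0,i_1,\dots)$, so $e_{ss}$ is a map $\Sigma^+\to\mathbf{P}^1$. Then $$\dim_H\mu=\dim_{\mathrm{Lyap}}\mu=\min\Big\{\frac{h_\nu}{\chi_s},\,1+\frac{h_\nu-\chi_s}{\chi_{ss}}\Big\}.$$ -/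

import Mathlib

open MeasureTheory Filter Topology
open scoped ENNReal LinearAlgebra.Projectivization

/-- The Euclidean plane. -/
abbrev Plane : Type := EuclideanSpace ℝ (Fin 2)

/-- Real `2 × 2` matrices. -/
abbrev Mat2 : Type := Matrix (Fin 2) (Fin 2) ℝ

noncomputable section

/-! ### The projective line with the metric `d(ℓ, ℓ') = ‖P_ℓ - P_ℓ'‖ = sin ∠(ℓ, ℓ')`

Here `P_ℓ` is the orthogonal projection onto `ℓ`. This metric is bi-Lipschitz equivalent to the
angle metric, so it has the same Borel sets and the same Hausdorff dimensions. -/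

/-- The orthogonal projection of the plane onto a line through the origin. -/
def lineProjection (l : ℙ ℝ Plane) : Plane →L[ℝ] Plane :=
  l.submodule.starProjection

theorem lineProjection_injective : Function.Injective lineProjection := by
  intro l m h
  apply Projectivization.submodule_injective
  have hl : (lineProjection l).range = l.submodule := by
    simp [lineProjection]
  have hm : (lineProjection m).range = m.submodule := by
    simp [lineProjection]
  rw [← hl, ← hm, h]

instance instMetricSpaceLines : MetricSpace (ℙ ℝ Plane) :=
  MetricSpace.induced lineProjection lineProjection_injective inferInstance

instance instMeasurableSpaceLines : MeasurableSpace (ℙ ℝ Plane) := borel _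

instance instBorelSpaceLines : BorelSpace (ℙ ℝ Plane) := ⟨rfl⟩

/-! ### Hausdorff dimension of a measure -/

/-- The Hausdorff dimension of a measure: the infimum of `dim_H s` over all sets `s` of full
measure. -/
def dimHMeasure {X : Type*} [EMetricSpace X] [MeasurableSpace X] (μ : Measure X) : ℝ≥0∞ :=
  ⨅ (s : Set X) (_ : μ sᶜ = 0), dimH s

/-! ### Planar affine iterated function systems -/

/-- The larger singular value of a `2 × 2` matrix. -/
def sv1 (M : Mat2) : ℝ := (Matrix.toEuclideanLin M).singularValues 0

/-- The smaller singular value of a `2 × 2` matrix. -/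
def sv2 (M : Mat2) : ℝ := (Matrix.toEuclideanLin M).singularValues 1

/-- The matrix is contracting: its operator norm for the Euclidean norm is less than one. -/
def IsContracting (M : Mat2) : Prop := ‖Matrix.toEuclideanCLM (n := Fin 2) (𝕜 := ℝ) M‖ < 1

/-- The affine map `f_i(x) = A_i x + t_i`. -/
def affMap {N : ℕ} (A : Fin N → Mat2) (t : Fin N → Plane) (i : Fin N) (x : Plane) : Plane :=
  Matrix.toEuclideanCLM (n := Fin 2) (𝕜 := ℝ) (A i) x + t i

/-- The strong separation condition for the system `f_i(x) = A_i x + t_i`. -/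
def StrongSeparation {N : ℕ} (A : Fin N → Mat2) (t : Fin N → Plane) : Prop :=
  ∃ O : Set Plane, IsOpen O ∧ O.Nonempty ∧ Bornology.IsBounded O ∧
    (∀ i, affMap A t i '' closure O ⊆ O) ∧
    ∀ i j, i ≠ j → Disjoint (affMap A t i '' closure O) (affMap A t j '' closure O)

/-- The dominated splitting condition: the ratio of the singular values of products along finite
words grows at least exponentially, uniformly in the length of the word. -/
def DominatedSplitting {N : ℕ} (A : Fin N → Mat2) : Prop :=
  ∃ C > 0, ∃ δ > 0, ∀ w : List (Fin N),
    C * Real.exp (δ * w.length) ≤ sv1 (w.map A).prod / sv2 (w.map A).prod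

/-! ### Bernoulli measures and self-affine measures -/

/-- The Bernoulli measure `p^ℕ` on the space of one-sided infinite words. -/
def bernoulliMeas {N : ℕ} (p : PMF (Fin N)) : Measure (ℕ → Fin N) :=
  Measure.infinitePi fun _ => p.toMeasure

/-- The composition `f_{i_0} ∘ ⋯ ∘ f_{i_{n-1}}`. -/
def wordMap {N : ℕ} (A : Fin N → Mat2) (t : Fin N → Plane) (i : ℕ → Fin N) : ℕ → Plane → Plane
  | 0 => id
  | n + 1 => wordMap A t i n ∘ affMap A t (i n)

/-- The natural projection `i ↦ lim_n f_{i_0} ∘ ⋯ ∘ f_{i_n} (0)` onto the attractor. -/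
def naturalProjection {N : ℕ} (A : Fin N → Mat2) (t : Fin N → Plane) (i : ℕ → Fin N) : Plane :=
  limUnder atTop fun n => wordMap A t i n 0

/-- The self-affine measure of the system `f_i(x) = A_i x + t_i` with probability vector `p`. -/
def selfAffineMeasure {N : ℕ} (A : Fin N → Mat2) (t : Fin N → Plane) (p : PMF (Fin N)) :
    Measure Plane :=
  (bernoulliMeas p).map (naturalProjection A t)

/-! ### Entropy, Lyapunov exponents, Lyapunov dimension -/

/-- The entropy `h = - ∑ p_i log p_i` (with `0 log 0 = 0`) of the Bernoulli measure. -/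
def entropy {N : ℕ} (p : PMF (Fin N)) : ℝ := ∑ i, Real.negMulLog (p i).toReal

/-- The product `A_{i_0} ⋯ A_{i_{n-1}}`. -/
def wordProd {N : ℕ} (A : Fin N → Mat2) (i : ℕ → Fin N) : ℕ → Mat2
  | 0 => 1
  | n + 1 => wordProd A i n * A (i n)

/-- The Lyapunov exponent `χ_s`: the constant with
`lim_n (1/n) log α₁(A_{i_0} ⋯ A_{i_{n-1}}) = -χ_s` for almost every word. -/
def lyapS {N : ℕ} (A : Fin N → Mat2) (p : PMF (Fin N)) : ℝ :=
  Classical.epsilon fun χ : ℝ => ∀ᵐ i ∂(bernoulliMeas p),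
    Tendsto (fun n : ℕ => 1 / (n : ℝ) * Real.log (sv1 (wordProd A i n))) atTop (𝓝 (-χ))

/-- The Lyapunov exponent `χ_ss`: the constant with
`lim_n (1/n) log α₂(A_{i_0} ⋯ A_{i_{n-1}}) = -χ_ss` for almost every word. -/
def lyapSS {N : ℕ} (A : Fin N → Mat2) (p : PMF (Fin N)) : ℝ :=
  Classical.epsilon fun χ : ℝ => ∀ᵐ i ∂(bernoulliMeas p),
    Tendsto (fun n : ℕ => 1 / (n : ℝ) * Real.log (sv2 (wordProd A i n))) atTop (𝓝 (-χ))

/-- The Lyapunov dimension of the self-affine measure. -/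
def dimLyap {N : ℕ} (A : Fin N → Mat2) (p : PMF (Fin N)) : ℝ :=
  min 2 (min (entropy p / lyapS A p) (1 + (entropy p - lyapS A p) / lyapSS A p))

/-! ### Strong stable directions -/

/-- The cocycle `A^{(n)}(i) = A_{i_{n-1}} ⋯ A_{i_0}` over the two-sided full shift. -/
def cocycle {N : ℕ} (A : Fin N → Mat2) (i : ℤ → Fin N) : ℕ → Mat2
  | 0 => 1
  | n + 1 => A (i n) * cocycle A i n

/-- The left shift on two-sided infinite words. -/
def leftShift {N : ℕ} (i : ℤ → Fin N) : ℤ → Fin N := fun k => i (k + 1)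

/-- The norm `‖M|ℓ‖` of the restriction of a matrix to a line. -/
def normOnLine (M : Mat2) (l : ℙ ℝ Plane) : ℝ :=
  ‖(Matrix.toEuclideanCLM (n := Fin 2) (𝕜 := ℝ) M).comp l.submodule.subtypeL‖

/-- `es` and `ess` are families of lines, indexed by two-sided infinite words, that are invariant
under the cocycle and such that `es` uniformly exponentially dominates `ess`. -/
structure IsInvariantSplitting {N : ℕ} (A : Fin N → Mat2) (es ess : (ℤ → Fin N) → ℙ ℝ Plane) :
    Prop where
  map_s : ∀ i, (es i).submodule.map (Matrix.toEuclideanLin (A (i 0))) =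
    (es (leftShift i)).submodule
  map_ss : ∀ i, (ess i).submodule.map (Matrix.toEuclideanLin (A (i 0))) =
    (ess (leftShift i)).submodule
  dominated : ∃ C > 0, ∃ δ > 0, ∀ (i : ℤ → Fin N) (n : ℕ), 1 ≤ n →
    C * Real.exp (δ * n) ≤ normOnLine (cocycle A i n) (es i) / normOnLine (cocycle A i n) (ess i)

/-- The family `e_ss` of strong stable directions of the invariant splitting. (Such a splitting
exists and is unique if `A` satisfies the dominated splitting condition.) -/
def strongStable {N : ℕ} (A : Fin N → Mat2) : (ℤ → Fin N) → ℙ ℝ Plane :=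
  Classical.epsilon fun ess => ∃ es, IsInvariantSplitting A es ess

/-- The strong stable direction of a one-sided infinite word. The line `e_ss(i)` depends only on
the coordinates `i_0, i_1, …` of a two-sided word, so any extension of the word to the left can be
used; here the coordinate `i_0` is repeated. -/
def strongStableDir {N : ℕ} (A : Fin N → Mat2) (i : ℕ → Fin N) : ℙ ℝ Plane :=
  strongStable A fun k : ℤ => i k.toNat

/-- The distribution `ν_ss = (e_ss)_* ν` of the strong stable directions. -/
def strongStableDistribution {N : ℕ} (A : Fin N → Mat2) (p : PMF (Fin N)) :
    Measure (ℙ ℝ Plane) :=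
  (bernoulliMeas p).map (strongStableDir A)

end

/-! Write ν for the Bernoulli measure, h for its entropy, χ₁ < χ₂ for the two exponents, α₁ ≥ α₂ for
singular values.

Upper bound. About exp(hn) words of length n carry almost all of ν, and each of their cylinders has
size about exp(-χ₁n) by exp(-χ₂n). Covering by whole cylinders gives h/χ₁; cutting each one into
exp((χ₂-χ₁)n) pieces of size exp(-χ₂n) gives 1+(h-χ₁)/χ₂ (`dimH_image_typical_le_one_scale`,
`dimH_image_typical_le_two_scales`). The entry 2 of the minimum plays no role: strong separation
makes the |det A_i| sum to at most 1, and Gibbs' inequality turns this into h ≤ χ₁+χ₂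
(`entropy_le`).

Lower bound. Let D be the supremum of the exponents s such that μ(B(x,r)) = O(r^s) at μ-almost every
x; by the mass distribution principle D bounds the dimension from below. A ball of radius about
α₂(A_{i|n}) around π(i) meets only the n-th cylinder. Pulled back by f_{i|n}, it becomes a set
inside a tube of width about α₂/α₁ through π(σⁿi), parallel to a direction that A_{i|n} contracts by
about α₂ (`selfAffineMeasure_closedBall_le`). Such a direction is e_ss of the word i_{n-1}…i_0
followed by an arbitrary j. The pair (σⁿi, i_{n-1}…i_0 j) is the n-th iterate of (i,j) under the
natural extension of the shift, which preserves ν×ν, so the tube is a typical one for μ×ν_ss.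

By a potential-theoretic projection argument (`ae_exists_tube_le`), typical tubes of width ρ have
mass O(ρ^s) for every s < min(D,1), as long as ν_ss satisfies Frostman bounds with exponents above
s. The constant depends on the pair, but a set of pairs with a common constant is visited with
sublinear gaps, by Kac's inequality and Borel–Cantelli (`ae_exists_visit`); hence all radii are
controlled. The cylinder contributes exp(-hn) and the tube exp(-(χ₂-χ₁)sn) at radius exp(-χ₂n), so D
χ₂ ≥ h+(χ₂-χ₁)min(D,1). For D ≤ 1 this says D ≥ h/χ₁, for D ≥ 1 it says D ≥ 1+(h-χ₁)/χ₂; either way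
D is not below the Lyapunov dimension.

Two ingredients remain. A lower bound on dim_H ν_ss gives a Frostman bound on a set of positive
measure only; the projective action of the matrices is bi-Lipschitz, so that set is shift-invariant
and a zero-one law makes it full (`frostmanAE_slowLine`). And e_ss, introduced by an abstract
choice, must be identified: it is the limit of the most contracted lines
(`strongStable_eq_slowLine`), and products contract it by α₂ up to a bounded factor
(`exists_slowNorm_le_sv2`). The latter also makes log α₁ almost additive, so that the exponents
exist by the law of large numbers for independent blocks. -/

noncomputable section

/-! ### Linear algebra in the plane -/

/-- The action of a matrix on the Euclidean plane. -/
abbrev act (M : Mat2) : Plane →L[ℝ] Plane := Matrix.toEuclideanCLM (n := Fin 2) (𝕜 := ℝ) M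

/-- The determinant of two plane vectors. -/
def cross (u v : Plane) : ℝ := u 0 * v 1 - u 1 * v 0

theorem act_mul (M L : Mat2) (v : Plane) : act (M * L) v = act M (act L v) := by
  simp [act, map_mul]

theorem act_one (v : Plane) : act 1 v = v := by
  simp [act]

theorem act_zero_apply (M : Mat2) (v : Plane) : act M v 0 = M 0 0 * v 0 + M 0 1 * v 1 := by
  simp [act, Matrix.ofLp_toEuclideanCLM, Matrix.mulVec, dotProduct, Fin.sum_univ_two]

theorem act_one_apply (M : Mat2) (v : Plane) : act M v 1 = M 1 0 * v 0 + M 1 1 * v 1 := by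
  simp [act, Matrix.ofLp_toEuclideanCLM, Matrix.mulVec, dotProduct, Fin.sum_univ_two]

theorem plane_norm_sq (v : Plane) : ‖v‖ ^ 2 = v 0 ^ 2 + v 1 ^ 2 := by
  simp [EuclideanSpace.real_norm_sq_eq, Fin.sum_univ_two]

theorem plane_inner (u v : Plane) : inner ℝ u v = u 0 * v 0 + u 1 * v 1 := by
  simp [PiLp.inner_apply, Fin.sum_univ_two, mul_comm]

theorem cross_act (M : Mat2) (u v : Plane) :
    cross (act M u) (act M v) = M.det * cross u v := by
  simp only [cross, act_zero_apply, act_one_apply, Matrix.det_fin_two]; ring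

theorem cross_sq_add_inner_sq (u v : Plane) :
    cross u v ^ 2 + (inner ℝ u v) ^ 2 = ‖u‖ ^ 2 * ‖v‖ ^ 2 := by
  simp only [cross, plane_inner, plane_norm_sq]; ring

theorem abs_cross_le (u v : Plane) : |cross u v| ≤ ‖u‖ * ‖v‖ := by
  refine abs_le_of_sq_le_sq ?_ (by positivity)
  nlinarith [cross_sq_add_inner_sq u v, sq_nonneg (inner ℝ u v)]

theorem cross_comm (u v : Plane) : cross u v = -cross v u := by
  simp only [cross]; ring

theorem abs_cross_comm (u v : Plane) : |cross u v| = |cross v u| := by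
  rw [cross_comm, abs_neg]

theorem cross_smul_left (a : ℝ) (u v : Plane) : cross (a • u) v = a * cross u v := by
  simp only [cross, PiLp.smul_apply, smul_eq_mul]; ring

theorem cross_smul_right (a : ℝ) (u v : Plane) : cross u (a • v) = a * cross u v := by
  simp only [cross, PiLp.smul_apply, smul_eq_mul]; ring

theorem cross_sub_right (u v w : Plane) : cross u (v - w) = cross u v - cross u w := by
  simp only [cross, PiLp.sub_apply]; ring

theorem cross_same (u : Plane) : cross u u = 0 := by
  simp only [cross]; ring

theorem exists_smul_of_cross_eq_zero {u v : Plane} (hu : ‖u‖ = 1) (h : cross u v = 0) :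
    v = (inner ℝ u v : ℝ) • u := by
  have hn := plane_norm_sq u
  rw [hu] at hn
  have h' := h
  simp only [cross] at h'
  ext i
  fin_cases i
  · simp only [Fin.zero_eta, PiLp.smul_apply, smul_eq_mul, plane_inner]
    linear_combination (v 0) * hn - (u 1) * h'
  · simp only [Fin.mk_one, PiLp.smul_apply, smul_eq_mul, plane_inner]
    linear_combination (v 1) * hn + (u 0) * h'

/-- Any vector is a combination of two non-parallel vectors. -/
theorem cross_smul_eq (u v w : Plane) :
    cross u v • w = cross w v • u + cross u w • v := by
  ext i
  fin_cases i <;> simp only [cross, Fin.zero_eta, Fin.mk_one, PiLp.smul_apply, smul_eq_mul,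
    PiLp.add_apply] <;> ring

/-- Eigenvectors of the adjoint composed with the map are sent to orthogonal vectors whose squared
lengths are the eigenvalues. All later facts about `sv1` and `sv2` come from expanding in this
basis. -/
theorem exists_singular_basis (M : Mat2) :
    ∃ b : OrthonormalBasis (Fin 2) ℝ Plane, ‖act M (b 0)‖ = sv1 M ∧ ‖act M (b 1)‖ = sv2 M ∧
      inner ℝ (act M (b 0)) (act M (b 1)) = 0 := by
  set T := Matrix.toEuclideanLin M with hT
  have hn : Module.finrank ℝ Plane = 2 := by simp
  set b := T.isSymmetric_adjoint_comp_self.eigenvectorBasis hn with hb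
  have key : ∀ i k, inner ℝ (act M (b i)) (act M (b k)) =
      T.isSymmetric_adjoint_comp_self.eigenvalues hn k * inner ℝ (b i) (b k) := by
    intro i k
    have h1 := T.isSymmetric_adjoint_comp_self.apply_eigenvectorBasis hn k
    have h2 : inner ℝ (b i) ((LinearMap.adjoint T ∘ₗ T) (b k)) =
        inner ℝ (act M (b i)) (act M (b k)) := by
      rw [LinearMap.comp_apply, LinearMap.adjoint_inner_right]; rfl
    rw [← h2, hb, h1, inner_smul_right]; rfl
  have key2 : ∀ k : Fin 2, ‖act M (b k)‖ = T.singularValues k := by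
    intro k
    have h1 := key k k
    rw [real_inner_self_eq_norm_sq, real_inner_self_eq_norm_sq, b.norm_eq_one,
      ← T.sq_singularValues_fin hn k] at h1
    have := T.singularValues_nonneg k
    rw [one_pow, mul_one] at h1
    exact (pow_left_inj₀ (norm_nonneg _) this two_ne_zero).mp h1
  refine ⟨b, key2 0, key2 1, ?_⟩
  rw [key, b.inner_eq_zero (by decide), mul_zero]

theorem sv2_le_sv1 (M : Mat2) : sv2 M ≤ sv1 M :=
  (Matrix.toEuclideanLin M).singularValues_antitone (by norm_num)

theorem sv1_nonneg (M : Mat2) : 0 ≤ sv1 M := LinearMap.singularValues_nonneg _ _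

theorem sv2_nonneg (M : Mat2) : 0 ≤ sv2 M := LinearMap.singularValues_nonneg _ _

theorem norm_sq_act_singular_basis {M : Mat2} {b : OrthonormalBasis (Fin 2) ℝ Plane}
    (h0 : ‖act M (b 0)‖ = sv1 M) (h1 : ‖act M (b 1)‖ = sv2 M)
    (h : inner ℝ (act M (b 0)) (act M (b 1)) = 0) (v : Plane) :
    ‖act M v‖ ^ 2 = (sv1 M * inner ℝ (b 0) v) ^ 2 + (sv2 M * inner ℝ (b 1) v) ^ 2 := by
  have hv := b.sum_repr' v
  rw [Fin.sum_univ_two] at hv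
  conv_lhs => rw [← hv, map_add, map_smul, map_smul, norm_add_sq_real, norm_smul, norm_smul,
    inner_smul_left, inner_smul_right, h, h0, h1]
  simp only [Real.norm_eq_abs, mul_pow, sq_abs]
  ring

theorem norm_sq_singular_basis (b : OrthonormalBasis (Fin 2) ℝ Plane) (v : Plane) :
    ‖v‖ ^ 2 = (inner ℝ (b 0) v) ^ 2 + (inner ℝ (b 1) v) ^ 2 := by
  rw [← b.sum_sq_norm_inner_right v, Fin.sum_univ_two]; simp

theorem norm_act_le_sv1 (M : Mat2) (v : Plane) : ‖act M v‖ ≤ sv1 M * ‖v‖ := by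
  obtain ⟨b, h0, h1, h⟩ := exists_singular_basis M
  refine le_of_sq_le_sq ?_ (mul_nonneg (sv1_nonneg _) (norm_nonneg _))
  rw [norm_sq_act_singular_basis h0 h1 h, mul_pow, mul_pow, mul_pow, norm_sq_singular_basis b v]
  have : sv2 M ^ 2 ≤ sv1 M ^ 2 := pow_le_pow_left₀ (sv2_nonneg M) (sv2_le_sv1 M) 2
  nlinarith [mul_nonneg (sub_nonneg.2 this) (sq_nonneg (inner ℝ (b 1) v : ℝ))]

theorem sv2_le_norm_act (M : Mat2) (v : Plane) : sv2 M * ‖v‖ ≤ ‖act M v‖ := by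
  obtain ⟨b, h0, h1, h⟩ := exists_singular_basis M
  refine le_of_sq_le_sq ?_ (norm_nonneg _)
  rw [norm_sq_act_singular_basis h0 h1 h, mul_pow, mul_pow, mul_pow, norm_sq_singular_basis b v]
  have : sv2 M ^ 2 ≤ sv1 M ^ 2 := pow_le_pow_left₀ (sv2_nonneg M) (sv2_le_sv1 M) 2
  nlinarith [mul_nonneg (sub_nonneg.2 this) (sq_nonneg (inner ℝ (b 0) v : ℝ))]

theorem sv1_eq_norm (M : Mat2) : sv1 M = ‖act M‖ := by
  refine le_antisymm ?_ (ContinuousLinearMap.opNorm_le_bound _ (sv1_nonneg _) (norm_act_le_sv1 M))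
  obtain ⟨b, h0, h1, h⟩ := exists_singular_basis M
  rw [← h0]
  simpa using (act M).le_opNorm (b 0)

theorem sv1_mul_sv2 (M : Mat2) : sv1 M * sv2 M = |M.det| := by
  obtain ⟨b, h0, h1, h⟩ := exists_singular_basis M
  have e1 := cross_sq_add_inner_sq (act M (b 0)) (act M (b 1))
  have e2 := cross_sq_add_inner_sq (b 0) (b 1)
  rw [b.inner_eq_zero (by decide), b.norm_eq_one, b.norm_eq_one] at e2
  rw [h, h0, h1, cross_act, mul_pow] at e1
  have e3 : (sv1 M * sv2 M) ^ 2 = M.det ^ 2 := by nlinarith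
  rw [← sq_abs M.det] at e3
  exact (pow_left_inj₀ (mul_nonneg (sv1_nonneg _) (sv2_nonneg _)) (abs_nonneg _) two_ne_zero).mp e3

theorem sv1_pos {M : Mat2} (h : M.det ≠ 0) : 0 < sv1 M := by
  have := sv1_mul_sv2 M
  have h' := abs_pos.2 h
  rcases (sv1_nonneg M).eq_or_lt with h0 | h0
  · rw [← h0, zero_mul] at this; linarith
  · exact h0

theorem sv2_pos {M : Mat2} (h : M.det ≠ 0) : 0 < sv2 M := by
  have := sv1_mul_sv2 M
  have h' := abs_pos.2 h
  rcases (sv2_nonneg M).eq_or_lt with h0 | h0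
  · rw [← h0, mul_zero] at this; linarith
  · exact h0

theorem sv1_mul_le (M L : Mat2) : sv1 (M * L) ≤ sv1 M * sv1 L := by
  rw [sv1_eq_norm, sv1_eq_norm, sv1_eq_norm]
  have : act (M * L) = act M * act L := map_mul _ _ _
  rw [this]
  exact norm_mul_le _ _

theorem exists_norm_act_eq_sv2 (M : Mat2) : ∃ u : Plane, ‖u‖ = 1 ∧ ‖act M u‖ = sv2 M := by
  obtain ⟨b, h0, h1, h⟩ := exists_singular_basis M
  exact ⟨b 1, b.norm_eq_one 1, h1⟩

theorem exists_norm_act_eq_sv1 (M : Mat2) : ∃ u : Plane, ‖u‖ = 1 ∧ ‖act M u‖ = sv1 M := by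
  obtain ⟨b, h0, h1, h⟩ := exists_singular_basis M
  exact ⟨b 0, b.norm_eq_one 0, h0⟩

theorem le_sv1_mul {M L : Mat2} : sv1 M * sv2 L ≤ sv1 (M * L) ∨ L.det = 0 := by
  by_cases hL : L.det = 0
  · exact Or.inr hL
  left
  obtain ⟨u, hu, hM⟩ := exists_norm_act_eq_sv1 M
  have hinv : act L (act L⁻¹ u) = u := by
    rw [← act_mul, Matrix.mul_nonsing_inv _ (isUnit_iff_ne_zero.2 hL), act_one]
  have h1 := sv2_le_norm_act L (act L⁻¹ u)
  rw [hinv, hu] at h1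
  have h2 := norm_act_le_sv1 (M * L) (act L⁻¹ u)
  rw [act_mul, hinv, hM] at h2
  calc sv1 M * sv2 L ≤ sv1 (M * L) * ‖act L⁻¹ u‖ * sv2 L := by
        gcongr; exact sv2_nonneg _
    _ = sv1 (M * L) * (sv2 L * ‖act L⁻¹ u‖) := by ring
    _ ≤ sv1 (M * L) * 1 := by gcongr; exact sv1_nonneg _
    _ = _ := mul_one _

/-! ### Lines in the plane -/

theorem exists_unit (l : ℙ ℝ Plane) : ∃ u : Plane, ‖u‖ = 1 ∧ l.submodule = ℝ ∙ u := by
  have h := l.rep_nonzero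
  refine ⟨(‖l.rep‖)⁻¹ • l.rep, ?_, ?_⟩
  · rw [norm_smul, norm_inv, norm_norm, inv_mul_cancel₀ (norm_ne_zero_iff.2 h)]
  · rw [l.submodule_eq, Submodule.span_singleton_smul_eq]
    exact (isUnit_iff_ne_zero.2 (inv_ne_zero (norm_ne_zero_iff.2 h)))

/-- A unit vector on a line through the origin. -/
def dir (l : ℙ ℝ Plane) : Plane := (exists_unit l).choose

theorem norm_dir (l : ℙ ℝ Plane) : ‖dir l‖ = 1 := (exists_unit l).choose_spec.1

theorem submodule_eq_span_dir (l : ℙ ℝ Plane) : l.submodule = ℝ ∙ dir l :=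
  (exists_unit l).choose_spec.2

theorem dir_ne_zero (l : ℙ ℝ Plane) : dir l ≠ 0 := by
  rw [← norm_ne_zero_iff, norm_dir]; exact one_ne_zero

theorem lineProjection_apply (l : ℙ ℝ Plane) (v : Plane) :
    lineProjection l v = (inner ℝ (dir l) v : ℝ) • dir l := by
  unfold lineProjection
  have : ∀ S : Submodule ℝ Plane, S = (ℝ ∙ dir l) →
      S.starProjection v = (inner ℝ (dir l) v : ℝ) • dir l := by
    rintro S rfl
    exact Submodule.starProjection_unit_singleton ℝ (norm_dir l) v
  exact this _ (submodule_eq_span_dir l)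

theorem norm_sq_projection_sub {u w : Plane} (hu : ‖u‖ = 1) (hw : ‖w‖ = 1) (v : Plane) :
    ‖(inner ℝ u v : ℝ) • u - (inner ℝ w v : ℝ) • w‖ ^ 2 = cross u w ^ 2 * ‖v‖ ^ 2 := by
  have h : ‖w‖ ^ 2 * (inner ℝ u v) ^ 2 + ‖u‖ ^ 2 * (inner ℝ w v) ^ 2
      - 2 * (inner ℝ u v * (inner ℝ w v * inner ℝ u w)) = cross u w ^ 2 * ‖v‖ ^ 2 := by
    simp only [plane_inner, cross, plane_norm_sq]; ring
  rw [hu, hw] at h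
  rw [← h, norm_sub_sq_real, norm_smul, norm_smul, hu, hw, inner_smul_left, inner_smul_right]
  simp only [Real.norm_eq_abs, mul_one, sq_abs, RCLike.conj_to_real]
  ring

/-- The difference of the projections onto two lines multiplies every norm by the same factor, the
sine of their angle. Distances between lines thereby become determinants, which transform well under
matrices. -/
theorem dist_eq_abs_cross (l m : ℙ ℝ Plane) : dist l m = |cross (dir l) (dir m)| := by
  change dist (lineProjection l) (lineProjection m) = _
  rw [dist_eq_norm]
  have key : ∀ v, ‖(lineProjection l - lineProjection m) v‖ = |cross (dir l) (dir m)| * ‖v‖ := by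
    intro v
    rw [sub_apply, lineProjection_apply, lineProjection_apply,
      ← abs_norm, ← abs_norm (v), ← abs_mul, ← sq_eq_sq_iff_abs_eq_abs,
      norm_sq_projection_sub (norm_dir l) (norm_dir m), mul_pow]
  refine le_antisymm (ContinuousLinearMap.opNorm_le_bound _ (abs_nonneg _) fun v => (key v).le) ?_
  have := (lineProjection l - lineProjection m).le_opNorm (dir l)
  rwa [key, norm_dir, mul_one, mul_one] at this

theorem line_eq_iff (l m : ℙ ℝ Plane) : l = m ↔ cross (dir l) (dir m) = 0 := by
  rw [← dist_eq_zero, dist_eq_abs_cross, abs_eq_zero]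

theorem submodule_eq_iff_cross {l : ℙ ℝ Plane} {v : Plane} (hv : v ≠ 0) :
    l.submodule = (ℝ ∙ v) ↔ cross (dir l) v = 0 := by
  rw [submodule_eq_span_dir]
  constructor
  · intro h
    have : v ∈ ℝ ∙ dir l := h ▸ Submodule.mem_span_singleton_self v
    obtain ⟨a, rfl⟩ := Submodule.mem_span_singleton.1 this
    rw [cross_smul_right, cross_same, mul_zero]
  · intro h
    have h1 := exists_smul_of_cross_eq_zero (norm_dir l) h
    rw [h1]
    refine (Submodule.span_singleton_smul_eq (isUnit_iff_ne_zero.2 ?_) _).symm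
    intro h0
    rw [h0, zero_smul] at h1
    exact hv h1

/-- The line spanned by a non-zero vector. -/
def lineThrough (v : Plane) (hv : v ≠ 0) : ℙ ℝ Plane := Projectivization.mk ℝ v hv

theorem cross_dir_lineThrough (v : Plane) (hv : v ≠ 0) :
    cross (dir (lineThrough v hv)) v = 0 :=
  (submodule_eq_iff_cross hv).1 (Projectivization.submodule_mk v hv)

theorem dir_lineThrough (u : Plane) (hu : ‖u‖ = 1) (hu0 : u ≠ 0) :
    dir (lineThrough u hu0) = u ∨ dir (lineThrough u hu0) = -u := by
  have h := exists_smul_of_cross_eq_zero (norm_dir _) (cross_dir_lineThrough u hu0)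
  set a : ℝ := inner ℝ (dir (lineThrough u hu0)) u
  have ha : |a| = 1 := by
    have := congrArg norm h
    rw [norm_smul, norm_dir, hu, mul_one] at this
    exact this.symm
  rcases (abs_eq zero_le_one).1 ha with h1 | h1
  · left; rw [h1, one_smul] at h; exact h.symm
  · right; rw [h1, neg_smul, one_smul] at h; exact (neg_eq_iff_eq_neg.2 h).symm

theorem normOnLine_eq (M : Mat2) (l : ℙ ℝ Plane) : normOnLine M l = ‖act M (dir l)‖ := by
  unfold normOnLine
  refine le_antisymm (ContinuousLinearMap.opNorm_le_bound _ (norm_nonneg _) ?_) ?_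
  · rintro ⟨v, hv⟩
    have hv' := hv
    rw [submodule_eq_span_dir] at hv'
    obtain ⟨a, rfl⟩ := Submodule.mem_span_singleton.1 hv'
    simp only [ContinuousLinearMap.comp_apply, Submodule.subtypeL_apply, map_smul, norm_smul,
      Submodule.coe_norm, norm_dir]
    rw [mul_one, mul_comm]
  · have hm : dir l ∈ l.submodule := by
      rw [submodule_eq_span_dir]; exact Submodule.mem_span_singleton_self _
    have := ((Matrix.toEuclideanCLM (n := Fin 2) (𝕜 := ℝ) M).comp l.submodule.subtypeL).le_opNorm
      ⟨dir l, hm⟩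
    simpa [norm_dir] using this

theorem act_ne_zero {M : Mat2} (hM : M.det ≠ 0) {v : Plane} (hv : v ≠ 0) : act M v ≠ 0 := by
  rw [← norm_pos_iff]
  exact (mul_pos (sv2_pos hM) (norm_pos_iff.2 hv)).trans_le (sv2_le_norm_act M v)

theorem map_submodule_eq_iff {M : Mat2} (hM : M.det ≠ 0) (l m : ℙ ℝ Plane) :
    l.submodule.map (Matrix.toEuclideanLin M) = m.submodule ↔
      cross (dir m) (act M (dir l)) = 0 := by
  rw [submodule_eq_span_dir l, Submodule.map_span, Set.image_singleton,
    ← submodule_eq_iff_cross (act_ne_zero hM (dir_ne_zero l)), eq_comm]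
  rfl

end

noncomputable section

/-! ### More on lines and vectors -/

theorem unit_decomp {u : Plane} (hu : ‖u‖ = 1) (v : Plane) :
    ‖v - (inner ℝ u v : ℝ) • u‖ = |cross u v| := by
  have h := cross_sq_add_inner_sq u v
  rw [hu] at h
  have h2 : ‖v - (inner ℝ u v : ℝ) • u‖ ^ 2 = |cross u v| ^ 2 := by
    rw [norm_sub_sq_real, norm_smul, hu, inner_smul_right, real_inner_comm u v, sq_abs]
    simp only [Real.norm_eq_abs, mul_one, sq_abs]
    nlinarith
  exact (pow_left_inj₀ (norm_nonneg _) (abs_nonneg _) two_ne_zero).mp h2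

theorem norm_act_le_add_cross (M : Mat2) {u v : Plane} (hu : ‖u‖ = 1) (hv : ‖v‖ = 1) :
    ‖act M v‖ ≤ ‖act M u‖ + sv1 M * |cross u v| := by
  have e : v = (inner ℝ u v : ℝ) • u + (v - (inner ℝ u v : ℝ) • u) := by abel
  have hi : |(inner ℝ u v : ℝ)| ≤ 1 := by
    have := abs_real_inner_le_norm u v
    rwa [hu, hv, mul_one] at this
  calc ‖act M v‖ = ‖act M ((inner ℝ u v : ℝ) • u + (v - (inner ℝ u v : ℝ) • u))‖ := by rw [← e]
    _ ≤ ‖act M ((inner ℝ u v : ℝ) • u)‖ + ‖act M (v - (inner ℝ u v : ℝ) • u)‖ := by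
        rw [map_add]; exact norm_add_le _ _
    _ ≤ ‖act M u‖ + sv1 M * |cross u v| := by
        rw [map_smul, norm_smul, Real.norm_eq_abs]
        have h2 := norm_act_le_sv1 M (v - (inner ℝ u v : ℝ) • u)
        rw [unit_decomp hu] at h2
        have := mul_le_mul_of_nonneg_right hi (norm_nonneg (act M u))
        linarith

theorem abs_det_mul_cross_le (M : Mat2) (u v : Plane) :
    |M.det| * |cross u v| ≤ ‖act M u‖ * ‖act M v‖ := by
  rw [← abs_mul, ← cross_act]; exact abs_cross_le _ _

theorem sv2_mul_le (M L : Mat2) : sv2 (M * L) ≤ sv1 M * sv2 L := by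
  obtain ⟨u, hu, h⟩ := exists_norm_act_eq_sv2 L
  have h1 := sv2_le_norm_act (M * L) u
  rw [hu, mul_one, act_mul] at h1
  exact h1.trans (h ▸ norm_act_le_sv1 M (act L u))

theorem sv2_mul_ge (M L : Mat2) : sv2 M * sv2 L ≤ sv2 (M * L) := by
  obtain ⟨u, hu, h⟩ := exists_norm_act_eq_sv2 (M * L)
  rw [← h, act_mul]
  have h1 := sv2_le_norm_act L u
  rw [hu, mul_one] at h1
  exact (mul_le_mul_of_nonneg_left h1 (sv2_nonneg M)).trans (sv2_le_norm_act M _)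

theorem act_inv_act {M : Mat2} (hM : M.det ≠ 0) (v : Plane) : act M⁻¹ (act M v) = v := by
  rw [← act_mul, Matrix.nonsing_inv_mul _ (isUnit_iff_ne_zero.2 hM), act_one]

theorem act_act_inv {M : Mat2} (hM : M.det ≠ 0) (v : Plane) : act M (act M⁻¹ v) = v := by
  rw [← act_mul, Matrix.mul_nonsing_inv _ (isUnit_iff_ne_zero.2 hM), act_one]

theorem det_inv_ne_zero {M : Mat2} (hM : M.det ≠ 0) : (M⁻¹).det ≠ 0 := by
  rw [Matrix.det_nonsing_inv, Ring.inverse_eq_inv']; exact inv_ne_zero hM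

theorem sv1_inv {M : Mat2} (hM : M.det ≠ 0) : sv1 M⁻¹ = (sv2 M)⁻¹ := by
  have h2 := sv2_pos hM
  apply le_antisymm
  · obtain ⟨u, hu, h⟩ := exists_norm_act_eq_sv1 M⁻¹
    rw [← h]
    have := sv2_le_norm_act M (act M⁻¹ u)
    rw [act_act_inv hM, hu] at this
    rw [inv_eq_one_div (sv2 M), le_div_iff₀ h2]; linarith
  · obtain ⟨u, hu, h⟩ := exists_norm_act_eq_sv2 M
    have := norm_act_le_sv1 M⁻¹ (act M u)
    rw [act_inv_act hM, hu, h] at this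
    rw [← one_div, div_le_iff₀ h2]; exact this

theorem sv2_inv {M : Mat2} (hM : M.det ≠ 0) : sv2 M⁻¹ = (sv1 M)⁻¹ := by
  have h := sv1_inv (det_inv_ne_zero hM)
  rw [Matrix.nonsing_inv_nonsing_inv _ (isUnit_iff_ne_zero.2 hM)] at h
  rw [h, inv_inv]

theorem norm_act_of_cross_eq_zero (M : Mat2) {u v : Plane} (hu : ‖u‖ = 1) (h : cross u v = 0) :
    ‖act M v‖ = ‖v‖ * ‖act M u‖ := by
  have e := exists_smul_of_cross_eq_zero hu h
  have : ‖v‖ = |(inner ℝ u v : ℝ)| := by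
    conv_lhs => rw [e, norm_smul, hu, mul_one, Real.norm_eq_abs]
  rw [this]
  conv_lhs => rw [e, map_smul, norm_smul, Real.norm_eq_abs]

theorem dist_lineThrough_le {u v : Plane} (hu : ‖u‖ = 1) (hv : ‖v‖ = 1) (hu0 : u ≠ 0)
    (hv0 : v ≠ 0) : dist (lineThrough u hu0) (lineThrough v hv0) = |cross u v| := by
  rw [dist_eq_abs_cross]
  have neg_l : ∀ a b : Plane, cross (-a) b = -cross a b := fun a b => by
    simp only [cross, PiLp.neg_apply]; ring
  have neg_r : ∀ a b : Plane, cross a (-b) = -cross a b := fun a b => by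
    simp only [cross, PiLp.neg_apply]; ring
  rcases dir_lineThrough u hu hu0 with h1 | h1 <;> rcases dir_lineThrough v hv hv0 with h2 | h2 <;>
    simp [h1, h2, neg_l, neg_r]

theorem dist_dir_lineThrough {v : Plane} (hv : ‖v‖ = 1) (hv0 : v ≠ 0) (l : ℙ ℝ Plane) :
    dist l (lineThrough v hv0) = |cross (dir l) v| := by
  rw [dist_eq_abs_cross]
  have neg_r : ∀ a b : Plane, cross a (-b) = -cross a b := fun a b => by
    simp only [cross, PiLp.neg_apply]; ring
  rcases dir_lineThrough v hv hv0 with h2 | h2 <;> simp [h2, neg_r]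

theorem lineThrough_dir (l : ℙ ℝ Plane) : lineThrough (dir l) (dir_ne_zero l) = l := by
  rw [eq_comm, ← dist_eq_zero, dist_dir_lineThrough (norm_dir l), cross_same, abs_zero]

/-- The projective line is a continuous image of the unit circle. Compactness supplies the
completeness needed for the limits of most contracted lines. -/
instance instCompactSpaceLines : CompactSpace (ℙ ℝ Plane) := by
  have hne : ∀ u : Metric.sphere (0 : Plane) 1, (u : Plane) ≠ 0 := fun u => by
    rw [← norm_ne_zero_iff, mem_sphere_zero_iff_norm.1 u.2]; exact one_ne_zero
  let f : Metric.sphere (0 : Plane) 1 → ℙ ℝ Plane := fun u => lineThrough u (hne u)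
  have hf : Continuous f := by
    refine (LipschitzWith.of_dist_le_mul (K := 1) fun u v => ?_).continuous
    have hu := mem_sphere_zero_iff_norm.1 u.2
    have hv := mem_sphere_zero_iff_norm.1 v.2
    rw [dist_lineThrough_le hu hv, NNReal.coe_one, one_mul, Subtype.dist_eq,
      dist_comm, dist_eq_norm]
    have := abs_cross_le (u : Plane) (v - u)
    rwa [cross_sub_right, cross_same, sub_zero, hu, one_mul] at this
  have hs : Function.Surjective f := fun l =>
    ⟨⟨dir l, mem_sphere_zero_iff_norm.2 (norm_dir l)⟩, lineThrough_dir l⟩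
  refine ⟨?_⟩
  rw [← hs.range_eq]
  exact isCompact_range hf

/-- A unit vector contracted the most by the matrix. -/
def contractedVec (M : Mat2) : Plane := (exists_norm_act_eq_sv2 M).choose

theorem norm_contractedVec (M : Mat2) : ‖contractedVec M‖ = 1 :=
  (exists_norm_act_eq_sv2 M).choose_spec.1

theorem norm_act_contractedVec (M : Mat2) : ‖act M (contractedVec M)‖ = sv2 M :=
  (exists_norm_act_eq_sv2 M).choose_spec.2

theorem contractedVec_ne_zero (M : Mat2) : contractedVec M ≠ 0 := by
  rw [← norm_ne_zero_iff, norm_contractedVec]; exact one_ne_zero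

/-- A line contracted the most by the matrix. -/
def contractedLine (M : Mat2) : ℙ ℝ Plane := lineThrough (contractedVec M) (contractedVec_ne_zero M)

/-- The component of a vector transverse to the most contracted direction is stretched by the full
factor α₁: divide the area inequality by α₂. A vector with a short image must therefore be close to
that direction. -/
theorem sv1_mul_cross_contractedVec_le {M : Mat2} (hM : M.det ≠ 0) (v : Plane) :
    sv1 M * |cross (contractedVec M) v| ≤ ‖act M v‖ := by
  have h := abs_det_mul_cross_le M (contractedVec M) v
  rw [norm_act_contractedVec, ← sv1_mul_sv2] at h
  have := sv2_pos hM
  exact le_of_mul_le_mul_left (by linarith) this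

/-! ### One-sided cocycles -/

variable {N : ℕ}

/-- The shift by `n` of a one-sided word. -/
def shiftBy (n : ℕ) (j : ℕ → Fin N) : ℕ → Fin N := fun k => j (n + k)

/-- The product `A_{j_{n-1}} ⋯ A_{j_0}` for a one-sided word. -/
def coc (A : Fin N → Mat2) (j : ℕ → Fin N) : ℕ → Mat2
  | 0 => 1
  | n + 1 => A (j n) * coc A j n

theorem shiftBy_shiftBy (m n : ℕ) (j : ℕ → Fin N) :
    shiftBy m (shiftBy n j) = shiftBy (n + m) j := by
  funext k; simp [shiftBy, add_assoc]

theorem coc_add (A : Fin N → Mat2) (j : ℕ → Fin N) (m n : ℕ) :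
    coc A j (m + n) = coc A (shiftBy m j) n * coc A j m := by
  induction n with
  | zero => simp [coc]
  | succ n ih => rw [← add_assoc, coc, ih, coc, Matrix.mul_assoc]; rfl

theorem coc_one (A : Fin N → Mat2) (j : ℕ → Fin N) : coc A j 1 = A (j 0) := by
  simp [coc]

theorem coc_succ' (A : Fin N → Mat2) (j : ℕ → Fin N) (n : ℕ) :
    coc A j (n + 1) = coc A (shiftBy 1 j) n * A (j 0) := by
  rw [add_comm, coc_add, coc_one]

theorem coc_congr (A : Fin N → Mat2) {j j' : ℕ → Fin N} {n : ℕ} (h : ∀ k < n, j k = j' k) :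
    coc A j n = coc A j' n := by
  induction n with
  | zero => rfl
  | succ n ih => rw [coc, coc, ih fun k hk => h k (by omega), h n (by omega)]

theorem det_coc_ne_zero {A : Fin N → Mat2} (hA : ∀ i, (A i).det ≠ 0) (j : ℕ → Fin N) (n : ℕ) :
    (coc A j n).det ≠ 0 := by
  induction n with
  | zero => simp [coc]
  | succ n ih => rw [coc, Matrix.det_mul]; exact mul_ne_zero (hA _) ih

/-- Quantitative domination of the products `A_{j_{n-1}} ⋯ A_{j_0}`. -/
structure UniformlyDominated (A : Fin N → Mat2) (L C δ : ℝ) : Prop where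
  det_ne : ∀ i, (A i).det ≠ 0
  one_le : 1 ≤ L
  sv1_le : ∀ i, sv1 (A i) ≤ L
  le_sv2 : ∀ i, 1 ≤ L * sv2 (A i)
  C_pos : 0 < C
  δ_pos : 0 < δ
  dom : ∀ j n, sv2 (coc A j n) ≤ C * Real.exp (-δ * n) * sv1 (coc A j n)

/-- The limit of the most contracted lines. -/
def slowLine (A : Fin N → Mat2) (j : ℕ → Fin N) : ℙ ℝ Plane :=
  limUnder atTop fun n => contractedLine (coc A j n)

namespace UniformlyDominated

variable {A : Fin N → Mat2} {L C δ : ℝ}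

theorem exp_lt_one (h : UniformlyDominated A L C δ) : Real.exp (-δ) < 1 := by
  rw [Real.exp_lt_one_iff]; linarith [h.δ_pos]

theorem exp_pow (n : ℕ) : Real.exp (-δ * n) = Real.exp (-δ) ^ n := by
  rw [← Real.exp_nat_mul, mul_comm]

/-- One more factor changes lengths by at most L, so the vector contracted most by n+1 factors has
an image of length at most L² α₂ under the first n. Its angle with the direction contracted most by
those n is then at most L² α₂/α₁, which domination makes exponentially small. -/
theorem dist_contractedLine_succ (h : UniformlyDominated A L C δ) (j : ℕ → Fin N) (n : ℕ) :
    dist (contractedLine (coc A j n)) (contractedLine (coc A j (n + 1))) ≤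
      L ^ 2 * C * Real.exp (-δ) ^ n := by
  have hd := det_coc_ne_zero h.det_ne j n
  set M := coc A j n
  set u := contractedVec (coc A j (n + 1))
  have hL : 0 < L := lt_of_lt_of_le one_pos h.one_le
  have h1 : ‖act M u‖ ≤ L ^ 2 * sv2 M := by
    have e1 : ‖act (A (j n)) (act M u)‖ = sv2 (coc A j (n + 1)) := by
      rw [← act_mul]; exact norm_act_contractedVec _
    have e2 := sv2_le_norm_act (A (j n)) (act M u)
    have e3 : sv2 (coc A j (n + 1)) ≤ L * sv2 M :=
      (sv2_mul_le _ _).trans (mul_le_mul_of_nonneg_right (h.sv1_le _) (sv2_nonneg _))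
    rw [e1] at e2
    calc ‖act M u‖ = 1 * ‖act M u‖ := (one_mul _).symm
      _ ≤ (L * sv2 (A (j n))) * ‖act M u‖ :=
        mul_le_mul_of_nonneg_right (h.le_sv2 _) (norm_nonneg _)
      _ = L * (sv2 (A (j n)) * ‖act M u‖) := by ring
      _ ≤ L * (L * sv2 M) := mul_le_mul_of_nonneg_left (e2.trans e3) hL.le
      _ = _ := by ring
  have h2 := sv1_mul_cross_contractedVec_le hd u
  have h3 := h.dom j n
  have hs := sv1_pos hd
  rw [contractedLine, contractedLine,
    dist_lineThrough_le (norm_contractedVec _) (norm_contractedVec _), ← exp_pow]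
  refine le_of_mul_le_mul_left ?_ hs
  calc _ ≤ L ^ 2 * sv2 M := h2.trans h1
    _ ≤ L ^ 2 * (C * Real.exp (-δ * n) * sv1 M) := by gcongr
    _ = _ := by ring

/-- The constant in the rate of convergence to `slowLine`. -/
def rate (L C δ : ℝ) : ℝ := L ^ 2 * C / (1 - Real.exp (-δ))

theorem rate_nonneg (h : UniformlyDominated A L C δ) : 0 ≤ rate L C δ := by
  have := h.C_pos
  exact div_nonneg (by positivity) (by linarith [h.exp_lt_one])

theorem tendsto_slowLine (h : UniformlyDominated A L C δ) (j : ℕ → Fin N) :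
    Tendsto (fun n => contractedLine (coc A j n)) atTop (𝓝 (slowLine A j)) :=
  tendsto_nhds_limUnder (cauchySeq_tendsto_of_complete
    (cauchySeq_of_le_geometric _ _ h.exp_lt_one (h.dist_contractedLine_succ j)))

theorem dist_slowLine_le (h : UniformlyDominated A L C δ) (j : ℕ → Fin N) (n : ℕ) :
    dist (contractedLine (coc A j n)) (slowLine A j) ≤ rate L C δ * Real.exp (-δ * n) := by
  have := dist_le_of_le_geometric_of_tendsto _ _ h.exp_lt_one (h.dist_contractedLine_succ j)
    (h.tendsto_slowLine j) n
  rw [exp_pow, rate]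
  exact this.trans_eq (by ring)

theorem dist_slowLine_slowLine_le (h : UniformlyDominated A L C δ) {j j' : ℕ → Fin N} {n : ℕ}
    (hj : ∀ k < n, j k = j' k) :
    dist (slowLine A j) (slowLine A j') ≤ 2 * rate L C δ * Real.exp (-δ * n) := by
  have h1 := h.dist_slowLine_le j n
  have h2 := h.dist_slowLine_le j' n
  rw [← coc_congr A hj] at h2
  linarith [dist_triangle_left (slowLine A j) (slowLine A j') (contractedLine (coc A j n))]

/-- A preliminary bound that only compares with α₁. Together with `cross_slowLine_eq_zero` it
characterizes the limit line; the sharp comparison with α₂ comes from `exists_slowNorm_le_sv2`. -/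
theorem norm_act_slowLine_le (h : UniformlyDominated A L C δ) (j : ℕ → Fin N) (n : ℕ) :
    ‖act (coc A j n) (dir (slowLine A j))‖ ≤
      (C + rate L C δ) * Real.exp (-δ * n) * sv1 (coc A j n) := by
  have h1 := norm_act_le_add_cross (coc A j n) (norm_contractedVec (coc A j n))
    (norm_dir (slowLine A j))
  have h2 := h.dist_slowLine_le j n
  rw [dist_comm, contractedLine, dist_dir_lineThrough (norm_contractedVec _), abs_cross_comm] at h2
  rw [norm_act_contractedVec] at h1
  have h3 := h.dom j n
  have := mul_le_mul_of_nonneg_left h2 (sv1_nonneg (coc A j n))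
  nlinarith

/-- A vector whose images are exponentially shorter than α₁ makes an angle tending to 0 with the
most contracted lines, hence spans their limit. Invariance of the limit line follows, since the
image of such a vector has the same property for the shifted word. -/
theorem cross_slowLine_eq_zero (h : UniformlyDominated A L C δ) (j : ℕ → Fin N) {v : Plane}
    {K : ℝ} (hv : ∀ n : ℕ, ‖act (coc A j n) v‖ ≤ K * Real.exp (-δ * n) * sv1 (coc A j n)) :
    cross (dir (slowLine A j)) v = 0 := by
  by_cases hv0 : v = 0
  · simp [hv0, cross]
  have hnv : 0 < ‖v‖ := norm_pos_iff.2 hv0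
  set w : Plane := ‖v‖⁻¹ • v with hw
  have hvw : v = ‖v‖ • w := by rw [hw, smul_smul, mul_inv_cancel₀ hnv.ne', one_smul]
  have hw1 : ‖w‖ = 1 := by rw [hw, norm_smul, norm_inv, norm_norm, inv_mul_cancel₀ hnv.ne']
  have hw0 : w ≠ 0 := by rw [← norm_ne_zero_iff, hw1]; exact one_ne_zero
  have hlim : Tendsto (fun n => contractedLine (coc A j n)) atTop (𝓝 (lineThrough w hw0)) := by
    rw [tendsto_iff_dist_tendsto_zero]
    refine squeeze_zero (fun _ => dist_nonneg) (g := fun n => ‖v‖⁻¹ * K * Real.exp (-δ) ^ n)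
      (fun n => ?_) ?_
    · rw [contractedLine, dist_lineThrough_le (norm_contractedVec _) hw1, ← exp_pow, hw,
        cross_smul_right, abs_mul, abs_inv, abs_norm, mul_assoc]
      refine mul_le_mul_of_nonneg_left ?_ (by positivity)
      have hd := det_coc_ne_zero h.det_ne j n
      refine le_of_mul_le_mul_left ?_ (sv1_pos hd)
      exact (sv1_mul_cross_contractedVec_le hd v).trans ((hv n).trans_eq (by ring))
    · simpa using (tendsto_pow_atTop_nhds_zero_of_lt_one (Real.exp_pos _).le
        h.exp_lt_one).const_mul (‖v‖⁻¹ * K)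
  have := tendsto_nhds_unique (h.tendsto_slowLine j) hlim
  rw [this, hvw, cross_smul_right, cross_dir_lineThrough, mul_zero]

theorem slowLine_invariant (h : UniformlyDominated A L C δ) (j : ℕ → Fin N) :
    cross (dir (slowLine A (shiftBy 1 j))) (act (A (j 0)) (dir (slowLine A j))) = 0 := by
  have hL : 0 < L := lt_of_lt_of_le one_pos h.one_le
  have hK : 0 ≤ C + rate L C δ := add_nonneg h.C_pos.le h.rate_nonneg
  refine h.cross_slowLine_eq_zero _ (K := (C + rate L C δ) * L) fun n => ?_
  rw [← act_mul, ← coc_succ']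
  have h1 := h.norm_act_slowLine_le j (n + 1)
  have h2 : sv1 (coc A j (n + 1)) ≤ sv1 (coc A (shiftBy 1 j) n) * L := by
    rw [coc_succ']
    exact (sv1_mul_le _ _).trans (mul_le_mul_of_nonneg_left (h.sv1_le _) (sv1_nonneg _))
  have h3 : Real.exp (-δ * (n + 1 : ℕ)) ≤ Real.exp (-δ * n) := by
    apply Real.exp_le_exp.2; push_cast; nlinarith [h.δ_pos]
  calc _ ≤ _ := h1
    _ ≤ (C + rate L C δ) * Real.exp (-δ * n) * (sv1 (coc A (shiftBy 1 j) n) * L) := by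
        gcongr
        exact sv1_nonneg _
    _ = _ := by ring

theorem slowLine_invariant_coc (h : UniformlyDominated A L C δ) (j : ℕ → Fin N) (n : ℕ) :
    cross (dir (slowLine A (shiftBy n j))) (act (coc A j n) (dir (slowLine A j))) = 0 := by
  induction n with
  | zero =>
    have : shiftBy 0 j = j := by funext k; simp [shiftBy]
    rw [this, coc, act_one, cross_same]
  | succ n ih =>
    have h1 := h.slowLine_invariant (shiftBy n j)
    have h2 := exists_smul_of_cross_eq_zero (norm_dir _) ih
    rw [coc, act_mul, h2, map_smul, cross_smul_right]
    rw [shiftBy_shiftBy] at h1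
    have h3 : shiftBy n j 0 = j n := rfl
    rw [h3] at h1
    rw [h1, mul_zero]

/-- The norm of the product along the slow line. -/
def slowNorm (A : Fin N → Mat2) (j : ℕ → Fin N) (n : ℕ) : ℝ :=
  ‖act (coc A j n) (dir (slowLine A j))‖

theorem slowNorm_pos (h : UniformlyDominated A L C δ) (j : ℕ → Fin N) (n : ℕ) :
    0 < slowNorm A j n :=
  norm_pos_iff.2 (act_ne_zero (det_coc_ne_zero h.det_ne j n) (dir_ne_zero _))

/-- Exact multiplicativity, because the slow line is invariant and one-dimensional. Singular values
acquire it up to bounded factors only through comparison with this quantity. -/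
theorem slowNorm_add (h : UniformlyDominated A L C δ) (j : ℕ → Fin N) (m n : ℕ) :
    slowNorm A j (m + n) = slowNorm A j m * slowNorm A (shiftBy m j) n := by
  rw [slowNorm, coc_add, act_mul,
    norm_act_of_cross_eq_zero _ (norm_dir _) (h.slowLine_invariant_coc j m)]
  rfl

end UniformlyDominated

end

/-! ### Contraction along the slow line compared with the determinant -/

noncomputable section

variable {N : ℕ}

namespace UniformlyDominated

variable {A : Fin N → Mat2} {L C δ : ℝ}

theorem tendsto_poly_mul_exp (a b : ℝ) {c : ℝ} (hc : 0 < c) :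
    Tendsto (fun k : ℕ => (a * k + b) ^ 2 * Real.exp (-c * k)) atTop (𝓝 0) := by
  have key : ∀ d : ℕ, Tendsto (fun k : ℕ => (k : ℝ) ^ d * Real.exp (-c * k)) atTop (𝓝 0) := by
    intro d
    have h1 := (Real.tendsto_pow_mul_exp_neg_atTop_nhds_zero d).comp
      ((tendsto_natCast_atTop_atTop (R := ℝ)).const_mul_atTop hc)
    have h2 := h1.const_mul ((c ^ d)⁻¹)
    rw [mul_zero] at h2
    refine h2.congr fun k => ?_
    have : c ^ d ≠ 0 := by positivity
    simp only [Function.comp_apply, mul_pow, neg_mul]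
    field_simp
  have h := (((key 2).const_mul (a ^ 2)).add ((key 1).const_mul (2 * a * b))).add
    ((key 0).const_mul (b ^ 2))
  simp only [mul_zero, add_zero] at h
  refine h.congr fun k => ?_
  ring

/-- In the basis formed by u and its orthogonal, W is triangular with diagonal entries of modulus x
and z. The off-diagonal entry of a power accumulates linearly, so powers exceed those of the
spectral radius by a linear factor only. -/
theorem sv1_pow_le {W : Mat2} {u : Plane} {x z : ℝ} (hu : ‖u‖ = 1) (hx : 0 < x)
    (hcross : cross u (act W u) = 0) (hxn : ‖act W u‖ = x) (hz : x * z = |W.det|) {s : ℝ}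
    (hxs : x ≤ s) (hzs : z ≤ s) (k : ℕ) :
    sv1 (W ^ k) ≤ (sv1 W / s * k + 2) * s ^ k := by
  have hs : 0 < s := hx.trans_le hxs
  obtain ⟨v, hv, hvk⟩ := exists_norm_act_eq_sv1 (W ^ k)
  have hWu := exists_smul_of_cross_eq_zero hu hcross
  set lam : ℝ := inner ℝ u (act W u) with hlam
  have hlx : |lam| = x := by rw [← hxn, hWu, norm_smul, hu, mul_one, Real.norm_eq_abs]
  have hz0 : 0 ≤ z := by
    by_contra hneg
    have := mul_neg_of_pos_of_neg hx (not_le.1 hneg)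
    rw [hz] at this
    exact absurd (abs_nonneg W.det) (not_le.2 this)
  -- the two components
  have step_c : ∀ y : Plane, |cross u (act W y)| = z * |cross u y| := by
    intro y
    have h1 := cross_act W u y
    rw [hWu, cross_smul_left] at h1
    have h2 := congrArg abs h1
    rw [abs_mul, abs_mul, hlx, ← hz] at h2
    have h3 : x * |cross u (act W y)| = x * (z * |cross u y|) := by rw [h2]; ring
    exact mul_left_cancel₀ hx.ne' h3
  have step_d : ∀ y : Plane, |(inner ℝ u (act W y) : ℝ)| ≤
      x * |(inner ℝ u y : ℝ)| + sv1 W * |cross u y| := by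
    intro y
    have e : act W y = (inner ℝ u y : ℝ) • act W u + act W (y - (inner ℝ u y : ℝ) • u) := by
      rw [map_sub, map_smul]; abel
    have h1 := norm_act_le_sv1 W (y - (inner ℝ u y : ℝ) • u)
    rw [unit_decomp hu] at h1
    have h2 := abs_real_inner_le_norm u (act W (y - (inner ℝ u y : ℝ) • u))
    rw [hu, one_mul] at h2
    rw [e, inner_add_right, inner_smul_right, ← hlam]
    refine (abs_add_le _ _).trans ?_
    rw [abs_mul, hlx]
    linarith
  have hc0 : |cross u v| ≤ 1 := by
    have := abs_cross_le u v; rwa [hu, hv, mul_one] at this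
  have hd0 : |(inner ℝ u v : ℝ)| ≤ 1 := by
    have := abs_real_inner_le_norm u v; rwa [hu, hv, mul_one] at this
  have hc : ∀ k : ℕ, |cross u (act (W ^ k) v)| ≤ s ^ k := by
    intro k
    induction k with
    | zero => simpa [act_one] using hc0
    | succ k ih =>
      rw [pow_succ', act_mul, step_c, pow_succ']
      exact mul_le_mul hzs ih (abs_nonneg _) hs.le
  have hd : ∀ k : ℕ, |(inner ℝ u (act (W ^ k) v) : ℝ)| ≤ (sv1 W / s * k + 1) * s ^ k := by
    intro k
    induction k with
    | zero => simpa [act_one] using hd0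
    | succ k ih =>
      rw [pow_succ', act_mul]
      refine (step_d _).trans ?_
      have h1 : x * |(inner ℝ u (act (W ^ k) v) : ℝ)| ≤ s * ((sv1 W / s * k + 1) * s ^ k) :=
        mul_le_mul hxs ih (abs_nonneg _) hs.le
      have h2 : sv1 W * |cross u (act (W ^ k) v)| ≤ sv1 W * s ^ k :=
        mul_le_mul_of_nonneg_left (hc k) (sv1_nonneg W)
      have h3 : (sv1 W / s * ((k + 1 : ℕ) : ℝ) + 1) * s ^ (k + 1) =
          s * ((sv1 W / s * k + 1) * s ^ k) + sv1 W * s ^ k := by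
        push_cast; field_simp; ring
      rw [h3]; linarith
  have h1 : ‖act (W ^ k) v‖ ≤ |(inner ℝ u (act (W ^ k) v) : ℝ)| + |cross u (act (W ^ k) v)| := by
    have := norm_add_le ((inner ℝ u (act (W ^ k) v) : ℝ) • u)
      (act (W ^ k) v - (inner ℝ u (act (W ^ k) v) : ℝ) • u)
    rw [unit_decomp hu, norm_smul, hu, mul_one, Real.norm_eq_abs] at this
    simpa using this
  rw [← hvk]
  have := hc k
  have := hd k
  linarith

theorem coc_periodic {j : ℕ → Fin N} {n : ℕ} (hj : shiftBy n j = j) (k : ℕ) :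
    coc A j (n * k) = coc A j n ^ k := by
  induction k with
  | zero => simp [coc]
  | succ k ih =>
    have hs : ∀ k, shiftBy (n * k) j = j := by
      intro k
      induction k with
      | zero => funext i; simp [shiftBy]
      | succ k ih => rw [Nat.mul_succ, ← shiftBy_shiftBy, ih, hj]
    rw [Nat.mul_succ, coc_add, hs, ih, pow_succ']

/-- Over a periodic word the slow line is an eigenline of W, with eigenvalues of modulus x on it and
z = |det W|/x. If x ≥ z, then α₁(W^k) would be about x^k, too small for the exponential gap along
the slow line. So z is the spectral radius, and domination of W^k reads (xz)^k ≤ C exp(-δnk) z^(2k)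
up to a polynomial. Letting k tend to infinity removes all constants. -/
theorem slowNorm_sq_le_of_periodic (h : UniformlyDominated A L C δ) {j : ℕ → Fin N} {n : ℕ}
    (hn : 0 < n) (hj : shiftBy n j = j) :
    slowNorm A j n ^ 2 ≤ Real.exp (-δ * n) * |(coc A j n).det| := by
  set W := coc A j n with hW
  set u := dir (slowLine A j) with hu_def
  have hu : ‖u‖ = 1 := norm_dir _
  have hx := h.slowNorm_pos j n
  set x := slowNorm A j n with hx_def
  have hWd : W.det ≠ 0 := det_coc_ne_zero h.det_ne j n
  have hcross : cross u (act W u) = 0 := by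
    have := h.slowLine_invariant_coc j n
    rwa [hj] at this
  obtain ⟨z, hz⟩ : ∃ z, x * z = |W.det| := ⟨|W.det| / x, by field_simp⟩
  have hz0 : 0 < z := by
    have := abs_pos.2 hWd
    rw [← hz] at this
    exact pos_of_mul_pos_right this hx.le
  have hδn : 0 < δ * n := mul_pos h.δ_pos (by exact_mod_cast hn)
  have hpow : ∀ k : ℕ, slowNorm A j (n * k) = x ^ k := by
    intro k
    induction k with
    | zero => simp [slowNorm, coc, norm_dir]
    | succ k ih =>
      rw [Nat.mul_succ, add_comm, h.slowNorm_add, hj, ih, pow_succ']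
  have hexp : ∀ k : ℕ, Real.exp (-δ * ((n * k : ℕ) : ℝ)) = Real.exp (-(δ * n) * k) := by
    intro k; congr 1; push_cast; ring
  have hdet : ∀ k : ℕ, |(W ^ k).det| = (x * z) ^ k := by
    intro k; rw [Matrix.det_pow, abs_pow, hz]
  -- the slow eigenvalue is the smaller one
  have hxz : x < z := by
    by_contra hle
    have hle := not_lt.1 hle
    have hb := fun k => sv1_pow_le hu hx hcross rfl hz le_rfl hle k
    set K := C + rate L C δ
    have hK : 0 < K := add_pos_of_pos_of_nonneg h.C_pos h.rate_nonneg
    have h1 : ∀ k : ℕ, 1 ≤ K * ((sv1 W / x * k + 2) ^ 2 * Real.exp (-(δ * n) * k)) := by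
      intro k
      have h2 := h.norm_act_slowLine_le j (n * k)
      rw [hexp, coc_periodic hj] at h2
      have h3 : ‖act (W ^ k) u‖ = x ^ k := by rw [← hpow, slowNorm, coc_periodic hj]
      rw [h3] at h2
      have h4 : x ^ k ≤ K * Real.exp (-(δ * n) * k) * ((sv1 W / x * k + 2) * x ^ k) :=
        h2.trans (mul_le_mul_of_nonneg_left (hb k) (by positivity))
      have h5 : 0 < x ^ k := by positivity
      have h6 : 1 ≤ K * Real.exp (-(δ * n) * k) * (sv1 W / x * k + 2) := by
        refine le_of_mul_le_mul_right ?_ h5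
        rw [one_mul]
        exact h4.trans_eq (by ring)
      have h7 : (1:ℝ) ≤ sv1 W / x * k + 2 := by
        have : 0 ≤ sv1 W / x * k := by
          have := sv1_nonneg W
          positivity
        linarith
      calc (1:ℝ) ≤ K * Real.exp (-(δ * n) * k) * (sv1 W / x * k + 2) := h6
        _ ≤ K * Real.exp (-(δ * n) * k) * (sv1 W / x * k + 2) ^ 2 := by
            gcongr
            nlinarith
        _ = _ := by ring
    have h2 := (tendsto_poly_mul_exp (sv1 W / x) 2 hδn).const_mul K
    rw [mul_zero] at h2
    have := ge_of_tendsto' h2 h1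
    linarith
  have hb := fun k => sv1_pow_le hu hx hcross rfl hz hxz.le le_rfl k
  by_contra hcon
  rw [not_le, ← hz] at hcon
  -- then `x e^{δ n} > z`, contradicting domination
  have hgt : Real.exp (-(δ * n)) * z < x := by
    have e : Real.exp (-δ * n) = Real.exp (-(δ * n)) := by congr 1; ring
    rw [e] at hcon
    nlinarith
  set q := Real.log (x / (Real.exp (-(δ * n)) * z)) with hq
  have hpos : 0 < Real.exp (-(δ * n)) * z := by positivity
  have hq0 : 0 < q := Real.log_pos (by rw [one_lt_div hpos]; exact hgt)
  have hxq : x = Real.exp q * (Real.exp (-(δ * n)) * z) := by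
    rw [hq, Real.exp_log (by positivity)]; field_simp
  have h1 : ∀ k : ℕ, 1 ≤ C * ((sv1 W / z * k + 2) ^ 2 * Real.exp (-q * k)) := by
    intro k
    have h2 := h.dom j (n * k)
    rw [hexp, coc_periodic hj] at h2
    have h3 : (x * z) ^ k ≤ C * Real.exp (-(δ * n) * k) * sv1 (W ^ k) ^ 2 := by
      rw [← hdet, ← sv1_mul_sv2]
      calc sv1 (W ^ k) * sv2 (W ^ k) ≤ sv1 (W ^ k) * _ :=
            mul_le_mul_of_nonneg_left h2 (sv1_nonneg _)
        _ = _ := by ring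
    have h4 : sv1 (W ^ k) ^ 2 ≤ ((sv1 W / z * k + 2) * z ^ k) ^ 2 :=
      pow_le_pow_left₀ (sv1_nonneg _) (hb k) 2
    have hC := h.C_pos
    have h5 : (x * z) ^ k ≤
        C * Real.exp (-(δ * n) * k) * ((sv1 W / z * k + 2) * z ^ k) ^ 2 :=
      h3.trans (mul_le_mul_of_nonneg_left h4 (by positivity))
    have e1 : x ^ k = Real.exp (q * k) * Real.exp (-(δ * n) * k) * z ^ k := by
      have a1 : Real.exp (q * k) = Real.exp q ^ k := by rw [← Real.exp_nat_mul]; ring_nf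
      have a2 : Real.exp (-(δ * n) * k) = Real.exp (-(δ * n)) ^ k := by
        rw [← Real.exp_nat_mul]; ring_nf
      conv_lhs => rw [hxq]
      rw [mul_pow, mul_pow, a1, a2]; ring
    rw [mul_pow x z, e1] at h5
    have h6 : 0 < Real.exp (-(δ * n) * k) * (z ^ k) ^ 2 := by positivity
    have h7 : Real.exp (q * k) ≤ C * (sv1 W / z * k + 2) ^ 2 := by
      refine le_of_mul_le_mul_right ?_ h6
      calc _ = Real.exp (q * k) * Real.exp (-(δ * n) * k) * z ^ k * z ^ k := by ring
        _ ≤ _ := h5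
        _ = _ := by ring
    calc (1:ℝ) = Real.exp (q * k) * Real.exp (-q * k) := by
          rw [← Real.exp_add]; simp
      _ ≤ C * (sv1 W / z * k + 2) ^ 2 * Real.exp (-q * k) := by gcongr
      _ = _ := by ring
  have h2 := (tendsto_poly_mul_exp (sv1 W / z) 2 hq0).const_mul C
  rw [mul_zero] at h2
  have := ge_of_tendsto' h2 h1
  linarith

theorem slowNorm_one_le (h : UniformlyDominated A L C δ) {j j' : ℕ → Fin N} {n : ℕ}
    (hj : ∀ k < n + 1, j k = j' k) :
    slowNorm A j 1 ≤ slowNorm A j' 1 *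
      Real.exp (2 * L ^ 2 * rate L C δ * Real.exp (-δ * (n + 1 : ℕ))) := by
  have hL : 0 < L := lt_of_lt_of_le one_pos h.one_le
  have h1 := norm_act_le_add_cross (A (j 0)) (norm_dir (slowLine A j')) (norm_dir (slowLine A j))
  have h2 := h.dist_slowLine_slowLine_le hj
  rw [dist_comm, dist_eq_abs_cross] at h2
  have e1 : slowNorm A j 1 = ‖act (A (j 0)) (dir (slowLine A j))‖ := by rw [slowNorm, coc_one]
  have e2 : slowNorm A j' 1 = ‖act (A (j 0)) (dir (slowLine A j'))‖ := by
    rw [slowNorm, coc_one, hj 0 (by omega)]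
  rw [← e1, ← e2] at h1
  have h3 : 1 ≤ L * slowNorm A j' 1 := by
    have := sv2_le_norm_act (A (j 0)) (dir (slowLine A j'))
    rw [norm_dir, mul_one, ← e2] at this
    exact (h.le_sv2 (j 0)).trans (mul_le_mul_of_nonneg_left this hL.le)
  set ε := Real.exp (-δ * (n + 1 : ℕ))
  have hr := h.rate_nonneg
  have h4 : sv1 (A (j 0)) * |cross (dir (slowLine A j')) (dir (slowLine A j))| ≤
      L * (2 * rate L C δ * ε) := mul_le_mul (h.sv1_le _) h2 (abs_nonneg _) hL.le
  have h5 : L * (2 * rate L C δ * ε) ≤ slowNorm A j' 1 * (2 * L ^ 2 * rate L C δ * ε) := by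
    have : 0 ≤ L * (2 * rate L C δ * ε) := by positivity
    calc _ = 1 * (L * (2 * rate L C δ * ε)) := by ring
      _ ≤ (L * slowNorm A j' 1) * (L * (2 * rate L C δ * ε)) := by gcongr
      _ = _ := by ring
  have h6 := Real.add_one_le_exp (2 * L ^ 2 * rate L C δ * ε)
  have h7 := mul_le_mul_of_nonneg_left h6 (h.slowNorm_pos j' 1).le
  linarith

/-- Bounded distortion: at step k the words still share n-k symbols, so their slow lines, and the
logarithms of the one-step norms, differ by O(exp(-δ(n-k))), which is summable uniformly in n. -/
theorem slowNorm_le_of_agree (h : UniformlyDominated A L C δ) {j j' : ℕ → Fin N} {n : ℕ}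
    (hj : ∀ k < n, j k = j' k) :
    slowNorm A j n ≤ slowNorm A j' n *
      Real.exp (2 * L ^ 2 * rate L C δ / (Real.exp δ - 1)) := by
  have hE : 0 < Real.exp δ - 1 := by linarith [Real.add_one_le_exp δ, h.δ_pos]
  set c := 2 * L ^ 2 * rate L C δ with hc
  have hc0 : 0 ≤ c := by have := h.rate_nonneg; positivity
  -- The exponent is a geometric sum in closed form: adding the next error c·exp(-δ(n-k)) multiplies
  -- it by exactly exp δ.
  have key : ∀ k ≤ n, slowNorm A j k ≤ slowNorm A j' k *
      Real.exp (c / (Real.exp δ - 1) * Real.exp (-δ * (n - k))) := by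
    intro k hk
    induction k with
    | zero =>
      have : ∀ j : ℕ → Fin N, slowNorm A j 0 = 1 := fun j => by
        simp [slowNorm, coc, norm_dir]
      rw [this, this, one_mul]
      exact Real.one_le_exp (by positivity)
    | succ k ih =>
      have ih := ih (by omega)
      obtain ⟨m, rfl⟩ : ∃ m, n = k + (m + 1) := ⟨n - k - 1, by omega⟩
      have h1 := h.slowNorm_one_le (j := shiftBy k j) (j' := shiftBy k j') (n := m)
        (fun i hi => hj (k + i) (by omega))
      rw [h.slowNorm_add, h.slowNorm_add]
      rw [← hc] at h1
      calc slowNorm A j k * slowNorm A (shiftBy k j) 1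
          ≤ (slowNorm A j' k * _) * (slowNorm A (shiftBy k j') 1 * _) :=
            mul_le_mul ih h1 (h.slowNorm_pos _ _).le
              (mul_nonneg (h.slowNorm_pos _ _).le (Real.exp_pos _).le)
        _ = slowNorm A j' k * slowNorm A (shiftBy k j') 1 *
            Real.exp (c / (Real.exp δ - 1) * Real.exp (-δ * ((k + (m + 1) : ℕ) - k)) +
              c * Real.exp (-δ * (m + 1 : ℕ))) := by rw [Real.exp_add]; ring
        _ = _ := by
            congr 2
            have e1 : Real.exp (-δ * (((k + (m + 1) : ℕ) : ℝ) - ((k + 1 : ℕ) : ℝ))) =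
                Real.exp δ * Real.exp (-δ * (m + 1 : ℕ)) := by
              rw [← Real.exp_add]; congr 1; push_cast; ring
            have e2 : Real.exp (-δ * (((k + (m + 1) : ℕ) : ℝ) - (k : ℝ))) =
                Real.exp (-δ * (m + 1 : ℕ)) := by congr 1; push_cast; ring
            rw [e1, e2]; field_simp; ring
  have := key n le_rfl
  simpa using this

/-- Along the slow line, the products are exponentially smaller than the square root of the
determinant. -/
theorem exists_slowNorm_sq_le (h : UniformlyDominated A L C δ) :
    ∃ K, 1 ≤ K ∧ ∀ j n, slowNorm A j n ^ 2 ≤ K * Real.exp (-δ * n) * |(coc A j n).det| := by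
  set c := Real.exp (2 * L ^ 2 * rate L C δ / (Real.exp δ - 1)) with hc
  have hE : 0 < Real.exp δ - 1 := by linarith [Real.add_one_le_exp δ, h.δ_pos]
  have hc1 : 1 ≤ c := by
    have := h.rate_nonneg
    exact Real.one_le_exp (by positivity)
  refine ⟨c ^ 2, one_le_pow₀ hc1, fun j n => ?_⟩
  rcases Nat.eq_zero_or_pos n with rfl | hn
  · simpa [slowNorm, coc, norm_dir, abs_of_pos (lt_of_lt_of_le one_pos hc1)] using hc1
  -- The n-periodic word with the same first n symbols has the same product of length n, hence the
  -- same determinant, and by bounded distortion a comparable slow norm.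
  let jp : ℕ → Fin N := fun k => j (k % n)
  have hjp : ∀ k < n, j k = jp k := fun k hk => by simp [jp, Nat.mod_eq_of_lt hk]
  have hper : shiftBy n jp = jp := by funext k; simp [jp, shiftBy]
  have h1 := h.slowNorm_le_of_agree hjp
  have h2 := h.slowNorm_sq_le_of_periodic hn hper
  rw [coc_congr A hjp]
  calc slowNorm A j n ^ 2 ≤ (slowNorm A jp n * c) ^ 2 :=
        pow_le_pow_left₀ (h.slowNorm_pos _ _).le h1 2
    _ = c ^ 2 * slowNorm A jp n ^ 2 := by ring
    _ ≤ c ^ 2 * (Real.exp (-δ * n) * |(coc A jp n).det|) := by gcongr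
    _ = _ := by ring

end UniformlyDominated

end

/-! ### The invariant splitting over two-sided words and its uniqueness -/

noncomputable section

variable {N : ℕ}

theorem coc_eq_prod (A : Fin N → Mat2) (j : ℕ → Fin N) (n : ℕ) :
    coc A j n = ((((List.range n).map j).reverse).map A).prod := by
  induction n with
  | zero => simp [coc]
  | succ n ih => simp [coc, ih, List.range_succ]

theorem wordProd_eq_prod (A : Fin N → Mat2) (j : ℕ → Fin N) (n : ℕ) :
    wordProd A j n = (((List.range n).map j).map A).prod := by
  induction n with
  | zero => simp [wordProd]
  | succ n ih => simp [wordProd, ih, List.range_succ]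

theorem coc_inv (A : Fin N → Mat2) (j : ℕ → Fin N) (n : ℕ) :
    coc (fun i => (A i)⁻¹) j n = (wordProd A j n)⁻¹ := by
  induction n with
  | zero => simp [coc, wordProd]
  | succ n ih => rw [coc, wordProd, ih, Matrix.mul_inv_rev]

theorem det_wordProd_ne_zero {A : Fin N → Mat2} (hA : ∀ i, (A i).det ≠ 0) (j : ℕ → Fin N) (n : ℕ) :
    (wordProd A j n).det ≠ 0 := by
  induction n with
  | zero => simp [wordProd]
  | succ n ih => rw [wordProd, Matrix.det_mul]; exact mul_ne_zero ih (hA _)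

/-- Reading a word backwards. -/
theorem coc_eq_wordProd (A : Fin N → Mat2) (j i : ℕ → Fin N) (n : ℕ)
    (h : ∀ k < n, j k = i (n - 1 - k)) : coc A j n = wordProd A i n := by
  induction n generalizing i with
  | zero => rfl
  | succ n ih =>
    have key : ∀ (i : ℕ → Fin N) n,
        wordProd A i (n + 1) = A (i 0) * wordProd A (shiftBy 1 i) n := by
      intro i n
      induction n with
      | zero => simp [wordProd]
      | succ n ih =>
        rw [wordProd, ih, Matrix.mul_assoc, wordProd]
        congr 3
        simp [shiftBy, add_comm]
    rw [coc, key, ih (shiftBy 1 i), h n (by omega)]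
    · congr 3; omega
    · intro k hk
      rw [h k (by omega), shiftBy]
      congr 1; omega

/-- Inversion exchanges the singular values and takes reciprocals, so their ratio is preserved. It
also reverses the order of the product, which is harmless because domination is assumed for all
finite words. -/
theorem exists_uniformlyDominated {A : Fin N → Mat2} (hA : ∀ i, (A i).det ≠ 0)
    (hdom : DominatedSplitting A) : ∃ L C δ, UniformlyDominated A L C δ ∧
      UniformlyDominated (fun i => (A i)⁻¹) L C δ := by
  obtain ⟨C, hC, δ, hδ, hd⟩ := hdom
  obtain ⟨L₁, hL₁⟩ : ∃ L₁, ∀ i, sv1 (A i) ≤ L₁ := by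
    obtain ⟨b, hb⟩ := (Set.finite_range fun i => sv1 (A i)).bddAbove
    exact ⟨b, fun i => hb ⟨i, rfl⟩⟩
  obtain ⟨L₂, hL₂⟩ : ∃ L₂, ∀ i, (sv2 (A i))⁻¹ ≤ L₂ := by
    obtain ⟨b, hb⟩ := (Set.finite_range fun i => (sv2 (A i))⁻¹).bddAbove
    exact ⟨b, fun i => hb ⟨i, rfl⟩⟩
  set L := max 1 (max L₁ L₂)
  have l1 : ∀ i, sv1 (A i) ≤ L := fun i =>
    (hL₁ i).trans ((le_max_left _ _).trans (le_max_right _ _))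
  have l2 : ∀ i, (sv2 (A i))⁻¹ ≤ L := fun i =>
    (hL₂ i).trans ((le_max_right _ _).trans (le_max_right _ _))
  have key : ∀ w : List (Fin N), (w.map A).prod.det ≠ 0 →
      sv2 (w.map A).prod ≤ C⁻¹ * Real.exp (-δ * w.length) * sv1 (w.map A).prod := by
    intro w hw
    have h1 := hd w
    rw [le_div_iff₀ (sv2_pos hw)] at h1
    have h2 : Real.exp (-δ * w.length) * Real.exp (δ * w.length) = 1 := by
      rw [← Real.exp_add]; simp
    calc sv2 (w.map A).prod = C⁻¹ * Real.exp (-δ * w.length) *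
          (C * Real.exp (δ * w.length) * sv2 (w.map A).prod) := by
          rw [show C⁻¹ * Real.exp (-δ * w.length) *
            (C * Real.exp (δ * w.length) * sv2 (w.map A).prod) = (C⁻¹ * C) *
            (Real.exp (-δ * w.length) * Real.exp (δ * w.length)) * sv2 (w.map A).prod by ring,
            h2, inv_mul_cancel₀ hC.ne', one_mul, one_mul]
      _ ≤ _ := by gcongr
  have keyc : ∀ j n, sv2 (coc A j n) ≤ C⁻¹ * Real.exp (-δ * n) * sv1 (coc A j n) := by
    intro j n
    have h := key ((List.range n).map j).reverse
    rw [← coc_eq_prod] at h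
    simpa using h (det_coc_ne_zero hA j n)
  have keyw : ∀ j n, sv2 (wordProd A j n) ≤
      C⁻¹ * Real.exp (-δ * n) * sv1 (wordProd A j n) := by
    intro j n
    have h := key ((List.range n).map j)
    rw [← wordProd_eq_prod] at h
    simpa using h (det_wordProd_ne_zero hA j n)
  refine ⟨L, C⁻¹, δ, ⟨hA, le_max_left _ _, l1, fun i => ?_, inv_pos.2 hC, hδ, keyc⟩,
    ⟨fun i => det_inv_ne_zero (hA i), le_max_left _ _, fun i => ?_, fun i => ?_, inv_pos.2 hC, hδ,
      fun j n => ?_⟩⟩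
  · have h := l2 i
    rwa [inv_le_iff_one_le_mul₀ (sv2_pos (hA i))] at h
  · rw [sv1_inv (hA i)]; exact l2 i
  · rw [sv2_inv (hA i), ← div_eq_mul_inv, one_le_div (sv1_pos (hA i))]; exact l1 i
  · have hw := det_wordProd_ne_zero hA j n
    rw [coc_inv, sv1_inv hw, sv2_inv hw, inv_le_iff_one_le_mul₀ (sv1_pos hw)]
    have h := keyw j n
    have h2 := sv2_pos hw
    rw [mul_assoc, mul_comm _ (sv1 _), ← mul_assoc]
    rw [← div_eq_mul_inv, one_le_div h2]
    exact h

namespace UniformlyDominated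

variable {A : Fin N → Mat2} {L C δ : ℝ}

/-- The future of a two-sided word. -/
def future (i : ℤ → Fin N) : ℕ → Fin N := fun k => i k

/-- The past of a two-sided word, read backwards. -/
def past (i : ℤ → Fin N) : ℕ → Fin N := fun k => i (-1 - k)

/-- The `n`-fold shift of a two-sided word. -/
def shiftZ (n : ℕ) (i : ℤ → Fin N) : ℤ → Fin N := fun k => i (k + n)

theorem cocycle_eq_coc (i : ℤ → Fin N) (n : ℕ) : cocycle A i n = coc A (future i) n := by
  induction n with
  | zero => rfl
  | succ n ih => rw [cocycle, coc, ih]; rfl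

theorem coc_past_shiftZ (i : ℤ → Fin N) (n : ℕ) :
    coc (fun i => (A i)⁻¹) (past (shiftZ n i)) n = (coc A (future i) n)⁻¹ := by
  rw [coc_inv]
  congr 1
  refine (coc_eq_wordProd A _ _ n fun k hk => ?_).symm
  simp only [past, shiftZ, future]
  congr 1; omega

theorem shiftBy_past_shiftZ (i : ℤ → Fin N) (n : ℕ) :
    shiftBy n (past (shiftZ n i)) = past i := by
  funext k; simp only [past, shiftZ, shiftBy]; congr 1; push_cast; ring

theorem shiftBy_future (i : ℤ → Fin N) (n : ℕ) : shiftBy n (future i) = future (shiftZ n i) := by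
  funext k; simp only [future, shiftZ, shiftBy]; congr 1; push_cast; ring

/-- The strong unstable line, determined by the past. -/
def fastLine (A : Fin N → Mat2) (i : ℤ → Fin N) : ℙ ℝ Plane := slowLine (fun i => (A i)⁻¹) (past i)

/-- The norm of the product along the fast line. -/
def fastNorm (A : Fin N → Mat2) (i : ℤ → Fin N) (n : ℕ) : ℝ :=
  ‖act (coc A (future i) n) (dir (fastLine A i))‖

theorem fastLine_invariant (h' : UniformlyDominated (fun i => (A i)⁻¹) L C δ)
    (hA : ∀ i, (A i).det ≠ 0) (i : ℤ → Fin N) (n : ℕ) :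
    cross (dir (fastLine A (shiftZ n i))) (act (coc A (future i) n) (dir (fastLine A i))) = 0 := by
  have h1 := h'.slowLine_invariant_coc (past (shiftZ n i)) n
  rw [shiftBy_past_shiftZ, coc_past_shiftZ] at h1
  have hd := det_coc_ne_zero hA (future i) n
  have h2 := cross_act (coc A (future i) n) (dir (slowLine (fun i => (A i)⁻¹) (past i)))
    (act (coc A (future i) n)⁻¹ (dir (slowLine (fun i => (A i)⁻¹) (past (shiftZ n i)))))
  rw [act_act_inv hd, h1, mul_zero] at h2
  rw [cross_comm, fastLine, fastLine, h2, neg_zero]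

/-- Time reversal: the inverse product from time n back to time 0 contracts its slow line by the
reciprocal of `fastNorm`. The upper bound for the inverse cocycle thus becomes a lower bound for the
forward one. -/
theorem exists_le_fastNorm_sq (h' : UniformlyDominated (fun i => (A i)⁻¹) L C δ)
    (hA : ∀ i, (A i).det ≠ 0) :
    ∃ K, 1 ≤ K ∧ ∀ (i : ℤ → Fin N) (n : ℕ),
      Real.exp (δ * n) * |(coc A (future i) n).det| ≤ K * fastNorm A i n ^ 2 := by
  obtain ⟨K, hK, hb⟩ := h'.exists_slowNorm_sq_le
  refine ⟨K, hK, fun i n => ?_⟩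
  have h1 := hb (past (shiftZ n i)) n
  have hd := det_coc_ne_zero hA (future i) n
  set M := coc A (future i) n with hM
  have hf : 0 < fastNorm A i n := norm_pos_iff.2 (act_ne_zero hd (dir_ne_zero _))
  have h2 : slowNorm (fun i => (A i)⁻¹) (past (shiftZ n i)) n = (fastNorm A i n)⁻¹ := by
    have h3 := norm_act_of_cross_eq_zero M⁻¹ (norm_dir _) (fastLine_invariant h' hA i n)
    rw [act_inv_act hd, norm_dir] at h3
    rw [slowNorm, coc_past_shiftZ]
    change 1 = fastNorm A i n * ‖act M⁻¹ (dir (fastLine A (shiftZ n i)))‖ at h3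
    exact eq_inv_of_mul_eq_one_right h3.symm
  rw [h2, coc_past_shiftZ, ← hM, Matrix.det_nonsing_inv, Ring.inverse_eq_inv', abs_inv] at h1
  have hdp := abs_pos.2 hd
  rw [inv_pow, inv_le_iff_one_le_mul₀ (by positivity)] at h1
  have e : Real.exp (-δ * n) = (Real.exp (δ * n))⁻¹ := by rw [← Real.exp_neg]; congr 1; ring
  rw [e] at h1
  have hE := Real.exp_pos (δ * n)
  calc Real.exp (δ * n) * |M.det| = Real.exp (δ * n) * |M.det| * 1 := by ring
    _ ≤ Real.exp (δ * n) * |M.det| *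
        (K * (Real.exp (δ * n))⁻¹ * |M.det|⁻¹ * fastNorm A i n ^ 2) := by
        gcongr
    _ = _ := by field_simp

/-- Elimination of the determinant d between the bounds for the slow norm x and the fast norm f,
with E = exp(δn); this yields domination of the splitting at the rate δ. -/
theorem sq_le_sq_of_bounds {K K' E d x f : ℝ} (hK : 1 ≤ K) (hK' : 1 ≤ K') (hE : 0 < E)
    (h1 : x ^ 2 ≤ K * E⁻¹ * d) (h2 : E * d ≤ K' * f ^ 2) :
    ((K * K')⁻¹ * E * x) ^ 2 ≤ f ^ 2 := by
  have hK0 : 0 < K := one_pos.trans_le hK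
  have hK0' : 0 < K' := one_pos.trans_le hK'
  calc ((K * K')⁻¹ * E * x) ^ 2 = (K * K')⁻¹ ^ 2 * E ^ 2 * x ^ 2 := by ring
    _ ≤ (K * K')⁻¹ ^ 2 * E ^ 2 * (K * E⁻¹ * d) := by gcongr
    _ = (K * K')⁻¹ ^ 2 * K * (E * d) := by field_simp
    _ ≤ (K * K')⁻¹ ^ 2 * K * (K' * f ^ 2) := by gcongr
    _ = (K * K')⁻¹ * f ^ 2 := by field_simp
    _ ≤ 1 * f ^ 2 := by
        gcongr
        exact inv_le_one_of_one_le₀ (one_le_mul_of_one_le_of_one_le hK hK')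
    _ = _ := one_mul _

theorem isInvariantSplitting (h : UniformlyDominated A L C δ)
    (h' : UniformlyDominated (fun i => (A i)⁻¹) L C δ) :
    IsInvariantSplitting A (fastLine A) (fun i => slowLine A (future i)) := by
  obtain ⟨K, hK, hs⟩ := h.exists_slowNorm_sq_le
  obtain ⟨K', hK', hf⟩ := exists_le_fastNorm_sq h' h.det_ne
  have hK0 : 0 < K := one_pos.trans_le hK
  have hK0' : 0 < K' := one_pos.trans_le hK'
  have hsh : ∀ i : ℤ → Fin N, leftShift i = shiftZ 1 i := fun i => rfl
  refine ⟨fun i => ?_, fun i => ?_, (K * K')⁻¹, by positivity, δ, h.δ_pos, fun i n _ => ?_⟩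
  · rw [map_submodule_eq_iff (h.det_ne _)]
    have := fastLine_invariant h' h.det_ne i 1
    rwa [coc_one] at this
  · rw [map_submodule_eq_iff (h.det_ne _)]
    have := h.slowLine_invariant (future i)
    rwa [shiftBy_future] at this
  · rw [normOnLine_eq, normOnLine_eq, cocycle_eq_coc]
    change _ ≤ fastNorm A i n / slowNorm A (future i) n
    have hd := abs_pos.2 (det_coc_ne_zero h.det_ne (future i) n)
    have hx := h.slowNorm_pos (future i) n
    have hfp : 0 ≤ fastNorm A i n := norm_nonneg _
    rw [le_div_iff₀ hx]
    refine le_of_sq_le_sq ?_ hfp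
    have h1 := hs (future i) n
    have h2 := hf i n
    have e : Real.exp (-δ * n) = (Real.exp (δ * n))⁻¹ := by rw [← Real.exp_neg]; congr 1; ring
    rw [e] at h1
    exact sq_le_sq_of_bounds hK hK' (Real.exp_pos (δ * n)) h1 h2

theorem le_sv2_coc (h : UniformlyDominated A L C δ) (j : ℕ → Fin N) (n : ℕ) :
    1 ≤ L ^ n * sv2 (coc A j n) := by
  induction n with
  | zero =>
    obtain ⟨u, hu, h2⟩ := exists_norm_act_eq_sv2 (coc A j 0)
    rw [← h2, coc, act_one, hu]; simp
  | succ n ih =>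
    have hL : 0 < L := one_pos.trans_le h.one_le
    calc (1:ℝ) ≤ (L * sv2 (A (j n))) * (L ^ n * sv2 (coc A j n)) :=
          one_le_mul_of_one_le_of_one_le (h.le_sv2 _) ih
      _ = L ^ (n + 1) * (sv2 (A (j n)) * sv2 (coc A j n)) := by ring
      _ ≤ _ := by gcongr; exact sv2_mul_ge _ _

theorem sv1_coc_le (h : UniformlyDominated A L C δ) (j : ℕ → Fin N) (n : ℕ) :
    sv1 (coc A j n) ≤ L ^ n := by
  induction n with
  | zero =>
    obtain ⟨u, hu, h2⟩ := exists_norm_act_eq_sv1 (coc A j 0)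
    rw [← h2, coc, act_one, hu]; simp
  | succ n ih =>
    have hL : 0 < L := one_pos.trans_le h.one_le
    rw [coc, pow_succ']
    exact (sv1_mul_le _ _).trans (mul_le_mul (h.sv1_le _) ih (sv1_nonneg _) hL.le)

/-- If the two lines were nearly parallel, a product of bounded length would act on them almost
equally, against domination. -/
theorem exists_angle_lower_bound (h : UniformlyDominated A L C δ)
    (h' : UniformlyDominated (fun i => (A i)⁻¹) L C δ) :
    ∃ c > 0, ∀ i : ℤ → Fin N, c ≤ |cross (dir (slowLine A (future i))) (dir (fastLine A i))| := by
  obtain ⟨c₀, hc₀, δ', hδ', hdom⟩ := (isInvariantSplitting h h').dominated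
  have hL : 0 < L := one_pos.trans_le h.one_le
  have ht : Tendsto (fun n : ℕ => c₀ * Real.exp (δ' * n)) atTop atTop :=
    (Real.tendsto_exp_atTop.comp
      ((tendsto_natCast_atTop_atTop (R := ℝ)).const_mul_atTop hδ')).const_mul_atTop hc₀
  -- A single n serves all words: the fast norm is at least twice the slow norm x, but at most x +
  -- α₁ sin(angle). Hence sin(angle) ≥ x/α₁, and L^(-2n) bounds that quotient from below.
  obtain ⟨n, hn1, hn⟩ := ((eventually_ge_atTop 1).and (ht.eventually_ge_atTop 2)).exists
  refine ⟨(L ^ n * L ^ n)⁻¹, by positivity, fun i => ?_⟩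
  have h1 := hn.trans (hdom i n hn1)
  rw [normOnLine_eq, normOnLine_eq, cocycle_eq_coc] at h1
  set M := coc A (future i) n
  have hx : 0 < ‖act M (dir (slowLine A (future i)))‖ := h.slowNorm_pos (future i) n
  rw [le_div_iff₀ hx] at h1
  have h2 := norm_act_le_add_cross M (norm_dir (slowLine A (future i))) (norm_dir (fastLine A i))
  have h3 := sv2_le_norm_act M (dir (slowLine A (future i)))
  rw [norm_dir, mul_one] at h3
  have h4 := h.le_sv2_coc (future i) n
  have h5 := h.sv1_coc_le (future i) n
  have hc := abs_nonneg (cross (dir (slowLine A (future i))) (dir (fastLine A i)))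
  set c := |cross (dir (slowLine A (future i))) (dir (fastLine A i))|
  have h6 : sv2 M ≤ L ^ n * c := by
    have := mul_le_mul_of_nonneg_right h5 hc
    linarith
  rw [inv_le_iff_one_le_mul₀ (by positivity)]
  calc (1:ℝ) ≤ L ^ n * sv2 M := h4
    _ ≤ L ^ n * (L ^ n * c) := by gcongr
    _ = _ := by ring

theorem mul_norm_act_le_det (M : Mat2) {u w u' w' : Plane} (hu : ‖u‖ = 1) (hw : ‖w‖ = 1)
    (hu' : ‖u'‖ = 1) (hw' : ‖w'‖ = 1) (hMu : cross u' (act M u) = 0)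
    (hMw : cross w' (act M w) = 0) :
    |cross u' w'| * (‖act M u‖ * ‖act M w‖) ≤ |M.det| := by
  have e1 := exists_smul_of_cross_eq_zero hu' hMu
  have e2 := exists_smul_of_cross_eq_zero hw' hMw
  have e3 := cross_act M u w
  set a : ℝ := inner ℝ u' (act M u)
  set b : ℝ := inner ℝ w' (act M w)
  rw [e1, e2, cross_smul_left, cross_smul_right] at e3
  have e4 := congrArg abs e3
  rw [abs_mul, abs_mul, abs_mul] at e4
  rw [e1, e2, norm_smul, norm_smul, hu', hw', Real.norm_eq_abs, Real.norm_eq_abs]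
  have e5 : |cross u w| ≤ 1 := by have := abs_cross_le u w; rwa [hu, hw, mul_one] at this
  calc _ = |M.det| * |cross u w| := by rw [← e4]; ring
    _ ≤ _ := mul_le_of_le_one_right (abs_nonneg _) e5

theorem cross_mul_sv1_le (M : Mat2) {u w : Plane} (hu : ‖u‖ = 1) (hw : ‖w‖ = 1) :
    |cross u w| * sv1 M ≤ ‖act M u‖ + ‖act M w‖ := by
  obtain ⟨v, hv, hMv⟩ := exists_norm_act_eq_sv1 M
  have e := congrArg (fun y => ‖act M y‖) (cross_smul_eq u w v)
  simp only [map_add, map_smul] at e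
  rw [norm_smul, Real.norm_eq_abs, hMv] at e
  have b1 : |cross v w| ≤ 1 := by have := abs_cross_le v w; rwa [hv, hw, mul_one] at this
  have b2 : |cross u v| ≤ 1 := by have := abs_cross_le u v; rwa [hu, hv, mul_one] at this
  rw [e]
  refine (norm_add_le _ _).trans ?_
  rw [norm_smul, norm_smul, Real.norm_eq_abs, Real.norm_eq_abs]
  exact add_le_add (mul_le_of_le_one_left (norm_nonneg _) b1)
    (mul_le_of_le_one_left (norm_nonneg _) b2)

/-- Transversality before M gives α₁ ≲ ‖Mw‖, because w is stretched at least comparably to u.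
Transversality after M gives ‖Mu‖‖Mw‖ ≲ |det M| = α₁α₂. Dividing leaves ‖Mu‖ ≲ α₂. -/
theorem norm_act_le_sv2_of_transversal {M : Mat2} (hM : M.det ≠ 0) {u w u' w' : Plane}
    (hu : ‖u‖ = 1) (hw : ‖w‖ = 1) (hu' : ‖u'‖ = 1) (hw' : ‖w'‖ = 1)
    (hMu : cross u' (act M u) = 0) (hMw : cross w' (act M w) = 0) {a c : ℝ} (ha : 0 ≤ a)
    (hc : 0 < c) (h1 : c ≤ |cross u w|) (h2 : c ≤ |cross u' w'|)
    (h3 : ‖act M u‖ ≤ a * ‖act M w‖) : ‖act M u‖ ≤ (1 + a) / c ^ 2 * sv2 M := by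
  have hdet := mul_norm_act_le_det M hu hw hu' hw' hMu hMw
  have hsv := cross_mul_sv1_le M hu hw
  have hs1 := sv1_pos hM
  rw [← sv1_mul_sv2] at hdet
  set x := ‖act M u‖
  set f := ‖act M w‖
  have hx : 0 ≤ x := norm_nonneg _
  have hf : 0 ≤ f := norm_nonneg _
  have hsv' : c * sv1 M ≤ (1 + a) * f := by
    have := mul_le_mul_of_nonneg_right h1 hs1.le
    linarith
  have hdet' : c * (x * f) ≤ sv1 M * sv2 M :=
    (mul_le_mul_of_nonneg_right h2 (mul_nonneg hx hf)).trans hdet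
  rw [div_mul_eq_mul_div, le_div_iff₀ (by positivity)]
  refine le_of_mul_le_mul_right ?_ hs1
  calc x * c ^ 2 * sv1 M = x * c * (c * sv1 M) := by ring
    _ ≤ x * c * ((1 + a) * f) := mul_le_mul_of_nonneg_left hsv' (by positivity)
    _ = (1 + a) * (c * (x * f)) := by ring
    _ ≤ (1 + a) * (sv1 M * sv2 M) := mul_le_mul_of_nonneg_left hdet' (by positivity)
    _ = _ := by ring

/-- The sharp comparison: the slow line is contracted as much as possible. -/
theorem exists_slowNorm_le_sv2 (h : UniformlyDominated A L C δ)
    (h' : UniformlyDominated (fun i => (A i)⁻¹) L C δ) :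
    ∃ K, 1 ≤ K ∧ ∀ (j : ℕ → Fin N) (n : ℕ), slowNorm A j n ≤ K * sv2 (coc A j n) := by
  obtain ⟨c, hc, hang⟩ := exists_angle_lower_bound h h'
  obtain ⟨c₀, hc₀, δ', hδ', hdom⟩ := (isInvariantSplitting h h').dominated
  refine ⟨max 1 ((1 + c₀⁻¹) / c ^ 2), le_max_left _ _, fun j n => ?_⟩
  rcases Nat.eq_zero_or_pos n with rfl | hn
  · obtain ⟨u, hu, h2⟩ := exists_norm_act_eq_sv2 (coc A j 0)
    rw [← h2, slowNorm, coc, act_one, act_one, hu, norm_dir, mul_one]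
    exact le_max_left _ _
  refine le_trans ?_ (mul_le_mul_of_nonneg_right (le_max_right _ _) (sv2_nonneg _))
  obtain ⟨i, rfl⟩ : ∃ i : ℤ → Fin N, future i = j :=
    ⟨fun k => j k.toNat, by funext k; simp [future]⟩
  have hd := hdom i n hn
  rw [normOnLine_eq, normOnLine_eq, cocycle_eq_coc] at hd
  have hx : 0 < slowNorm A (future i) n := h.slowNorm_pos _ n
  have hang1 := hang (shiftZ n i)
  rw [← shiftBy_future] at hang1
  refine norm_act_le_sv2_of_transversal (det_coc_ne_zero h.det_ne _ n) (norm_dir _) (norm_dir _)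
    (norm_dir _) (norm_dir _) (h.slowLine_invariant_coc (future i) n)
    (fastLine_invariant h' h.det_ne i n) (inv_pos.2 hc₀).le hc (hang i) hang1 ?_
  change slowNorm A (future i) n ≤ c₀⁻¹ * fastNorm A i n
  change _ ≤ fastNorm A i n / slowNorm A (future i) n at hd
  rw [le_div_iff₀ hx] at hd
  have h1 : 1 ≤ Real.exp (δ' * n) := Real.one_le_exp (by positivity)
  have h2 : c₀ * 1 * slowNorm A (future i) n ≤
      c₀ * Real.exp (δ' * n) * slowNorm A (future i) n := by gcongr
  rw [← div_eq_inv_mul, le_div_iff₀ hc₀]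
  linarith

/-- `isInvariantSplitting` shows that the choice defining `strongStable` is made from a non-empty
set. For uniqueness, a vector v at sine κ > 0 from the slow line satisfies ‖Mv‖ ≥ κα₁/K by the area
inequality, so no line can be stretched more than K/κ times as much as v; this contradicts
exponential domination. -/
theorem strongStable_eq_slowLine (h : UniformlyDominated A L C δ)
    (h' : UniformlyDominated (fun i => (A i)⁻¹) L C δ) (i : ℤ → Fin N) :
    strongStable A i = slowLine A (future i) := by
  have hex : ∃ ess, ∃ es, IsInvariantSplitting A es ess := ⟨_, _, isInvariantSplitting h h'⟩
  obtain ⟨es, hes⟩ : ∃ es, IsInvariantSplitting A es (strongStable A) :=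
    Classical.epsilon_spec hex
  obtain ⟨K, hK, hsharp⟩ := exists_slowNorm_le_sv2 h h'
  have hK0 : 0 < K := one_pos.trans_le hK
  by_contra hne
  rw [line_eq_iff] at hne
  set v := dir (strongStable A i)
  set κ := |cross v (dir (slowLine A (future i)))|
  have hκ : 0 < κ := abs_pos.2 hne
  obtain ⟨c₀, hc₀, δ', hδ', hdom⟩ := hes.dominated
  have ht : Tendsto (fun n : ℕ => c₀ * Real.exp (δ' * n)) atTop atTop :=
    (Real.tendsto_exp_atTop.comp
      ((tendsto_natCast_atTop_atTop (R := ℝ)).const_mul_atTop hδ')).const_mul_atTop hc₀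
  obtain ⟨n, hn1, hn⟩ := ((eventually_ge_atTop 1).and (ht.eventually_gt_atTop (K / κ))).exists
  have h1 := hn.trans_le (hdom i n hn1)
  rw [normOnLine_eq, normOnLine_eq, cocycle_eq_coc] at h1
  have hd := det_coc_ne_zero h.det_ne (future i) n
  have hs := hsharp (future i) n
  set M := coc A (future i) n
  have h2 := abs_det_mul_cross_le M v (dir (slowLine A (future i)))
  have hv : 0 < ‖act M v‖ := norm_pos_iff.2 (act_ne_zero hd (dir_ne_zero _))
  have h3 := norm_act_le_sv1 M (dir (es i))
  rw [norm_dir, mul_one] at h3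
  rw [lt_div_iff₀ hv, div_mul_eq_mul_div, div_lt_iff₀ hκ] at h1
  have hs2 := sv2_pos hd
  have h4 : sv1 M * κ ≤ ‖act M v‖ * K := by
    refine le_of_mul_le_mul_right ?_ hs2
    calc sv1 M * κ * sv2 M = |M.det| * κ := by rw [← sv1_mul_sv2]; ring
      _ ≤ ‖act M v‖ * slowNorm A (future i) n := h2
      _ ≤ ‖act M v‖ * (K * sv2 M) := by gcongr
      _ = _ := by ring
  have h5 := mul_le_mul_of_nonneg_right h3 hκ.le
  linarith

theorem strongStableDir_eq_slowLine (h : UniformlyDominated A L C δ)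
    (h' : UniformlyDominated (fun i => (A i)⁻¹) L C δ) (j : ℕ → Fin N) :
    strongStableDir A j = slowLine A j := by
  rw [strongStableDir, strongStable_eq_slowLine h h']
  congr 1

/-- The second singular value is comparable to the multiplicative `slowNorm`, and α₁ = |det|/α₂ with
a multiplicative determinant. So α₁ is supermultiplicative up to a constant. -/
theorem exists_le_sv1_add (h : UniformlyDominated A L C δ)
    (h' : UniformlyDominated (fun i => (A i)⁻¹) L C δ) :
    ∃ K, 1 ≤ K ∧ ∀ (j : ℕ → Fin N) (m n : ℕ),
      sv1 (coc A j m) * sv1 (coc A (shiftBy m j) n) ≤ K * sv1 (coc A j (m + n)) := by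
  obtain ⟨K, hK, hsharp⟩ := exists_slowNorm_le_sv2 h h'
  refine ⟨K ^ 2, one_le_pow₀ hK, fun j m n => ?_⟩
  have hK0 : 0 < K := one_pos.trans_le hK
  have hd := det_coc_ne_zero h.det_ne j (m + n)
  have hd1 := det_coc_ne_zero h.det_ne j m
  have hd2 := det_coc_ne_zero h.det_ne (shiftBy m j) n
  have hs2 := sv2_pos hd
  have h1 : sv2 (coc A j (m + n)) ≤ K ^ 2 * (sv2 (coc A j m) * sv2 (coc A (shiftBy m j) n)) := by
    have e1 := sv2_le_norm_act (coc A j (m + n)) (dir (slowLine A j))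
    rw [norm_dir, mul_one] at e1
    calc sv2 (coc A j (m + n)) ≤ slowNorm A j (m + n) := e1
      _ = slowNorm A j m * slowNorm A (shiftBy m j) n := h.slowNorm_add j m n
      _ ≤ (K * sv2 (coc A j m)) * (K * sv2 (coc A (shiftBy m j) n)) :=
        mul_le_mul (hsharp _ _) (hsharp _ _) (h.slowNorm_pos _ _).le
          (mul_nonneg hK0.le (sv2_nonneg _))
      _ = _ := by ring
  have h2 : |(coc A j (m + n)).det| = |(coc A j m).det| * |(coc A (shiftBy m j) n).det| := by
    rw [coc_add, Matrix.det_mul, abs_mul, mul_comm]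
  rw [← sv1_mul_sv2, ← sv1_mul_sv2, ← sv1_mul_sv2] at h2
  refine le_of_mul_le_mul_right ?_ hs2
  calc _ ≤ sv1 (coc A j m) * sv1 (coc A (shiftBy m j) n) *
        (K ^ 2 * (sv2 (coc A j m) * sv2 (coc A (shiftBy m j) n))) :=
        mul_le_mul_of_nonneg_left h1 (mul_nonneg (sv1_nonneg _) (sv1_nonneg _))
    _ = K ^ 2 * (sv1 (coc A j m) * sv2 (coc A j m) *
        (sv1 (coc A (shiftBy m j) n) * sv2 (coc A (shiftBy m j) n))) := by ring
    _ = _ := by rw [← h2]; ring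

theorem continuous_slowLine (h : UniformlyDominated A L C δ) : Continuous (slowLine A) := by
  rw [continuous_iff_continuousAt]
  intro j
  rw [ContinuousAt, tendsto_iff_dist_tendsto_zero, Metric.tendsto_nhds]
  intro ε hε
  have ht : Tendsto (fun n : ℕ => 2 * rate L C δ * Real.exp (-δ * n)) atTop (𝓝 0) := by
    simp_rw [exp_pow]
    simpa using (tendsto_pow_atTop_nhds_zero_of_lt_one (Real.exp_pos _).le
      h.exp_lt_one).const_mul (2 * rate L C δ)
  obtain ⟨n, hn⟩ := (ht.eventually_lt_const hε).exists
  have hnb : ∀ᶠ j' in 𝓝 j, ∀ k < n, j' k = j k := by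
    have : ∀ k : ℕ, ∀ᶠ j' in 𝓝 j, j' k = j k := fun k =>
      (continuous_apply k).continuousAt.eventually_mem
        ((isOpen_discrete {j k}).mem_nhds rfl)
    exact (Filter.eventually_all_finite (Set.finite_lt_nat n)).2 fun k _ => this k
  filter_upwards [hnb] with j' hj'
  rw [dist_zero_right, Real.norm_eq_abs, abs_of_nonneg dist_nonneg]
  exact (h.dist_slowLine_slowLine_le hj').trans_lt hn

end UniformlyDominated

end

noncomputable section

/-! ### Bernoulli measures -/

variable {N : ℕ}

instance instIsProbabilityMeasureBernoulli (p : PMF (Fin N)) :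
    IsProbabilityMeasure (bernoulliMeas p) := by
  unfold bernoulliMeas; infer_instance

/-- Putting a symbol in front of a word. -/
def consWord (q : Fin N × (ℕ → Fin N)) : ℕ → Fin N
  | 0 => q.1
  | k + 1 => q.2 k

theorem measurable_consWord : Measurable (consWord (N := N)) := by
  refine measurable_pi_iff.2 fun k => ?_
  cases k with
  | zero => exact measurable_fst
  | succ k => exact (measurable_pi_apply k).comp measurable_snd

theorem measurable_shiftBy (n : ℕ) : Measurable (shiftBy (N := N) n) :=
  measurable_pi_iff.2 fun k => measurable_pi_apply (n + k)

theorem bernoulliMeas_pi (p : PMF (Fin N)) (n : ℕ) (t : ℕ → Set (Fin N)) :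
    bernoulliMeas p {i | ∀ k < n, i k ∈ t k} = ∏ k ∈ Finset.range n, p.toMeasure (t k) := by
  rw [bernoulliMeas, ← Measure.infinitePi_pi _ (fun _ _ => MeasurableSet.of_discrete)]
  congr 1; ext i; simp [Set.mem_pi]

theorem ext_bernoulliMeas (p : PMF (Fin N)) {m : Measure (ℕ → Fin N)}
    (h : ∀ (n : ℕ) (t : ℕ → Set (Fin N)),
      m {i | ∀ k < n, i k ∈ t k} = ∏ k ∈ Finset.range n, p.toMeasure (t k)) :
    m = bernoulliMeas p := by
  classical
  refine Measure.eq_infinitePi _ fun s t ht => ?_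
  obtain ⟨n, hn⟩ : ∃ n, s ⊆ Finset.range n := s.exists_nat_subset_range
  have h1 := h n fun k => if k ∈ s then t k else Set.univ
  have h2 : {i : ℕ → Fin N | ∀ k < n, i k ∈ (if k ∈ s then t k else Set.univ)} =
      Set.pi s t := by
    ext i
    simp only [Set.mem_ofPred_eq, Set.mem_pi, Finset.mem_coe]
    constructor
    · intro hi k hk
      have := hi k (Finset.mem_range.1 (hn hk))
      rwa [if_pos hk] at this
    · intro hi k _
      split_ifs with hk
      · exact hi k hk
      · trivial
  rw [h2] at h1
  rw [h1, ← Finset.prod_subset hn]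
  · exact Finset.prod_congr rfl fun k hk => by rw [if_pos hk]
  · intro k _ hk
    rw [if_neg hk, measure_univ]

theorem measurePreserving_consWord (p : PMF (Fin N)) :
    MeasurePreserving consWord (p.toMeasure.prod (bernoulliMeas p)) (bernoulliMeas p) := by
  refine ⟨measurable_consWord, ext_bernoulliMeas p fun n t => ?_⟩
  have hm : MeasurableSet {i : ℕ → Fin N | ∀ k < n, i k ∈ t k} := by
    have : {i : ℕ → Fin N | ∀ k < n, i k ∈ t k} = ⋂ k, ⋂ (_ : k < n), (fun i => i k) ⁻¹' t k := by
      ext; simp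
    rw [this]
    exact .iInter fun k => .iInter fun _ => measurable_pi_apply k .of_discrete
  rw [Measure.map_apply measurable_consWord hm]
  cases n with
  | zero => simp
  | succ n =>
    have : consWord ⁻¹' {i : ℕ → Fin N | ∀ k < n + 1, i k ∈ t k} =
        t 0 ×ˢ {i : ℕ → Fin N | ∀ k < n, i k ∈ t (k + 1)} := by
      ext ⟨a, i⟩
      simp only [Set.mem_preimage, Set.mem_ofPred_eq, Set.mem_prod]
      constructor
      · intro hh
        exact ⟨hh 0 (by omega), fun k hk => hh (k + 1) (by omega)⟩
      · rintro ⟨h0, h1⟩ k hk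
        cases k with
        | zero => exact h0
        | succ k => exact h1 k (by omega)
    rw [this, Measure.prod_prod, bernoulliMeas_pi p n fun k => t (k + 1),
      Finset.prod_range_succ', mul_comm]

/-- Splitting off the first symbol of a word. -/
def uncons (i : ℕ → Fin N) : Fin N × (ℕ → Fin N) := (i 0, shiftBy 1 i)

theorem measurePreserving_uncons (p : PMF (Fin N)) :
    MeasurePreserving uncons (bernoulliMeas p) (p.toMeasure.prod (bernoulliMeas p)) := by
  have hm : Measurable (uncons (N := N)) := (measurable_pi_apply 0).prodMk (measurable_shiftBy 1)
  refine ⟨hm, ?_⟩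
  rw [← (measurePreserving_consWord p).map_eq, Measure.map_map hm measurable_consWord]
  have : (uncons ∘ consWord (N := N)) = id := by
    funext ⟨a, i⟩
    simp only [Function.comp_apply, uncons, id, Prod.mk.injEq]
    refine ⟨rfl, ?_⟩
    funext k
    simp only [shiftBy, add_comm 1 k]; rfl
  rw [this, Measure.map_id, (measurePreserving_consWord p).map_eq]

theorem measurePreserving_shiftBy (p : PMF (Fin N)) (n : ℕ) :
    MeasurePreserving (shiftBy n) (bernoulliMeas p) (bernoulliMeas p) := by
  induction n with
  | zero =>
    have : shiftBy (N := N) 0 = id := by funext i k; simp [shiftBy]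
    rw [this]; exact MeasurePreserving.id _
  | succ n ih =>
    have h1 : MeasurePreserving (shiftBy 1) (bernoulliMeas p) (bernoulliMeas p) :=
      measurePreserving_snd.comp (measurePreserving_uncons p)
    have : shiftBy (N := N) (n + 1) = shiftBy 1 ∘ shiftBy n := by
      funext i; rw [Function.comp_apply, shiftBy_shiftBy]
    rw [this]
    exact h1.comp ih

theorem bernoulliMeas_pi_inter_shift (p : PMF (Fin N)) (n : ℕ) (t : ℕ → Set (Fin N))
    {S : Set (ℕ → Fin N)} (hS : MeasurableSet S) :
    bernoulliMeas p ({i | ∀ k < n, i k ∈ t k} ∩ shiftBy n ⁻¹' S) =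
      (∏ k ∈ Finset.range n, p.toMeasure (t k)) * bernoulliMeas p S := by
  induction n generalizing t with
  | zero =>
    have : shiftBy (N := N) 0 = id := by funext i k; simp [shiftBy]
    simp [this]
  | succ n ih =>
    have hm : MeasurableSet ({i : ℕ → Fin N | ∀ k < n, i k ∈ t (k + 1)} ∩ shiftBy n ⁻¹' S) := by
      refine MeasurableSet.inter ?_ (measurable_shiftBy n hS)
      have : {i : ℕ → Fin N | ∀ k < n, i k ∈ t (k + 1)} =
          ⋂ k, ⋂ (_ : k < n), (fun i => i k) ⁻¹' t (k + 1) := by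
        ext; simp
      rw [this]
      exact .iInter fun k => .iInter fun _ => measurable_pi_apply k .of_discrete
    have : {i : ℕ → Fin N | ∀ k < n + 1, i k ∈ t k} ∩ shiftBy (n + 1) ⁻¹' S =
        uncons ⁻¹' (t 0 ×ˢ ({i : ℕ → Fin N | ∀ k < n, i k ∈ t (k + 1)} ∩ shiftBy n ⁻¹' S)) := by
      ext i
      simp only [Set.mem_preimage, Set.mem_ofPred_eq, Set.mem_prod, Set.mem_inter_iff, uncons,
        shiftBy_shiftBy, add_comm 1 n]
      constructor
      · rintro ⟨h1, h2⟩
        exact ⟨h1 0 (by omega), fun k hk => by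
          rw [shiftBy, add_comm 1 k]; exact h1 (k + 1) (by omega), h2⟩
      · rintro ⟨h0, h1, h2⟩
        refine ⟨fun k hk => ?_, h2⟩
        cases k with
        | zero => exact h0
        | succ k => have := h1 k (by omega); rwa [shiftBy, add_comm 1 k] at this
    rw [this, (measurePreserving_uncons p).measure_preimage
      ((MeasurableSet.of_discrete).prod hm).nullMeasurableSet, Measure.prod_prod,
      ih fun k => t (k + 1), Finset.prod_range_succ']
    ring

/-- Zero-one law for sets that are, up to null sets, mapped into themselves by the shift. -/
theorem bernoulliMeas_zero_or_one (p : PMF (Fin N)) {G : Set (ℕ → Fin N)} (hG : MeasurableSet G)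
    (h : bernoulliMeas p (G \ shiftBy 1 ⁻¹' G) = 0) :
    bernoulliMeas p G = 0 ∨ bernoulliMeas p G = 1 := by
  set ν := bernoulliMeas p
  have hpre : ∀ n, ν (shiftBy n ⁻¹' G) = ν G := fun n =>
    (measurePreserving_shiftBy p n).measure_preimage hG.nullMeasurableSet
  -- The preimage has the same finite measure as G, so the inclusion modulo null sets is an
  -- equality.
  have hstep : G =ᵐ[ν] shiftBy 1 ⁻¹' G :=
    ae_eq_of_ae_subset_of_measure_ge (ae_le_set.2 h) (hpre 1).le hG.nullMeasurableSet
      (measure_ne_top _ _)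
  have hae : ∀ n, G =ᵐ[ν] shiftBy n ⁻¹' G := by
    intro n
    induction n with
    | zero =>
      have : shiftBy (N := N) 0 = id := by funext i k; simp [shiftBy]
      rw [this, Set.preimage_id]; exact ae_eq_refl _
    | succ n ih =>
      have h1 := (measurePreserving_shiftBy p n).quasiMeasurePreserving.preimage_ae_eq hstep
      have h2 : shiftBy n ⁻¹' (shiftBy 1 ⁻¹' G) = shiftBy (n + 1) ⁻¹' G := by
        ext i; simp [shiftBy_shiftBy]
      rw [h2] at h1
      exact ih.trans h1
  by_cases h0 : ν G = 0
  · exact Or.inl h0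
  right
  -- Modulo null sets G is its own preimage under the n-th shift, hence independent of the first n
  -- symbols. The measure conditioned on G therefore agrees with ν on all cylinders and equals ν.
  have hm : (ν G)⁻¹ • ν.restrict G = ν := by
    refine ext_bernoulliMeas p fun n t => ?_
    have hms : MeasurableSet {i : ℕ → Fin N | ∀ k < n, i k ∈ t k} := by
      have : {i : ℕ → Fin N | ∀ k < n, i k ∈ t k} =
          ⋂ k, ⋂ (_ : k < n), (fun i => i k) ⁻¹' t k := by ext; simp
      rw [this]
      exact .iInter fun k => .iInter fun _ => measurable_pi_apply k .of_discrete
    rw [Measure.smul_apply, Measure.restrict_apply hms, smul_eq_mul,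
      measure_congr (ae_eq_set_inter (ae_eq_refl {i : ℕ → Fin N | ∀ k < n, i k ∈ t k}) (hae n)),
      bernoulliMeas_pi_inter_shift p n t hG]
    rw [mul_comm, mul_assoc, ENNReal.mul_inv_cancel h0 (measure_ne_top _ _), mul_one]
  have h1 : ν Gᶜ = 0 := by
    rw [← hm, Measure.smul_apply, Measure.restrict_apply hG.compl]; simp
  exact (prob_compl_eq_zero_iff hG).1 h1

/-! ### The natural extension of the shift -/

/-- The natural extension of the shift, on pairs (future, past). -/
def natExt (q : (ℕ → Fin N) × (ℕ → Fin N)) : (ℕ → Fin N) × (ℕ → Fin N) :=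
  (shiftBy 1 q.1, consWord (q.1 0, q.2))

/-- The first `n` symbols of `i` read backwards, followed by `j`. -/
def prependRev (n : ℕ) (i j : ℕ → Fin N) : ℕ → Fin N :=
  fun k => if k < n then i (n - 1 - k) else j (k - n)

/-- The reversal in the second coordinate is what matters: the product of its first n matrices in
the order of `coc` is A_{i_0}⋯A_{i_{n-1}}, whatever j is (`wordProd_eq_coc_prependRev`). -/
theorem natExt_iterate (n : ℕ) (i j : ℕ → Fin N) :
    natExt^[n] (i, j) = (shiftBy n i, prependRev n i j) := by
  induction n with
  | zero =>
    simp only [Function.iterate_zero, id]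
    refine Prod.ext ?_ ?_
    · funext k; simp [shiftBy]
    · funext k; simp [prependRev]
  | succ n ih =>
    rw [Function.iterate_succ_apply', ih, natExt]
    refine Prod.ext (shiftBy_shiftBy _ _ _) ?_
    funext k
    cases k with
    | zero => simp [consWord, prependRev, shiftBy]
    | succ k =>
      simp only [consWord, prependRev, add_lt_add_iff_right]
      split_ifs with hk
      · congr 1; omega
      · congr 1; omega

/-- The map transfers one independent symbol from the first word to the second: split it off, swap,
reassociate, attach it. -/
theorem measurePreserving_natExt (p : PMF (Fin N)) :
    MeasurePreserving natExt ((bernoulliMeas p).prod (bernoulliMeas p))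
      ((bernoulliMeas p).prod (bernoulliMeas p)) := by
  set ν := bernoulliMeas p
  have h1 := (measurePreserving_uncons p).prod (MeasurePreserving.id ν)
  have h2 := (Measure.measurePreserving_swap (μ := p.toMeasure) (ν := ν)).prod
    (MeasurePreserving.id ν)
  have h3 := measurePreserving_prodAssoc ν p.toMeasure ν
  have h4 := (MeasurePreserving.id ν).prod (measurePreserving_consWord p)
  exact h4.comp (h3.comp (h2.comp h1))

/-! ### Return times -/

/-- The points of `G` that do not return to `G` in the first `n` steps. -/
def noReturn {X : Type*} (T : X → X) (G : Set X) (n : ℕ) : Set X :=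
  {x | x ∈ G ∧ ∀ k, 1 ≤ k → k ≤ n → T^[k] x ∉ G}

theorem measurableSet_noReturn {X : Type*} [MeasurableSpace X] {T : X → X} (hT : Measurable T)
    {G : Set X} (hG : MeasurableSet G) (n : ℕ) : MeasurableSet (noReturn T G n) := by
  have : noReturn T G n = G ∩ ⋂ k, ⋂ (_ : 1 ≤ k), ⋂ (_ : k ≤ n), (T^[k] ⁻¹' G)ᶜ := by
    ext; simp [noReturn]
  rw [this]
  exact hG.inter (.iInter fun k => .iInter fun _ => .iInter fun _ => (hT.iterate k hG).compl)

/-- Kac's inequality. -/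
theorem tsum_measure_noReturn_le {X : Type*} [MeasurableSpace X] {m : Measure X} {T : X → X}
    (hT : MeasurePreserving T m m) {G : Set X} (hG : MeasurableSet G) :
    ∑' n, m (noReturn T G n) ≤ m Set.univ := by
  refine ENNReal.tsum_le_of_sum_range_le fun n => ?_
  have hmeas := measurableSet_noReturn hT.measurable hG
  -- Pulled back by T^(n-1-k), the k-th set consists of the points whose last visit to G among the
  -- times 0,…,n-1 occurs at time n-1-k. These events are disjoint.
  have h1 : ∑ k ∈ Finset.range n, m (noReturn T G k) =
      ∑ k ∈ Finset.range n, m (T^[n - 1 - k] ⁻¹' noReturn T G k) :=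
    Finset.sum_congr rfl fun k _ =>
      ((hT.iterate _).measure_preimage (hmeas k).nullMeasurableSet).symm
  rw [h1, ← measure_biUnion_finset]
  · exact measure_mono (Set.subset_univ _)
  · have key : ∀ k l, k < l → l < n → Disjoint (T^[n - 1 - k] ⁻¹' noReturn T G k)
        (T^[n - 1 - l] ⁻¹' noReturn T G l) := by
      intro k l hkl hl
      rw [Set.disjoint_left]
      rintro x ⟨hx, -⟩ ⟨-, hx'⟩
      refine hx' (l - k) (by omega) (by omega) ?_
      rw [← Function.iterate_add_apply]
      have : l - k + (n - 1 - l) = n - 1 - k := by omega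
      rwa [this]
    intro k hk l hl hkl
    simp only [Finset.coe_range, Set.mem_Iio] at hk hl
    rcases lt_or_gt_of_ne hkl with h | h
    · exact key k l h hl
    · exact (key l k h hk).symm
  · exact fun k _ => hT.measurable.iterate _ (hmeas k)

/-- Each integer equals ⌈εn⌉ for a bounded number of n, at most M+1 with M > 1/ε. -/
theorem tsum_comp_ceil_ne_top {f : ℕ → ℝ≥0∞} (hf : ∑' n, f n ≠ ∞) {ε : ℝ} (hε : 0 < ε) :
    ∑' n : ℕ, f ⌈ε * n⌉₊ ≠ ∞ := by
  obtain ⟨M, hM⟩ := exists_nat_gt (1 / ε)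
  have hfib : ∀ b : ℕ, ∑' n : ((fun n : ℕ => ⌈ε * n⌉₊) ⁻¹' {b} : Set ℕ), f ⌈ε * (n : ℕ)⌉₊ ≤
      (M + 1 : ℕ) * f b := by
    intro b
    have h1 : ∀ n : ((fun n : ℕ => ⌈ε * n⌉₊) ⁻¹' {b} : Set ℕ), f ⌈ε * (n : ℕ)⌉₊ = f b := by
      rintro ⟨n, hn⟩
      rw [Set.mem_preimage, Set.mem_singleton_iff] at hn
      rw [hn]
    simp_rw [h1]
    rw [ENNReal.tsum_const]
    gcongr
    -- the fibre is contained in an interval of length `M`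
    by_cases hne : ((fun n : ℕ => ⌈ε * n⌉₊) ⁻¹' {b} : Set ℕ).Nonempty
    · set F := ((fun n : ℕ => ⌈ε * n⌉₊) ⁻¹' {b} : Set ℕ)
      set n₀ := sInf F
      have hn₀ : n₀ ∈ F := Nat.sInf_mem hne
      have hsub : F ⊆ (Finset.Icc n₀ (n₀ + M) : Finset ℕ) := by
        intro n hn
        have hle : n₀ ≤ n := Nat.sInf_le hn
        rw [Finset.coe_Icc]
        refine ⟨hle, ?_⟩
        by_contra hcon
        have h2 : ⌈ε * n₀⌉₊ = ⌈ε * n⌉₊ := (hn₀ : _ = b).trans (hn : _ = b).symm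
        have h3 : ε * n ≤ ⌈ε * n₀⌉₊ := h2 ▸ Nat.le_ceil _
        have h4 : (⌈ε * n₀⌉₊ : ℝ) < ε * n₀ + 1 := Nat.ceil_lt_add_one (by positivity)
        have h5 : ((n₀ + M + 1 : ℕ) : ℝ) ≤ n := by exact_mod_cast (by omega : n₀ + M + 1 ≤ n)
        push_cast at h5
        rw [div_lt_iff₀ hε] at hM
        nlinarith
      have h6 : ENat.card F ≤ ((M + 1 : ℕ) : ℕ∞) := by
        refine (Set.encard_le_encard hsub).trans ?_
        rw [Set.encard_coe_eq_coe_finsetCard, Nat.card_Icc]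
        exact_mod_cast (by omega : n₀ + M + 1 - n₀ ≤ M + 1)
      have := ENat.toENNReal_le.2 h6
      simpa using this
    · rw [Set.not_nonempty_iff_eq_empty] at hne
      rw [hne]; simp
  have h2 : ∑' n : ℕ, f ⌈ε * n⌉₊ =
      ∑' b, ∑' n : ((fun n : ℕ => ⌈ε * n⌉₊) ⁻¹' {b} : Set ℕ), f ⌈ε * (n : ℕ)⌉₊ :=
    (ENNReal.tsum_fiberwise _ _).symm
  rw [h2]
  refine ne_top_of_le_ne_top ?_ (ENNReal.tsum_le_tsum hfib)
  rw [ENNReal.tsum_mul_left]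
  exact ENNReal.mul_ne_top (ENNReal.natCast_ne_top _) hf

/-- Almost every point of `G` visits `G` with sublinear gaps. -/
theorem ae_exists_visit {X : Type*} [MeasurableSpace X] {m : Measure X} [IsFiniteMeasure m]
    {T : X → X} (hT : MeasurePreserving T m m) {G : Set X} (hG : MeasurableSet G) :
    ∀ᵐ x ∂m, x ∈ G → ∀ ε : ℝ, 0 < ε →
      ∀ᶠ n : ℕ in atTop, ∃ k ≤ n, (n : ℝ) ≤ (1 + ε) * k ∧ T^[k] x ∈ G := by
  have hkac : ∑' n, m (noReturn T G n) ≠ ∞ :=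
    ne_top_of_le_ne_top (measure_ne_top _ _) (tsum_measure_noReturn_le hT hG)
  have hmeas := measurableSet_noReturn hT.measurable hG
  have h1 : ∀ r : ℕ, ∀ᵐ x ∂m, ∀ᶠ n : ℕ in atTop,
      T^[n] x ∉ noReturn T G ⌈(1 / ((r : ℝ) + 1)) * n⌉₊ := by
    intro r
    -- Summability feeds Borel–Cantelli: eventually no visit at time n is followed by an absence of
    -- length n/(r+1). Poincaré recurrence then provides one late visit from which to start.
    have := tsum_comp_ceil_ne_top hkac (ε := 1 / ((r : ℝ) + 1)) (by positivity)
    have h2 : ∑' n : ℕ, m (T^[n] ⁻¹' noReturn T G ⌈(1 / ((r : ℝ) + 1)) * n⌉₊) ≠ ∞ := by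
      refine ne_of_eq_of_ne (tsum_congr fun n => ?_) this
      exact (hT.iterate _).measure_preimage (hmeas _).nullMeasurableSet
    exact ae_eventually_notMem h2
  have h3 : ∀ᵐ x ∂m, x ∈ G → ∃ᶠ n in atTop, T^[n] x ∈ G :=
    hT.conservative.ae_mem_imp_frequently_image_mem hG.nullMeasurableSet
  filter_upwards [ae_all_iff.2 h1, h3] with x hx hfreq hxG ε hε
  obtain ⟨r, hr⟩ := exists_nat_one_div_lt hε
  obtain ⟨n₀, hn₀⟩ := eventually_atTop.1 (hx r)
  obtain ⟨n₁, hn₁, hn₁G⟩ := frequently_atTop.1 (hfreq hxG) n₀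
  filter_upwards [eventually_ge_atTop n₁] with n hn
  -- the last visit before time `n`
  classical
  set k := Nat.findGreatest (fun k => T^[k] x ∈ G) n with hk
  have hkG : T^[k] x ∈ G := Nat.findGreatest_spec (P := fun k => T^[k] x ∈ G) hn hn₁G
  have hkn : k ≤ n := Nat.findGreatest_le n
  have hk1 : n₁ ≤ k := Nat.le_findGreatest hn hn₁G
  refine ⟨k, hkn, ?_, hkG⟩
  by_contra hcon
  refine hn₀ k (hn₁.trans hk1) ⟨hkG, fun l hl1 hl2 => ?_⟩
  rw [← Function.iterate_add_apply]
  refine Nat.findGreatest_is_greatest (P := fun k => T^[k] x ∈ G) (n := n) (by omega) ?_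
  have h5 : (l : ℝ) < 1 / ((r : ℝ) + 1) * k + 1 :=
    (Nat.cast_le.2 hl2).trans_lt (Nat.ceil_lt_add_one (by positivity))
  have h6 : (1 / ((r : ℝ) + 1)) * k ≤ ε * k := by gcongr
  have h7 : ((l + k : ℕ) : ℝ) < n + 1 := by push_cast; nlinarith
  have h8 : l + k < n + 1 := by exact_mod_cast h7
  omega

end

/-! ### Law of large numbers for blocks and almost additive sequences -/

noncomputable section

variable {N : ℕ}

/-- The function depends only on the first `m` symbols of a word. -/
def DependsOnFirst {β : Type*} (m : ℕ) (F : (ℕ → Fin N) → β) : Prop :=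
  ∀ i j : ℕ → Fin N, (∀ k < m, i k = j k) → F i = F j

theorem exists_factor_of_dependsOnFirst {m : ℕ} {F : (ℕ → Fin N) → ℝ} (hF : DependsOnFirst m F)
    (i₀ : ℕ → Fin N) (n : ℕ) :
    ∃ Φ : ((Finset.Ico n (n + m) : Finset ℕ) → Fin N) → ℝ,
      ∀ i : ℕ → Fin N, F (shiftBy n i) = Φ fun k => i k := by
  classical
  refine ⟨fun x => F fun k => if h : n + k ∈ Finset.Ico n (n + m) then x ⟨n + k, h⟩ else i₀ k,
    fun i => hF _ _ fun k hk => ?_⟩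
  have : n + k ∈ Finset.Ico n (n + m) := by rw [Finset.mem_Ico]; omega
  rw [dif_pos this]; rfl

theorem measurable_of_dependsOnFirst [Nonempty (ℕ → Fin N)] {m : ℕ} {F : (ℕ → Fin N) → ℝ}
    (hF : DependsOnFirst m F) : Measurable F := by
  obtain ⟨Φ, hΦ⟩ := exists_factor_of_dependsOnFirst hF (Classical.arbitrary _) 0
  have h0 : ∀ i : ℕ → Fin N, shiftBy 0 i = i := fun i => by funext k; simp [shiftBy]
  have : F = fun i => Φ fun k => i k := by funext i; rw [← hΦ i, h0]
  rw [this]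
  exact (measurable_of_countable Φ).comp (measurable_pi_iff.2 fun k => measurable_pi_apply _)

theorem exists_bound_of_dependsOnFirst [Nonempty (ℕ → Fin N)] {m : ℕ} {F : (ℕ → Fin N) → ℝ}
    (hF : DependsOnFirst m F) : ∃ B, ∀ i, |F i| ≤ B := by
  obtain ⟨Φ, hΦ⟩ := exists_factor_of_dependsOnFirst hF (Classical.arbitrary _) 0
  have h0 : ∀ i : ℕ → Fin N, shiftBy 0 i = i := fun i => by funext k; simp [shiftBy]
  obtain ⟨B, hB⟩ := (Set.finite_range fun x => |Φ x|).bddAbove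
  refine ⟨B, fun i => ?_⟩
  have := hΦ i
  rw [h0] at this
  rw [this]
  exact hB ⟨_, rfl⟩

theorem nonempty_words (p : PMF (Fin N)) : Nonempty (ℕ → Fin N) :=
  nonempty_of_isProbabilityMeasure (bernoulliMeas p)

/-- Strong law of large numbers for functions of consecutive blocks of symbols. -/
theorem ae_tendsto_block_average (p : PMF (Fin N)) {m : ℕ} {F : (ℕ → Fin N) → ℝ}
    (hF : DependsOnFirst m F) :
    ∀ᵐ i ∂(bernoulliMeas p), Tendsto
      (fun n : ℕ => (∑ k ∈ Finset.range n, F (shiftBy (m * k) i)) / n) atTop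
      (𝓝 (∫ i, F i ∂(bernoulliMeas p))) := by
  have := nonempty_words p
  have hFm := measurable_of_dependsOnFirst hF
  obtain ⟨B, hB⟩ := exists_bound_of_dependsOnFirst hF
  have h0 : ∀ i : ℕ → Fin N, shiftBy (m * 0) i = i := fun i => by funext k; simp [shiftBy]
  have hindep : ProbabilityTheory.iIndepFun (fun (k : ℕ) (i : ℕ → Fin N) => i k)
      (bernoulliMeas p) :=
    ProbabilityTheory.iIndepFun_infinitePi (P := fun _ : ℕ => p.toMeasure)
      (X := fun _ x => x) fun _ => measurable_id
  have hmk : ∀ n, Measurable fun i => F (shiftBy n i) := fun n => hFm.comp (measurable_shiftBy n)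
  have key := ProbabilityTheory.strong_law_ae_real (μ := bernoulliMeas p)
    (fun k i => F (shiftBy (m * k) i)) ?_ ?_ ?_
  · simpa only [h0] using key
  · exact Integrable.of_bound (hmk _).aestronglyMeasurable B
      (Eventually.of_forall fun i => by rw [Real.norm_eq_abs]; exact hB _)
  · intro k l hkl
    obtain ⟨Φ, hΦ⟩ := exists_factor_of_dependsOnFirst hF (Classical.arbitrary _) (m * k)
    obtain ⟨Ψ, hΨ⟩ := exists_factor_of_dependsOnFirst hF (Classical.arbitrary _) (m * l)
    have hdisj : Disjoint (Finset.Ico (m * k) (m * k + m)) (Finset.Ico (m * l) (m * l + m)) := by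
      rw [Finset.disjoint_left]
      intro a ha hb
      rw [Finset.mem_Ico, ← Nat.mul_succ] at ha hb
      rcases lt_or_gt_of_ne hkl with h | h
      · have := Nat.mul_le_mul_left m (Nat.succ_le_of_lt h); omega
      · have := Nat.mul_le_mul_left m (Nat.succ_le_of_lt h); omega
    have h1 := hindep.indepFun_finset _ _ hdisj fun k => measurable_pi_apply k
    have h2 := h1.comp (measurable_of_countable Φ) (measurable_of_countable Ψ)
    have e1 : (fun i => F (shiftBy (m * k) i)) = Φ ∘ fun i k => i k := by
      funext i; exact hΦ i
    have e2 : (fun i => F (shiftBy (m * l) i)) = Ψ ∘ fun i k => i k := by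
      funext i; exact hΨ i
    simp only [Function.onFun]
    rw [e1, e2]
    exact h2
  · intro k
    simp only [h0]
    refine ⟨(hmk _).aemeasurable, hFm.aemeasurable, ?_⟩
    have := (measurePreserving_shiftBy p (m * k)).map_eq
    conv_rhs => rw [← this]
    rw [Measure.map_map hFm (measurable_shiftBy _)]
    rfl

theorem ae_tendsto_average (p : PMF (Fin N)) (f : Fin N → ℝ) :
    ∀ᵐ i ∂(bernoulliMeas p), Tendsto
      (fun n : ℕ => (∑ k ∈ Finset.range n, f (i k)) / n) atTop
      (𝓝 (∑ a, (p a).toReal * f a)) := by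
  have hF : DependsOnFirst 1 fun i : ℕ → Fin N => f (i 0) := fun i j h => by
    simp only [h 0 one_pos]
  have key := ae_tendsto_block_average p hF
  have hint : ∫ i, f (i 0) ∂(bernoulliMeas p) = ∑ a, (p a).toReal * f a := by
    have h1 : MeasurePreserving (fun i : ℕ → Fin N => i 0) (bernoulliMeas p) p.toMeasure :=
      measurePreserving_fst.comp (measurePreserving_uncons p)
    have h2 := integral_map (μ := bernoulliMeas p) h1.measurable.aemeasurable (f := f)
      (measurable_of_countable f).aestronglyMeasurable
    rw [← h2, h1.map_eq, PMF.integral_eq_sum]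
    simp
  rw [hint] at key
  filter_upwards [key] with i hi
  simpa [shiftBy] using hi

/-- An almost additive sequence of functions over the Bernoulli shift. -/
structure AlmostAdditive (a : ℕ → (ℕ → Fin N) → ℝ) (c : ℝ) : Prop where
  depends : ∀ n, DependsOnFirst n (a n)
  add : ∀ m n i, |a (m + n) i - a m i - a n (shiftBy m i)| ≤ c

theorem AlmostAdditive.sum_blocks {a : ℕ → (ℕ → Fin N) → ℝ} {c : ℝ} (h : AlmostAdditive a c)
    (m K r : ℕ) (i : ℕ → Fin N) :
    |a (m * K + r) i - (∑ k ∈ Finset.range K, a m (shiftBy (m * k) i)) -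
      a r (shiftBy (m * K) i)| ≤ c * K := by
  induction K generalizing i with
  | zero =>
    have : shiftBy (m * 0) i = i := by funext k; simp [shiftBy]
    rw [this]; simp
  | succ K ih =>
    have h1 := ih (shiftBy m i)
    have h2 := h.add m (m * K + r) i
    have e : m + (m * K + r) = m * (K + 1) + r := by ring
    rw [e] at h2
    rw [Finset.sum_range_succ']
    have e2 : ∀ k, shiftBy (m * k) (shiftBy m i) = shiftBy (m * (k + 1)) i := fun k => by
      rw [shiftBy_shiftBy]; congr 1; ring
    simp only [e2] at h1
    have e3 : shiftBy (m * 0) i = i := by funext k; simp [shiftBy]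
    rw [e3]
    push_cast
    rw [abs_le] at h1 h2 ⊢
    constructor <;> linarith [h1.1, h1.2, h2.1, h2.2]

/-- Cut the word into blocks of length m. The block values are independent and identically
distributed, each cut costs at most c, that is c/m per symbol, and the last incomplete block is
bounded. -/
theorem AlmostAdditive.ae_eventually_le (p : PMF (Fin N)) {a : ℕ → (ℕ → Fin N) → ℝ} {c : ℝ}
    (h : AlmostAdditive a c) {m : ℕ} (hm : 0 < m) :
    ∀ᵐ i ∂(bernoulliMeas p), ∀ ε > 0, ∀ᶠ n : ℕ in atTop,
      |a n i / n - (∫ i, a m i ∂(bernoulliMeas p)) / m| ≤ c / m + ε := by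
  have := nonempty_words p
  have hc : 0 ≤ c := (abs_nonneg _).trans (h.add 0 0 (Classical.arbitrary _))
  choose B hB using fun r => exists_bound_of_dependsOnFirst (h.depends r)
  set S := ∑ r ∈ Finset.range m, |B r|
  have hS : ∀ r < m, ∀ i, |a r i| ≤ S := fun r hr i =>
    (hB r i).trans ((le_abs_self _).trans
      (Finset.single_le_sum (f := fun r => |B r|) (fun _ _ => abs_nonneg _)
        (Finset.mem_range.2 hr)))
  have hm' : (0 : ℝ) < m := by exact_mod_cast hm
  filter_upwards [ae_tendsto_block_average p (h.depends m)] with i hi ε hε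
  set I := ∫ i, a m i ∂(bernoulliMeas p)
  set s : ℕ → ℝ := fun K => ∑ k ∈ Finset.range K, a m (shiftBy (m * k) i) with hs
  have hdiv : Tendsto (fun n : ℕ => n / m) atTop atTop :=
    Nat.tendsto_div_const_atTop hm.ne'
  have hratio : Tendsto (fun n : ℕ => ((n / m : ℕ) : ℝ) / n) atTop (𝓝 (1 / m)) := by
    have h1 := (tendsto_nat_floor_div_atTop (R := ℝ)).comp
      ((tendsto_natCast_atTop_atTop (R := ℝ)).atTop_div_const hm')
    have h2 := h1.const_mul (1 / (m : ℝ))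
    rw [mul_one] at h2
    refine h2.congr fun n => ?_
    simp only [Function.comp_apply, Nat.floor_div_eq_div]
    field_simp
  have hlim : Tendsto (fun n : ℕ => s (n / m) / n) atTop (𝓝 (I / m)) := by
    have h1 := (hi.comp hdiv).mul hratio
    rw [mul_one_div] at h1
    refine h1.congr' ?_
    filter_upwards [eventually_ge_atTop m] with n hn
    have : ((n / m : ℕ) : ℝ) ≠ 0 := by
      have : 0 < n / m := Nat.div_pos hn hm
      positivity
    simp only [Function.comp_apply]
    field_simp
    rfl
  have hS0 : Tendsto (fun n : ℕ => S / (n : ℝ)) atTop (𝓝 0) := tendsto_const_div_atTop_nhds_zero_nat S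
  have hε2 : 0 < ε / 2 := by positivity
  filter_upwards [(Metric.tendsto_nhds.1 hlim) _ hε2, (Metric.tendsto_nhds.1 hS0) _ hε2,
    eventually_gt_atTop 0] with n h1 h2 hn
  have hn' : (0 : ℝ) < n := by exact_mod_cast hn
  rw [Real.dist_eq] at h1 h2
  rw [sub_zero] at h2
  have h3 := h.sum_blocks m (n / m) (n % m) i
  rw [Nat.div_add_mod] at h3
  have h4 := hS (n % m) (Nat.mod_lt _ hm) (shiftBy (m * (n / m)) i)
  have h5 : |a n i - s (n / m)| ≤ c * (n / m : ℕ) + S := by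
    change |a n i - s (n / m) - _| ≤ _ at h3
    rw [abs_le] at h3 h4 ⊢
    constructor <;> linarith [h3.1, h3.2, h4.1, h4.2]
  have h6 : |a n i / n - s (n / m) / n| ≤ c / m + S / n := by
    rw [← sub_div, abs_div, abs_of_pos hn', div_le_iff₀ hn', add_mul, div_mul_cancel₀ _ hn'.ne']
    refine h5.trans ?_
    have : ((n / m : ℕ) : ℝ) ≤ n / m := Nat.cast_div_le
    have := mul_le_mul_of_nonneg_left this hc
    have e : c * (n / m : ℝ) = c / m * n := by ring
    linarith
  have h7 := (le_abs_self _).trans_lt h2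
  calc |a n i / n - I / m| ≤ |a n i / n - s (n / m) / n| + |s (n / m) / n - I / m| :=
        abs_sub_le _ _ _
    _ ≤ c / m + ε := by linarith

/-- For almost every word and every m the averages end up within about c/m of a number not depending
on the word. Letting m grow makes them Cauchy with a common limit. -/
theorem AlmostAdditive.exists_ae_tendsto (p : PMF (Fin N)) {a : ℕ → (ℕ → Fin N) → ℝ} {c : ℝ}
    (h : AlmostAdditive a c) :
    ∃ l, ∀ᵐ i ∂(bernoulliMeas p), Tendsto (fun n : ℕ => a n i / n) atTop (𝓝 l) := by
  have hall : ∀ᵐ i ∂(bernoulliMeas p), ∀ m : ℕ, ∀ ε > 0, ∀ᶠ n : ℕ in atTop,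
      |a n i / n - (∫ i, a (m + 1) i ∂(bernoulliMeas p)) / (m + 1 : ℕ)| ≤ c / (m + 1 : ℕ) + ε :=
    ae_all_iff.2 fun m => h.ae_eventually_le p m.succ_pos
  obtain ⟨i₀, hi₀⟩ := hall.exists
  have hsmall : ∀ ε > 0, ∃ m : ℕ, c / (m + 1 : ℕ) ≤ ε := by
    intro ε hε
    have := tendsto_const_div_atTop_nhds_zero_nat c
    obtain ⟨m, hm⟩ := ((tendsto_add_atTop_iff_nat 1).2 this |>.eventually_lt_const hε).exists
    exact ⟨m, hm.le⟩
  have hcauchy : CauchySeq fun n : ℕ => a n i₀ / n := by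
    rw [Metric.cauchySeq_iff]
    intro ε hε
    obtain ⟨m, hm⟩ := hsmall (ε / 8) (by positivity)
    obtain ⟨n₀, hn₀⟩ := eventually_atTop.1 (hi₀ m (ε / 8) (by positivity))
    refine ⟨n₀, fun n hn n' hn' => ?_⟩
    have h1 := abs_le.1 (hn₀ n hn)
    have h2 := abs_le.1 (hn₀ n' hn')
    rw [Real.dist_eq, abs_lt]
    constructor <;> linarith [h1.1, h1.2, h2.1, h2.2]
  obtain ⟨l, hl⟩ := cauchySeq_tendsto_of_complete hcauchy
  refine ⟨l, ?_⟩
  filter_upwards [hall] with i hi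
  have hdiff : Tendsto (fun n : ℕ => a n i / n - a n i₀ / n) atTop (𝓝 0) := by
    rw [Metric.tendsto_nhds]
    intro ε hε
    obtain ⟨m, hm⟩ := hsmall (ε / 8) (by positivity)
    filter_upwards [hi₀ m (ε / 8) (by positivity), hi m (ε / 8) (by positivity)] with n h1 h2
    have h1 := abs_le.1 h1
    have h2 := abs_le.1 h2
    rw [dist_zero_right, Real.norm_eq_abs, abs_lt]
    constructor <;> linarith [h1.1, h1.2, h2.1, h2.2]
  simpa using hdiff.add hl

/-! ### Lyapunov exponents -/

theorem wordProd_congr (A : Fin N → Mat2) {i j : ℕ → Fin N} {n : ℕ} (h : ∀ k < n, i k = j k) :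
    wordProd A i n = wordProd A j n := by
  induction n with
  | zero => rfl
  | succ n ih => rw [wordProd, wordProd, ih fun k hk => h k (by omega), h n (by omega)]

theorem wordProd_eq_coc_prependRev (A : Fin N → Mat2) (i j : ℕ → Fin N) (n : ℕ) :
    wordProd A i n = coc A (prependRev n i j) n :=
  (coc_eq_wordProd A _ _ n fun k hk => by simp [prependRev, hk]).symm

theorem shiftBy_prependRev_add (m n : ℕ) (i j : ℕ → Fin N) :
    shiftBy n (prependRev (m + n) i j) = prependRev m i j := by
  funext k
  simp only [shiftBy, prependRev]
  split_ifs with h1 h2 h2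
  · congr 1; omega
  · omega
  · omega
  · congr 1; omega

/-- The lower bound is `exists_le_sv1_add` for the reversed word, in which the last n symbols come
first; the upper bound is submultiplicativity of the norm. -/
theorem exists_almostAdditive_log_sv1 {A : Fin N → Mat2} {L C δ : ℝ}
    (h : UniformlyDominated A L C δ) (h' : UniformlyDominated (fun i => (A i)⁻¹) L C δ) :
    ∃ c, AlmostAdditive (fun n i => Real.log (sv1 (wordProd A i n))) c := by
  obtain ⟨K, hK, hadd⟩ := UniformlyDominated.exists_le_sv1_add h h'
  refine ⟨Real.log K, fun n i j hij => by simp only [wordProd_congr A hij], fun m n i => ?_⟩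
  have hd := det_wordProd_ne_zero h.det_ne
  set j := prependRev (m + n) i i
  have e1 : wordProd A i (m + n) = coc A j (n + m) := by
    rw [add_comm n m]; exact wordProd_eq_coc_prependRev A i i (m + n)
  have e2 : wordProd A (shiftBy m i) n = coc A j n := by
    refine (coc_eq_wordProd A _ _ n fun k hk => ?_).symm
    simp only [j, prependRev, if_pos (show k < m + n by omega), shiftBy]
    congr 1; omega
  have e3 : wordProd A i m = coc A (shiftBy n j) m := by
    rw [shiftBy_prependRev_add]; exact wordProd_eq_coc_prependRev A i i m
  have p1 := sv1_pos (hd i (m + n))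
  have p2 := sv1_pos (hd (shiftBy m i) n)
  have p3 := sv1_pos (hd i m)
  have h1 := hadd j n m
  rw [← e1, ← e2, ← e3] at h1
  have h2 : sv1 (wordProd A i (m + n)) ≤
      sv1 (wordProd A i m) * sv1 (wordProd A (shiftBy m i) n) := by
    rw [e1, coc_add, ← e2, ← e3]; exact sv1_mul_le _ _
  have h1' := Real.log_le_log (by positivity) h1
  have h2' := Real.log_le_log p1 h2
  rw [Real.log_mul p2.ne' p3.ne', Real.log_mul (by positivity) p1.ne'] at h1'
  rw [Real.log_mul p3.ne' p2.ne'] at h2'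
  have := Real.log_nonneg hK
  rw [abs_le]; constructor <;> linarith

theorem log_abs_det_wordProd {A : Fin N → Mat2} (hA : ∀ i, (A i).det ≠ 0) (i : ℕ → Fin N) (n : ℕ) :
    Real.log |(wordProd A i n).det| = ∑ k ∈ Finset.range n, Real.log |(A (i k)).det| := by
  induction n with
  | zero => simp [wordProd]
  | succ n ih =>
    rw [wordProd, Matrix.det_mul, abs_mul, Real.log_mul (abs_ne_zero.2 (det_wordProd_ne_zero hA i n))
      (abs_ne_zero.2 (hA _)), ih, Finset.sum_range_succ]

/-- Almost additivity gives the limit for α₁. As log|det| is a sum of independent terms and α₂ =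
|det|/α₁, the limit for α₂ and the formula for the sum follow. The exponents are defined by choice,
so a limit has to be exhibited before anything is known about them. -/
theorem ae_tendsto_lyapunov {A : Fin N → Mat2} {L C δ : ℝ} (p : PMF (Fin N))
    (h : UniformlyDominated A L C δ) (h' : UniformlyDominated (fun i => (A i)⁻¹) L C δ) :
    (∀ᵐ i ∂(bernoulliMeas p),
      Tendsto (fun n : ℕ => Real.log (sv1 (wordProd A i n)) / n) atTop (𝓝 (-lyapS A p))) ∧
    (∀ᵐ i ∂(bernoulliMeas p),
      Tendsto (fun n : ℕ => Real.log (sv2 (wordProd A i n)) / n) atTop (𝓝 (-lyapSS A p))) ∧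
    lyapS A p + lyapSS A p = -∑ a, (p a).toReal * Real.log |(A a).det| := by
  obtain ⟨c, hadd⟩ := exists_almostAdditive_log_sv1 h h'
  obtain ⟨l, hl⟩ := hadd.exists_ae_tendsto p
  have hdet := ae_tendsto_average p fun a => Real.log |(A a).det|
  set D := ∑ a, (p a).toReal * Real.log |(A a).det|
  have h2 : ∀ᵐ i ∂(bernoulliMeas p),
      Tendsto (fun n : ℕ => Real.log (sv2 (wordProd A i n)) / n) atTop (𝓝 (D - l)) := by
    filter_upwards [hl, hdet] with i h1 h2
    refine (h2.sub h1).congr fun n => ?_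
    have hd := det_wordProd_ne_zero h.det_ne i n
    rw [← log_abs_det_wordProd h.det_ne, ← sv1_mul_sv2,
      Real.log_mul (sv1_pos hd).ne' (sv2_pos hd).ne']
    ring
  have e1 : ∀ x : ℝ, 1 / x = x⁻¹ := fun x => one_div x
  have s1 : ∀ᵐ i ∂(bernoulliMeas p), Tendsto
      (fun n : ℕ => 1 / (n : ℝ) * Real.log (sv1 (wordProd A i n))) atTop (𝓝 (-lyapS A p)) := by
    refine Classical.epsilon_spec (p := fun χ : ℝ => ∀ᵐ i ∂(bernoulliMeas p), Tendsto
      (fun n : ℕ => 1 / (n : ℝ) * Real.log (sv1 (wordProd A i n))) atTop (𝓝 (-χ))) ⟨-l, ?_⟩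
    filter_upwards [hl] with i hi
    rw [neg_neg]
    exact hi.congr fun n => by ring
  have s2 : ∀ᵐ i ∂(bernoulliMeas p), Tendsto
      (fun n : ℕ => 1 / (n : ℝ) * Real.log (sv2 (wordProd A i n))) atTop (𝓝 (-lyapSS A p)) := by
    refine Classical.epsilon_spec (p := fun χ : ℝ => ∀ᵐ i ∂(bernoulliMeas p), Tendsto
      (fun n : ℕ => 1 / (n : ℝ) * Real.log (sv2 (wordProd A i n))) atTop (𝓝 (-χ))) ⟨-(D - l), ?_⟩
    filter_upwards [h2] with i hi
    rw [neg_neg]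
    exact hi.congr fun n => by ring
  have t1 : ∀ᵐ i ∂(bernoulliMeas p),
      Tendsto (fun n : ℕ => Real.log (sv1 (wordProd A i n)) / n) atTop (𝓝 (-lyapS A p)) := by
    filter_upwards [s1] with i hi
    exact hi.congr fun n => by ring
  have t2 : ∀ᵐ i ∂(bernoulliMeas p),
      Tendsto (fun n : ℕ => Real.log (sv2 (wordProd A i n)) / n) atTop (𝓝 (-lyapSS A p)) := by
    filter_upwards [s2] with i hi
    exact hi.congr fun n => by ring
  refine ⟨t1, t2, ?_⟩
  obtain ⟨i, a1, a2, a3, a4⟩ := (hl.and (h2.and (t1.and t2))).exists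
  have b1 := tendsto_nhds_unique a1 a3
  have b2 := tendsto_nhds_unique a2 a4
  linarith

end

noncomputable section

/-! ### Frostman bounds and Hausdorff dimension -/

section Dimension

open Metric

variable {X : Type*} [MetricSpace X] [MeasurableSpace X]

/-- The measure satisfies a Frostman bound with exponent `s` at the point `x`. -/
def FrostmanAt (μ : Measure X) (s : ℝ) (x : X) : Prop :=
  ∃ C : ℝ, ∀ r, 0 < r → r ≤ 1 → μ (closedBall x r) ≤ ENNReal.ofReal (C * r ^ s)

/-- The measure satisfies a Frostman bound with exponent `s` at almost every point. -/
def FrostmanAE (μ : Measure X) (s : ℝ) : Prop := ∀ᵐ x ∂μ, FrostmanAt μ s x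

/-- The set of points where the Frostman bound holds with the constant `n` at dyadic scales. -/
def frostmanSet (μ : Measure X) (s : ℝ) (n : ℕ) : Set X :=
  {x | ∀ m : ℕ, μ (closedBall x ((1 / 2) ^ m)) ≤ ENNReal.ofReal (n * ((1 / 2) ^ m) ^ s)}

theorem exists_dyadic {r : ℝ} (h0 : 0 < r) (h1 : r ≤ 1) :
    ∃ m : ℕ, r ≤ (1 / 2) ^ m ∧ ((1 / 2 : ℝ) ^ m) ≤ 2 * r := by
  obtain ⟨m, hm1, hm2⟩ := exists_nat_pow_near_of_lt_one h0 h1 (by norm_num : (0:ℝ) < 1 / 2)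
    (by norm_num)
  refine ⟨m, hm2, ?_⟩
  rw [pow_succ] at hm1
  linarith

theorem frostmanAt_of_dyadic {μ : Measure X} {s : ℝ} (hs : 0 ≤ s) {x : X} {C : ℝ}
    (h : ∀ m : ℕ, μ (closedBall x ((1 / 2) ^ m)) ≤ ENNReal.ofReal (C * ((1 / 2) ^ m) ^ s))
    {r : ℝ} (h0 : 0 < r) (h1 : r ≤ 1) :
    μ (closedBall x r) ≤ ENNReal.ofReal (|C| * 2 ^ s * r ^ s) := by
  obtain ⟨m, hm1, hm2⟩ := exists_dyadic h0 h1
  refine (measure_mono (closedBall_subset_closedBall hm1)).trans ((h m).trans ?_)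
  refine ENNReal.ofReal_le_ofReal ?_
  rw [mul_assoc, ← Real.mul_rpow (by norm_num) h0.le]
  calc C * ((1 / 2) ^ m) ^ s ≤ |C| * ((1 / 2) ^ m) ^ s := by gcongr; exact le_abs_self C
    _ ≤ |C| * (2 * r) ^ s := by gcongr

/-- Restricting to dyadic radii and integer constants costs only a constant, and writes the Frostman
points as a countable union of sets with a uniform bound, each cut out by countably many conditions.
-/
theorem iUnion_frostmanSet {μ : Measure X} {s : ℝ} (hs : 0 ≤ s) :
    ⋃ n, frostmanSet μ s n = {x | FrostmanAt μ s x} := by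
  ext x
  simp only [Set.mem_iUnion]
  constructor
  · rintro ⟨n, hn⟩
    exact ⟨_, fun r h0 h1 => frostmanAt_of_dyadic hs hn h0 h1⟩
  · rintro ⟨C, hC⟩
    obtain ⟨n, hn⟩ := exists_nat_ge C
    refine ⟨n, fun m => (hC _ (by positivity) (pow_le_one₀ (by norm_num) (by norm_num))).trans ?_⟩
    exact ENNReal.ofReal_le_ofReal (by gcongr)

theorem measurable_measure_closedBall [SecondCountableTopology X] [BorelSpace X] (μ : Measure X)
    [SFinite μ] (r : ℝ) : Measurable fun x => μ (closedBall x r) := by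
  have : MeasurableSet {q : X × X | dist q.2 q.1 ≤ r} :=
    measurableSet_le (measurable_snd.dist measurable_fst) measurable_const
  exact measurable_measure_prodMk_left this

theorem measurableSet_frostmanSet [SecondCountableTopology X] [BorelSpace X] (μ : Measure X)
    [SFinite μ] (s : ℝ) (n : ℕ) : MeasurableSet (frostmanSet μ s n) := by
  have : frostmanSet μ s n = ⋂ m : ℕ,
      {x | μ (closedBall x ((1 / 2) ^ m)) ≤ ENNReal.ofReal (n * ((1 / 2) ^ m) ^ s)} := by
    ext; simp [frostmanSet]
  rw [this]
  exact .iInter fun m => measurableSet_le (measurable_measure_closedBall μ _) measurable_const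

theorem measurableSet_frostmanAt [SecondCountableTopology X] [BorelSpace X] (μ : Measure X)
    [SFinite μ] {s : ℝ} (hs : 0 ≤ s) : MeasurableSet {x | FrostmanAt μ s x} := by
  rw [← iUnion_frostmanSet hs]
  exact .iUnion fun n => measurableSet_frostmanSet μ s n

theorem FrostmanAE.mono {μ : Measure X} {s s' : ℝ} (h : FrostmanAE μ s) (hs : s' ≤ s) :
    FrostmanAE μ s' := by
  filter_upwards [h] with x hx
  obtain ⟨C, hC⟩ := hx
  refine ⟨|C|, fun r h0 h1 => (hC r h0 h1).trans (ENNReal.ofReal_le_ofReal ?_)⟩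
  calc C * r ^ s ≤ |C| * r ^ s := by gcongr; exact le_abs_self C
    _ ≤ |C| * r ^ s' :=
      mul_le_mul_of_nonneg_left (Real.rpow_le_rpow_of_exponent_ge h0 h1 hs) (abs_nonneg _)

theorem frostmanAt_of_nonpos {μ : Measure X} [IsFiniteMeasure μ] {s : ℝ} (hs : s ≤ 0) (x : X) :
    FrostmanAt μ s x := by
  refine ⟨(μ Set.univ).toReal, fun r h0 h1 => ?_⟩
  have h2 : 1 ≤ r ^ s := Real.one_le_rpow_of_pos_of_le_one_of_nonpos h0 h1 hs
  calc μ (closedBall x r) ≤ μ Set.univ := measure_mono (Set.subset_univ _)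
    _ = ENNReal.ofReal ((μ Set.univ).toReal * 1) := by
      rw [mul_one, ENNReal.ofReal_toReal (measure_ne_top _ _)]
    _ ≤ _ := ENNReal.ofReal_le_ofReal (by gcongr)

/-- Mass distribution principle. -/
theorem FrostmanAE.le_dimHMeasure [SecondCountableTopology X] [BorelSpace X] {μ : Measure X}
    [IsFiniteMeasure μ] [NeZero μ] {s : ℝ} (h : FrostmanAE μ s) :
    ENNReal.ofReal s ≤ dimHMeasure μ := by
  rcases le_or_gt s 0 with hs | hs
  · rw [ENNReal.ofReal_of_nonpos hs]; exact zero_le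
  refine le_iInf₂ fun E hE => ?_
  rw [ENNReal.ofReal]
  refine le_dimH_of_hausdorffMeasure_ne_zero fun h0 => ?_
  rw [Real.coe_toNNReal _ hs.le] at h0
  have hpos : ∃ n, μ (frostmanSet μ s n) ≠ 0 := by
    by_contra hcon
    push Not at hcon
    have h1 : μ (⋃ n, frostmanSet μ s n) = 0 := measure_iUnion_null hcon
    rw [iUnion_frostmanSet hs.le] at h1
    have h2 : μ {x | FrostmanAt μ s x}ᶜ = 0 := h
    have : μ Set.univ = 0 := by
      rw [← Set.union_compl_self {x | FrostmanAt μ s x}]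
      exact measure_union_null h1 h2
    exact NeZero.ne μ (Measure.measure_univ_eq_zero.1 this)
  obtain ⟨n, hn⟩ := hpos
  set K := frostmanSet μ s n
  have hK : MeasurableSet K := measurableSet_frostmanSet μ s n
  -- Taking n+1 in place of n keeps C positive, so that it can be inverted.
  set C : ℝ := (n + 1 : ℕ) * 2 ^ s
  have hC : 0 < C := by positivity
  have hfr : ∀ x ∈ K, ∀ r, 0 < r → r ≤ 1 → μ (closedBall x r) ≤ ENNReal.ofReal (C * r ^ s) := by
    intro x hx r hr0 hr1
    refine (frostmanAt_of_dyadic hs.le hx hr0 hr1).trans (ENNReal.ofReal_le_ofReal ?_)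
    simp only [C]
    rw [abs_of_nonneg (Nat.cast_nonneg n)]
    gcongr
    omega
  -- A set of diameter at most 1 that meets K lies in a ball centred in K whose radius is that
  -- diameter. Diameter zero is treated by letting the radius decrease to 0, as the Frostman bound
  -- needs a positive radius.
  have hle : (ENNReal.ofReal C)⁻¹ • μ.restrict K ≤ μH[s] := by
    refine Measure.le_hausdorffMeasure s _ 1 one_pos fun S hS => ?_
    rw [Measure.smul_apply, Measure.restrict_apply' hK, smul_eq_mul]
    rcases (S ∩ K).eq_empty_or_nonempty with hemp | ⟨x, hxS, hxK⟩
    · rw [hemp]; simp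
    have hCne : ENNReal.ofReal C ≠ 0 := by simpa using hC
    rw [← ENNReal.div_eq_inv_mul]
    refine ENNReal.div_le_of_le_mul' ?_
    have hfin : ediam S ≠ ∞ := ne_top_of_le_ne_top ENNReal.one_ne_top hS
    have hbound : ∀ r : ℝ, (ediam S).toReal ≤ r → 0 < r → r ≤ 1 →
        μ (S ∩ K) ≤ ENNReal.ofReal (C * r ^ s) := by
      intro r h1 h2 h3
      refine (measure_mono ?_).trans (hfr x hxK r h2 h3)
      rintro y ⟨hyS, -⟩
      rw [mem_closedBall, dist_edist]
      exact (ENNReal.toReal_mono hfin (edist_le_ediam_of_mem hyS hxS)).trans h1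
    have h1 : (ediam S).toReal ≤ 1 := by
      have := ENNReal.toReal_mono ENNReal.one_ne_top hS
      simpa using this
    rcases (ENNReal.toReal_nonneg (a := ediam S)).eq_or_lt with h0' | h0'
    · have hz : μ (S ∩ K) = 0 := by
        have hlim : Tendsto (fun r : ℝ => ENNReal.ofReal (C * r ^ s)) (𝓝[>] 0) (𝓝 0) := by
          have : Tendsto (fun r : ℝ => C * r ^ s) (𝓝 0) (𝓝 (C * 0 ^ s)) :=
            (Real.continuousAt_rpow_const 0 s (Or.inr hs.le)).tendsto.const_mul C
          rw [Real.zero_rpow hs.ne', mul_zero] at this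
          have h3 := (ENNReal.tendsto_ofReal this).mono_left
            (nhdsWithin_le_nhds (s := Set.Ioi (0:ℝ)))
          simpa using h3
        refine le_antisymm (ge_of_tendsto hlim ?_) zero_le
        filter_upwards [Ioc_mem_nhdsGT (zero_lt_one' ℝ)] with r hr
        exact hbound r (h0' ▸ hr.1.le) hr.1 hr.2
      rw [hz]; exact zero_le
    · refine (hbound _ le_rfl h0' h1).trans_eq ?_
      rw [ENNReal.ofReal_mul hC.le, ← ENNReal.ofReal_rpow_of_pos h0', ENNReal.ofReal_toReal hfin]
  have h1 : ((ENNReal.ofReal C)⁻¹ • μ.restrict K) E = 0 := le_antisymm ((hle E).trans h0.le) zero_le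
  rw [Measure.smul_apply, smul_eq_mul, mul_eq_zero, Measure.restrict_apply' hK] at h1
  have h2 : μ (E ∩ K) = 0 := h1.resolve_left (by simp)
  refine hn (le_antisymm ?_ zero_le)
  calc μ K ≤ μ ((E ∩ K) ∪ Eᶜ) := measure_mono fun x hx => by
        by_cases hxE : x ∈ E
        · exact Or.inl ⟨hxE, hx⟩
        · exact Or.inr hxE
    _ ≤ μ (E ∩ K) + μ Eᶜ := measure_union_le _ _
    _ = 0 := by rw [h2, hE, add_zero]

/-- The set of points where the Frostman bound fails is small. -/
theorem dimH_not_frostmanAt_le [SecondCountableTopology X] [BorelSpace X] (μ : Measure X)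
    [IsFiniteMeasure μ] {s : ℝ} (hs : 0 < s) :
    dimH {x | ¬ FrostmanAt μ s x} ≤ ENNReal.ofReal s := by
  set E := {x | ¬ FrostmanAt μ s x} with hE
  set M := (μ Set.univ).toReal with hM
  have hM0 : 0 ≤ M := ENNReal.toReal_nonneg
  have hex : ∀ (n : ℕ) (x : E), ∃ r, 0 < r ∧ r ≤ 1 ∧
      ENNReal.ofReal ((n + 1 : ℕ) * r ^ s) < μ (closedBall (x : X) r) := by
    rintro n ⟨x, hx⟩
    have : ¬ FrostmanAt μ s x := hx
    unfold FrostmanAt at this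
    push Not at this
    exact this _
  choose r hr0 hr1 hr using hex
  have hrs : ∀ n x, r n x ^ s ≤ M / (n + 1 : ℕ) := by
    intro n x
    have h1 := (hr n x).le.trans (measure_mono (Set.subset_univ _))
    have h2 := (ENNReal.ofReal_le_iff_le_toReal (measure_ne_top _ _)).1 h1
    rw [le_div_iff₀ (by positivity)]
    linarith
  have hrle : ∀ n x, r n x ≤ (M / (n + 1 : ℕ)) ^ s⁻¹ := by
    intro n x
    have h2 := Real.rpow_le_rpow (by have := hr0 n x; positivity) (hrs n x) (inv_pos.2 hs).le
    rwa [← Real.rpow_mul (hr0 n x).le, mul_inv_cancel₀ hs.ne', Real.rpow_one] at h2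
  -- For each n a disjoint family of too heavy balls has enlargements covering E. Since r^s <
  -- μ(B)/(n+1), the sum of the (10r)^s is at most 10^s μ(X)/(n+1), which tends to 0.
  have hvit := fun n => Vitali.exists_disjoint_subfamily_covering_enlargement_closedBall
    (Set.univ : Set E) (fun x => (x : X)) (r n) 1 (fun x _ => hr1 n x) 5 (by norm_num)
  choose u _ hdisj hcov using hvit
  have hcount : ∀ n, Countable (u n) := by
    intro n
    refine ((hdisj n).countable_of_nonempty_interior fun x _ => ?_).to_subtype
    exact ⟨x, mem_interior.2 ⟨ball (x : X) (r n x), ball_subset_closedBall, isOpen_ball,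
      mem_ball_self (hr0 n x)⟩⟩
  have hH : μH[s] E = 0 := by
    refine le_antisymm ?_ zero_le
    have hlim0 : Tendsto (fun n : ℕ => M / ((n + 1 : ℕ) : ℝ)) atTop (𝓝 0) :=
      (tendsto_add_atTop_iff_nat 1).2 (tendsto_const_div_atTop_nhds_zero_nat M)
    have hrad : Tendsto (fun n : ℕ => ENNReal.ofReal (10 * (M / (n + 1 : ℕ)) ^ s⁻¹)) atTop
        (𝓝 0) := by
      have h1 := ((Real.continuousAt_rpow_const 0 s⁻¹ (Or.inr (inv_pos.2 hs).le)).tendsto.comp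
        hlim0).const_mul 10
      rw [Real.zero_rpow (inv_pos.2 hs).ne', mul_zero] at h1
      simpa using ENNReal.tendsto_ofReal h1
    have hdiam : ∀ n (x : E), ediam (closedBall (x : X) (5 * r n x)) ≤
        ENNReal.ofReal (10 * r n x) := by
      intro n x
      refine ediam_le_of_forall_dist_le fun y hy z hz => ?_
      rw [mem_closedBall] at hy hz
      linarith [dist_triangle_right y z (x : X)]
    have key := Measure.hausdorffMeasure_le_liminf_tsum s E (l := atTop) _ hrad
      (fun n (x : u n) => closedBall ((x : E) : X) (5 * r n x))
      (Eventually.of_forall fun n x => (hdiam n x).trans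
        (ENNReal.ofReal_le_ofReal (by have := hrle n x; gcongr)))
      (Eventually.of_forall fun n x hx => by
        obtain ⟨b, hb, hsub⟩ := hcov n ⟨x, hx⟩ trivial
        exact Set.mem_iUnion.2 ⟨⟨b, hb⟩, hsub (mem_closedBall_self (hr0 n _).le)⟩)
    refine key.trans ?_
    have hbound : ∀ n : ℕ, ∑' x : u n, ediam (closedBall ((x : E) : X) (5 * r n x)) ^ s ≤
        ENNReal.ofReal (10 ^ s * (M / (n + 1 : ℕ))) := by
      intro n
      have hterm : ∀ x : u n, ediam (closedBall ((x : E) : X) (5 * r n x)) ^ s ≤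
          ENNReal.ofReal (10 ^ s / (n + 1 : ℕ)) * μ (closedBall ((x : E) : X) (r n x)) := by
        intro x
        have hx0 := hr0 n x
        calc _ ≤ ENNReal.ofReal (10 * r n x) ^ s := ENNReal.rpow_le_rpow (hdiam n x) hs.le
          _ = ENNReal.ofReal (10 ^ s / (n + 1 : ℕ)) *
              ENNReal.ofReal ((n + 1 : ℕ) * r n x ^ s) := by
            rw [ENNReal.ofReal_rpow_of_pos (by positivity), ← ENNReal.ofReal_mul (by positivity),
              Real.mul_rpow (by norm_num) hx0.le]
            congr 1
            field_simp
          _ ≤ _ := mul_le_mul_right (hr n x).le _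
      refine (ENNReal.tsum_le_tsum hterm).trans ?_
      rw [ENNReal.tsum_mul_left]
      have hsum : ∑' x : u n, μ (closedBall ((x : E) : X) (r n x)) ≤ μ Set.univ := by
        have := hcount n
        refine (tsum_meas_le_meas_iUnion_of_disjoint μ
          (As := fun x : u n => closedBall ((x : E) : X) (r n x))
          (fun x => isClosed_closedBall.measurableSet) ?_).trans (measure_mono (Set.subset_univ _))
        intro x y hxy
        exact hdisj n x.2 y.2 fun h => hxy (Subtype.ext h)
      refine (mul_le_mul_right hsum _).trans_eq ?_
      rw [← ENNReal.ofReal_toReal (measure_ne_top μ Set.univ), ← ENNReal.ofReal_mul (by positivity)]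
      congr 1
      rw [← hM]; ring
    have hlim : Tendsto (fun n : ℕ => ENNReal.ofReal (10 ^ s * (M / (n + 1 : ℕ)))) atTop (𝓝 0) := by
      have h1 := hlim0.const_mul ((10:ℝ) ^ s)
      rw [mul_zero] at h1
      simpa using ENNReal.tendsto_ofReal h1
    rw [← hlim.liminf_eq]
    exact liminf_le_liminf (Eventually.of_forall hbound)
  rw [ENNReal.ofReal]
  refine dimH_le_of_hausdorffMeasure_ne_top ?_
  rw [Real.coe_toNNReal _ hs.le, hH]
  exact ENNReal.zero_ne_top

/-- Upper bound for the Hausdorff dimension by exponentially fine coverings. -/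
theorem dimH_le_of_covering [BorelSpace X] {F : Set X} {a b C : ℝ} (ha : 0 ≤ a) (hb : 0 < b)
    (h : ∀ᶠ n : ℕ in atTop, ∃ (m : ℕ) (t : Fin m → Set X), F ⊆ (⋃ i, t i) ∧
      (m : ℝ) ≤ C * Real.exp (a * n) ∧ ∀ i, ediam (t i) ≤ ENNReal.ofReal (C * Real.exp (-b * n))) :
    dimH F ≤ ENNReal.ofReal (a / b) := by
  obtain ⟨n₀, hn₀⟩ := eventually_atTop.1 h
  have h' := fun n : ℕ => hn₀ (n + n₀) (by omega)
  choose m t hcov hm hdiam using h'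
  have hC : 0 ≤ C := by
    by_contra hneg
    have h1 := hm 0
    have h2 := mul_neg_of_neg_of_pos (not_le.1 hneg) (Real.exp_pos (a * (0 + n₀ : ℕ)))
    have : (0:ℝ) ≤ m 0 := Nat.cast_nonneg _
    linarith
  have hshift : Tendsto (fun n : ℕ => n + n₀) atTop atTop := tendsto_add_atTop_nat n₀
  have hlim0 : ∀ q > 0, Tendsto (fun n : ℕ => Real.exp (-q * (n + n₀ : ℕ))) atTop (𝓝 0) := by
    intro q hq
    refine Real.tendsto_exp_atBot.comp ?_
    simp_rw [neg_mul]
    exact tendsto_neg_atTop_atBot.comp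
      (((tendsto_natCast_atTop_atTop (R := ℝ)).comp hshift).const_mul_atTop hq)
  have key : ∀ d : ℝ, a / b < d → dimH F ≤ ENNReal.ofReal d := by
    intro d hd
    have hd0 : 0 < d := (div_nonneg ha hb.le).trans_lt hd
    have hq : 0 < b * d - a := by
      rw [div_lt_iff₀ hb] at hd; linarith
    have hH : μH[d] F = 0 := by
      refine le_antisymm ?_ zero_le
      have hrad : Tendsto (fun n : ℕ => ENNReal.ofReal (C * Real.exp (-b * (n + n₀ : ℕ)))) atTop
          (𝓝 0) := by
        have := (hlim0 b hb).const_mul C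
        rw [mul_zero] at this
        simpa using ENNReal.tendsto_ofReal this
      refine (Measure.hausdorffMeasure_le_liminf_sum d F (l := atTop) _ hrad t
        (Eventually.of_forall hdiam) (Eventually.of_forall hcov)).trans ?_
      have hbound : ∀ n : ℕ, ∑ i, ediam (t n i) ^ d ≤
          ENNReal.ofReal (C * C ^ d * Real.exp (-(b * d - a) * (n + n₀ : ℕ))) := by
        intro n
        calc ∑ i, ediam (t n i) ^ d
            ≤ ∑ _i : Fin (m n), ENNReal.ofReal (C * Real.exp (-b * (n + n₀ : ℕ))) ^ d :=
              Finset.sum_le_sum fun i _ => ENNReal.rpow_le_rpow (hdiam n i) hd0.le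
          _ = ENNReal.ofReal (m n * (C * Real.exp (-b * (n + n₀ : ℕ))) ^ d) := by
              rw [Finset.sum_const, Finset.card_univ, Fintype.card_fin, nsmul_eq_mul,
                ENNReal.ofReal_rpow_of_nonneg (by positivity) hd0.le,
                ENNReal.ofReal_mul (Nat.cast_nonneg _), ENNReal.ofReal_natCast]
          _ ≤ _ := by
              refine ENNReal.ofReal_le_ofReal ?_
              rw [Real.mul_rpow hC (Real.exp_pos _).le, ← Real.exp_mul]
              calc (m n : ℝ) * (C ^ d * Real.exp (-b * (n + n₀ : ℕ) * d))
                  ≤ C * Real.exp (a * (n + n₀ : ℕ)) *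
                    (C ^ d * Real.exp (-b * (n + n₀ : ℕ) * d)) := by
                    have := hm n
                    gcongr
                _ = C * C ^ d * (Real.exp (a * (n + n₀ : ℕ)) *
                    Real.exp (-b * (n + n₀ : ℕ) * d)) := by ring
                _ = _ := by rw [← Real.exp_add]; congr 2; ring
      have hlim : Tendsto (fun n : ℕ =>
          ENNReal.ofReal (C * C ^ d * Real.exp (-(b * d - a) * (n + n₀ : ℕ)))) atTop (𝓝 0) := by
        have := (hlim0 _ hq).const_mul (C * C ^ d)
        rw [mul_zero] at this
        simpa using ENNReal.tendsto_ofReal this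
      rw [← hlim.liminf_eq]
      exact liminf_le_liminf (Eventually.of_forall hbound)
    rw [ENNReal.ofReal]
    refine dimH_le_of_hausdorffMeasure_ne_top ?_
    rw [Real.coe_toNNReal _ hd0.le, hH]
    exact ENNReal.zero_ne_top
  have hcont : Tendsto (fun d : ℝ => ENNReal.ofReal d) (𝓝[>] (a / b)) (𝓝 (ENNReal.ofReal (a / b))) :=
    (ENNReal.continuous_ofReal.tendsto _).mono_left nhdsWithin_le_nhds
  exact ge_of_tendsto hcont (eventually_mem_nhdsWithin.mono key)

end Dimension

end

noncomputable section

/-! ### Projections of measures in typical directions -/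

open Metric

/-- The distance from a point to a line through the origin. -/
def distToLine (l : ℙ ℝ Plane) (z : Plane) : ℝ := ‖z - lineProjection l z‖

theorem distToLine_eq (l : ℙ ℝ Plane) (z : Plane) : distToLine l z = |cross (dir l) z| := by
  rw [distToLine, lineProjection_apply, unit_decomp (norm_dir l)]

theorem continuous_distToLine : Continuous fun q : ℙ ℝ Plane × Plane => distToLine q.1 q.2 := by
  have h : Continuous lineProjection := by
    have : Isometry lineProjection := Isometry.of_dist_eq fun _ _ => rfl
    exact this.continuous
  unfold distToLine
  exact (continuous_snd.sub ((h.comp continuous_fst).clm_apply continuous_snd)).norm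

/-- Each of the two lines is within ρ/‖w‖ of the line spanned by w. -/
theorem dist_le_of_distToLine_le {l m : ℙ ℝ Plane} {w : Plane} (hw : w ≠ 0) {ρ : ℝ}
    (hl : distToLine l w ≤ ρ) (hm : distToLine m w ≤ ρ) : dist l m ≤ 2 * ρ / ‖w‖ := by
  have hn : 0 < ‖w‖ := norm_pos_iff.2 hw
  set v : Plane := ‖w‖⁻¹ • w with hv
  have hv1 : ‖v‖ = 1 := by rw [hv, norm_smul, norm_inv, norm_norm, inv_mul_cancel₀ hn.ne']
  have hv0 : v ≠ 0 := by rw [← norm_ne_zero_iff, hv1]; exact one_ne_zero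
  have key : ∀ k : ℙ ℝ Plane, distToLine k w ≤ ρ → dist k (lineThrough v hv0) ≤ ρ / ‖w‖ := by
    intro k hk
    rw [dist_dir_lineThrough hv1, hv, cross_smul_right, abs_mul, abs_inv, abs_norm,
      ← distToLine_eq, ← div_eq_inv_mul]
    gcongr
  have h1 := key l hl
  have h2 := key m hm
  have e : 2 * ρ / ‖w‖ = ρ / ‖w‖ + ρ / ‖w‖ := by ring
  rw [e]
  exact (dist_triangle_right _ _ _).trans (add_le_add h1 h2)

variable {η : Measure (ℙ ℝ Plane)} [IsFiniteMeasure η] {μ : Measure Plane} [IsFiniteMeasure μ]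

/-- The lines passing within ρ of w form an arc of size ρ/‖w‖, to which the uniform Frostman bound
applies. Arcs of size above 1 are bounded by the total mass, whence the term M in the constant. -/
theorem exists_measure_tube_le (s : ℝ) (hs : 0 ≤ s) (n : ℕ) :
    ∃ B : ℝ, 0 ≤ B ∧ ∀ w : Plane, w ≠ 0 → ∀ ρ > 0,
      η (frostmanSet η s n ∩ {l | distToLine l w ≤ ρ}) ≤
        ENNReal.ofReal (B * (ρ ^ s * ‖w‖ ^ (-s))) := by
  set M := (η Set.univ).toReal
  have hM0 : 0 ≤ M := ENNReal.toReal_nonneg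
  refine ⟨(M + n * 2 ^ s) * 2 ^ s, by positivity, fun w hw ρ hρ => ?_⟩
  have hn : 0 < ‖w‖ := norm_pos_iff.2 hw
  have e : ∀ c : ℝ, c * 2 ^ s * (ρ ^ s * ‖w‖ ^ (-s)) = c * (2 * ρ / ‖w‖) ^ s := by
    intro c
    rw [Real.div_rpow (by positivity) hn.le, Real.mul_rpow (by norm_num) hρ.le,
      Real.rpow_neg hn.le]
    ring
  rw [e]
  have hr0 : 0 < 2 * ρ / ‖w‖ := by positivity
  rcases le_or_gt (2 * ρ / ‖w‖) 1 with hr | hr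
  · rcases (frostmanSet η s n ∩ {l | distToLine l w ≤ ρ}).eq_empty_or_nonempty with h0 | ⟨l, hl1, hl2⟩
    · rw [h0]; simp
    have hsub : frostmanSet η s n ∩ {l | distToLine l w ≤ ρ} ⊆ closedBall l (2 * ρ / ‖w‖) :=
      fun m hm => dist_le_of_distToLine_le hw hm.2 hl2
    refine (measure_mono hsub).trans ((frostmanAt_of_dyadic hs hl1 hr0 hr).trans
      (ENNReal.ofReal_le_ofReal ?_))
    rw [abs_of_nonneg (Nat.cast_nonneg n)]
    have : 0 ≤ M * (2 * ρ / ‖w‖) ^ s := by positivity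
    linarith
  · calc η (frostmanSet η s n ∩ {l | distToLine l w ≤ ρ}) ≤ η Set.univ :=
        measure_mono (Set.subset_univ _)
      _ = ENNReal.ofReal (M * 1) := by
        rw [mul_one, ENNReal.ofReal_toReal (measure_ne_top _ _)]
      _ ≤ _ := by
        refine ENNReal.ofReal_le_ofReal ?_
        have h1 : 1 ≤ (2 * ρ / ‖w‖) ^ s := Real.one_le_rpow hr.le hs
        have h2 : M ≤ M + n * 2 ^ s := by
          have : (0:ℝ) ≤ n * 2 ^ s := by positivity
          linarith
        exact mul_le_mul h2 h1 zero_le_one (by positivity)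

/-- A dyadic version of the Riesz kernel `‖w‖ ^ (-s)`. -/
def dyadicKernel (s : ℝ) (w : Plane) : ℝ≥0∞ :=
  1 + ∑' k : ℕ, (closedBall (0 : Plane) ((1 / 2) ^ k)).indicator
    (fun _ => ENNReal.ofReal (((1 / 2 : ℝ) ^ k) ^ (-s))) w

theorem rpow_neg_le_dyadicKernel {s : ℝ} (hs : 0 ≤ s) {w : Plane} (hw : w ≠ 0) :
    ENNReal.ofReal (‖w‖ ^ (-s)) ≤ ENNReal.ofReal (2 ^ s) * dyadicKernel s w := by
  have hn : 0 < ‖w‖ := norm_pos_iff.2 hw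
  have h2 : (1:ℝ≥0∞) ≤ ENNReal.ofReal (2 ^ s) := by
    rw [ENNReal.one_le_ofReal]; exact Real.one_le_rpow (by norm_num) hs
  rcases le_or_gt ‖w‖ 1 with h1 | h1
  · obtain ⟨k, hk1, hk2⟩ := exists_dyadic hn h1
    have hmem : w ∈ closedBall (0 : Plane) ((1 / 2) ^ k) := by simpa using hk1
    have hle : ENNReal.ofReal (((1 / 2 : ℝ) ^ k) ^ (-s)) ≤ dyadicKernel s w := by
      refine le_trans ?_ (le_add_left (ENNReal.le_tsum k))
      rw [Set.indicator_of_mem hmem]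
    refine le_trans ?_ (mul_le_mul_right hle _)
    rw [← ENNReal.ofReal_mul (by positivity)]
    refine ENNReal.ofReal_le_ofReal ?_
    have h3 : (2 * ‖w‖) ^ (-s) ≤ ((1 / 2 : ℝ) ^ k) ^ (-s) :=
      Real.rpow_le_rpow_of_nonpos (by positivity) hk2 (by linarith)
    rw [Real.mul_rpow (by norm_num) hn.le] at h3
    calc ‖w‖ ^ (-s) = 2 ^ s * (2 ^ (-s) * ‖w‖ ^ (-s)) := by
          rw [← mul_assoc, ← Real.rpow_add (by norm_num)]; simp
      _ ≤ _ := by gcongr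
  · calc ENNReal.ofReal (‖w‖ ^ (-s)) ≤ 1 := by
          rw [ENNReal.ofReal_le_one]
          exact Real.rpow_le_one_of_one_le_of_nonpos h1.le (by linarith)
      _ ≤ ENNReal.ofReal (2 ^ s) * dyadicKernel s w :=
          one_le_mul h2 (le_add_right le_rfl)

theorem dyadicKernel_zero {s : ℝ} (hs : 0 ≤ s) : dyadicKernel s 0 = ∞ := by
  rw [dyadicKernel, ENNReal.add_eq_top]
  right
  refine top_unique ?_
  rw [← ENNReal.tsum_const_eq_top_of_ne_zero (α := ℕ) one_ne_zero]
  refine ENNReal.tsum_le_tsum fun k => ?_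
  rw [Set.indicator_of_mem (mem_closedBall_self (by positivity)), ENNReal.one_le_ofReal]
  exact Real.one_le_rpow_of_pos_of_le_one_of_nonpos (by positivity)
    (pow_le_one₀ (by norm_num) (by norm_num)) (by linarith)

theorem tsum_geometric_ne_top (C : ℝ) {a b : ℝ} (hab : a < b) :
    ∑' k : ℕ, ENNReal.ofReal (C * (((1 / 2 : ℝ) ^ k) ^ (-a) * ((1 / 2 : ℝ) ^ k) ^ b)) ≠ ∞ := by
  have h1 : ∀ k : ℕ, ((1 / 2 : ℝ) ^ k) ^ (-a) * ((1 / 2 : ℝ) ^ k) ^ b = ((1 / 2 : ℝ) ^ (b - a)) ^ k := by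
    intro k
    rw [← Real.rpow_add (by positivity), ← Real.rpow_natCast, ← Real.rpow_natCast,
      ← Real.rpow_mul (by norm_num), ← Real.rpow_mul (by norm_num)]
    congr 1; ring
  simp_rw [h1]
  have hs : Summable fun k : ℕ => C * ((1 / 2 : ℝ) ^ (b - a)) ^ k :=
    (summable_geometric_of_lt_one (by positivity)
      (Real.rpow_lt_one (by norm_num) (by norm_num) (by linarith))).mul_left C
  exact hs.tsum_ofReal_ne_top

/-- The shell of radius 2^(-k) contributes at most 2^(ks)·C·2^(-kt), a geometric series. -/
theorem lintegral_dyadicKernel_ne_top {s t : ℝ} (hst : s < t) {y : Plane} (hy : FrostmanAt μ t y) :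
    ∫⁻ z, dyadicKernel s (z - y) ∂μ ≠ ∞ := by
  obtain ⟨C, hC⟩ := hy
  unfold dyadicKernel
  rw [lintegral_add_left measurable_const, lintegral_const, one_mul, lintegral_tsum]
  · refine ENNReal.add_ne_top.2 ⟨measure_ne_top _ _, ?_⟩
    refine ne_top_of_le_ne_top (tsum_geometric_ne_top C hst) (ENNReal.tsum_le_tsum fun k => ?_)
    have : ∀ z : Plane, (closedBall (0 : Plane) ((1 / 2) ^ k)).indicator
        (fun _ => ENNReal.ofReal (((1 / 2 : ℝ) ^ k) ^ (-s))) (z - y) =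
        (closedBall y ((1 / 2) ^ k)).indicator
          (fun _ => ENNReal.ofReal (((1 / 2 : ℝ) ^ k) ^ (-s))) z := by
      intro z
      simp only [Set.indicator, mem_closedBall, dist_eq_norm, sub_zero]
    simp_rw [this]
    rw [lintegral_indicator_const isClosed_closedBall.measurableSet]
    refine (mul_le_mul_right (hC _ (by positivity)
      (pow_le_one₀ (by norm_num) (by norm_num))) _).trans_eq ?_
    rw [← ENNReal.ofReal_mul (by positivity)]
    congr 1; ring
  · intro k
    exact ((measurable_const.indicator isClosed_closedBall.measurableSet).comp
      (measurable_id.sub_const y)).aemeasurable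

/-- The weighted sum over dyadic scales of the measures of the tubes around a line. -/
def tubeSum (μ : Measure Plane) (s : ℝ) (q : Plane × ℙ ℝ Plane) : ℝ≥0∞ :=
  ∑' m : ℕ, ENNReal.ofReal (((1 / 2 : ℝ) ^ m) ^ (-s)) *
    μ {z | distToLine q.2 (z - q.1) ≤ (1 / 2) ^ m}

theorem measurableSet_tube (r : ℝ) : MeasurableSet
    {x : (Plane × ℙ ℝ Plane) × Plane | distToLine x.1.2 (x.2 - x.1.1) ≤ r} := by
  have h1 : Measurable fun x : (Plane × ℙ ℝ Plane) × Plane => (x.1.2, x.2 - x.1.1) :=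
    (measurable_snd.comp measurable_fst).prodMk
      (measurable_snd.sub (measurable_fst.comp measurable_fst))
  have h2 := continuous_distToLine.measurable.comp h1
  exact measurableSet_le h2 measurable_const

theorem measurable_tubeSum (s : ℝ) : Measurable (tubeSum μ s) := by
  have h : ∀ m : ℕ, Measurable fun q : Plane × ℙ ℝ Plane =>
      μ {z | distToLine q.2 (z - q.1) ≤ (1 / 2) ^ m} := fun m =>
    measurable_measure_prodMk_left (ν := μ) (measurableSet_tube ((1 / 2) ^ m))
  exact Measurable.tsum fun m => (h m).const_mul _

/-- Integrate over directions first. For fixed z the directions whose tube of width 2^(-m) through y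
contains z have measure at most about (2^(-m)/‖z-y‖)^s; the weighted sum over m converges because s'
< s. What is left is the Riesz potential of order s at y, finite because s < t. -/
theorem setLIntegral_tubeSum_ne_top {s' s t : ℝ} (hs' : 0 ≤ s') (h1 : s' < s) (h2 : s < t) (n : ℕ)
    {y : Plane} (hy : FrostmanAt μ t y) :
    ∫⁻ l in frostmanSet η s n, tubeSum μ s' (y, l) ∂η ≠ ∞ := by
  have hs : 0 ≤ s := hs'.trans h1.le
  obtain ⟨B, hB, htube⟩ := exists_measure_tube_le (η := η) s hs n
  set Θ := frostmanSet η s n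
  have hmeas : ∀ m : ℕ, MeasurableSet
      {x : ℙ ℝ Plane × Plane | distToLine x.1 (x.2 - y) ≤ (1 / 2) ^ m} := fun m =>
    (isClosed_le (continuous_distToLine.comp
      (continuous_fst.prodMk (continuous_snd.sub continuous_const))) continuous_const).measurableSet
  have hswap : ∫⁻ l in Θ, tubeSum μ s' (y, l) ∂η =
      ∫⁻ z, ∑' m : ℕ, ENNReal.ofReal (((1 / 2 : ℝ) ^ m) ^ (-s')) *
        (η.restrict Θ) {l | distToLine l (z - y) ≤ (1 / 2) ^ m} ∂μ := by
    unfold tubeSum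
    rw [lintegral_tsum, lintegral_tsum]
    · refine tsum_congr fun m => ?_
      rw [lintegral_const_mul' _ _ ENNReal.ofReal_ne_top,
        lintegral_const_mul' _ _ ENNReal.ofReal_ne_top]
      congr 1
      exact (Measure.prod_apply (hmeas m)).symm.trans (Measure.prod_apply_symm (hmeas m))
    · exact fun m => ((measurable_measure_prodMk_right (hmeas m)).const_mul _).aemeasurable
    · exact fun m => ((measurable_measure_prodMk_left (hmeas m)).const_mul _).aemeasurable
  rw [hswap]
  set T : ℝ≥0∞ := ∑' m : ℕ, ENNReal.ofReal
    (B * (((1 / 2 : ℝ) ^ m) ^ (-s') * ((1 / 2 : ℝ) ^ m) ^ s)) with hT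
  have hTtop : T ≠ ∞ := tsum_geometric_ne_top B h1
  set T' : ℝ≥0∞ := (T + 1) * ENNReal.ofReal (2 ^ s) with hT'
  have hT'0 : T' ≠ 0 := by
    refine mul_ne_zero (by simp) ?_
    rw [Ne, ENNReal.ofReal_eq_zero, not_le]; positivity
  have hT'top : T' ≠ ∞ := ENNReal.mul_ne_top (by simp [hTtop]) ENNReal.ofReal_ne_top
  have hbound : ∀ z, ∑' m : ℕ, ENNReal.ofReal (((1 / 2 : ℝ) ^ m) ^ (-s')) *
        (η.restrict Θ) {l | distToLine l (z - y) ≤ (1 / 2) ^ m} ≤ T' * dyadicKernel s (z - y) := by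
    intro z
    by_cases hz : z - y = 0
    · rw [hz, dyadicKernel_zero hs, ENNReal.mul_top hT'0]; exact le_top
    have hn : 0 < ‖z - y‖ := norm_pos_iff.2 hz
    have hml : ∀ m : ℕ, MeasurableSet {l | distToLine l (z - y) ≤ (1 / 2) ^ m} := fun m =>
      (isClosed_le (continuous_distToLine.comp
        (continuous_id.prodMk continuous_const)) continuous_const).measurableSet
    have hterm : ∀ m : ℕ, ENNReal.ofReal (((1 / 2 : ℝ) ^ m) ^ (-s')) *
        (η.restrict Θ) {l | distToLine l (z - y) ≤ (1 / 2) ^ m} ≤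
        ENNReal.ofReal (B * (((1 / 2 : ℝ) ^ m) ^ (-s') * ((1 / 2 : ℝ) ^ m) ^ s)) *
          ENNReal.ofReal (‖z - y‖ ^ (-s)) := by
      intro m
      rw [Measure.restrict_apply (hml m), Set.inter_comm]
      refine (mul_le_mul_right (htube _ hz _ (by positivity)) _).trans_eq ?_
      rw [← ENNReal.ofReal_mul (by positivity), ← ENNReal.ofReal_mul (by positivity)]
      congr 1; ring
    refine (ENNReal.tsum_le_tsum hterm).trans ?_
    rw [ENNReal.tsum_mul_right, ← hT, hT', mul_assoc]
    exact mul_le_mul' (le_add_right le_rfl) (rpow_neg_le_dyadicKernel hs hz)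
  refine ne_top_of_le_ne_top ?_ (lintegral_mono hbound)
  rw [lintegral_const_mul' _ _ hT'top]
  exact ENNReal.mul_ne_top hT'top (lintegral_dyadicKernel_ne_top h2 hy)

/-- Almost every projection of a measure along a typical direction satisfies Frostman bounds. -/
theorem ae_exists_tube_le {s' s t : ℝ} (hs' : 0 ≤ s') (h1 : s' < s) (h2 : s < t)
    (hη : FrostmanAE η s) (hμ : FrostmanAE μ t) :
    ∀ᵐ q ∂(μ.prod η), ∃ C : ℝ, ∀ ρ, 0 < ρ → ρ ≤ 1 →
      μ {z | distToLine q.2 (z - q.1) ≤ ρ} ≤ ENNReal.ofReal (C * ρ ^ s') := by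
  have hfin : ∀ᵐ q ∂(μ.prod η), tubeSum μ s' q < ∞ := by
    rw [Measure.ae_prod_iff_ae_ae (measurableSet_lt (measurable_tubeSum s') measurable_const)]
    filter_upwards [hμ] with y hy
    have hall : ∀ n : ℕ, ∀ᵐ l ∂η, l ∈ frostmanSet η s n → tubeSum μ s' (y, l) < ∞ := fun n => by
      rw [← ae_restrict_iff' (measurableSet_frostmanSet η s n)]
      exact ae_lt_top ((measurable_tubeSum s').comp measurable_prodMk_left)
        (setLIntegral_tubeSum_ne_top hs' h1 h2 n hy)
    filter_upwards [ae_all_iff.2 hall, hη] with l hl hlf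
    have : l ∈ ⋃ n, frostmanSet η s n := by
      rw [iUnion_frostmanSet (hs'.trans h1.le)]; exact hlf
    obtain ⟨n, hn⟩ := Set.mem_iUnion.1 this
    exact hl n hn
  filter_upwards [hfin] with q hq
  refine ⟨(tubeSum μ s' q).toReal * 2 ^ s', fun ρ h0 hρ1 => ?_⟩
  obtain ⟨m, hm1, hm2⟩ := exists_dyadic h0 hρ1
  set w : ℝ := ((1 / 2 : ℝ) ^ m) with hw
  have hw0 : 0 < w := by positivity
  have h3 : ENNReal.ofReal (w ^ (-s')) * μ {z | distToLine q.2 (z - q.1) ≤ w} ≤ tubeSum μ s' q :=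
    ENNReal.le_tsum m
  have h4 : μ {z | distToLine q.2 (z - q.1) ≤ w} ≤
      ENNReal.ofReal ((tubeSum μ s' q).toReal * w ^ s') := by
    rw [ENNReal.ofReal_mul ENNReal.toReal_nonneg, ENNReal.ofReal_toReal hq.ne]
    calc μ {z | distToLine q.2 (z - q.1) ≤ w}
        = ENNReal.ofReal (w ^ (-s')) * μ {z | distToLine q.2 (z - q.1) ≤ w} *
          ENNReal.ofReal (w ^ s') := by
          rw [mul_right_comm, ← ENNReal.ofReal_mul (by positivity), ← Real.rpow_add hw0]
          simp
      _ ≤ _ := mul_le_mul_left h3 _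
  refine (measure_mono fun z hz => le_trans hz hm1).trans (h4.trans
    (ENNReal.ofReal_le_ofReal ?_))
  rw [mul_assoc, ← Real.mul_rpow (by norm_num) h0.le]
  gcongr

end

noncomputable section

/-! ### Self-affine systems with strong separation -/

open Metric

variable {N : ℕ}

theorem wordMap_add (A : Fin N → Mat2) (t : Fin N → Plane) (i : ℕ → Fin N) (m n : ℕ) :
    wordMap A t i (m + n) = wordMap A t i m ∘ wordMap A t (shiftBy m i) n := by
  induction n with
  | zero => rfl
  | succ n ih => rw [← add_assoc, wordMap, ih, wordMap, Function.comp_assoc]; rfl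

theorem wordMap_congr (A : Fin N → Mat2) (t : Fin N → Plane) {i j : ℕ → Fin N} {n : ℕ}
    (h : ∀ k < n, i k = j k) : wordMap A t i n = wordMap A t j n := by
  induction n with
  | zero => rfl
  | succ n ih => rw [wordMap, wordMap, ih fun k hk => h k (by omega), h n (by omega)]

theorem wordMap_sub (A : Fin N → Mat2) (t : Fin N → Plane) (i : ℕ → Fin N) (n : ℕ) (x y : Plane) :
    wordMap A t i n x - wordMap A t i n y = act (wordProd A i n) (x - y) := by
  induction n generalizing x y with
  | zero => simp [wordMap, wordProd]
  | succ n ih =>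
    simp only [wordMap, wordProd, Function.comp_apply]
    rw [ih, act_mul]
    congr 1
    simp only [affMap, map_sub]
    abel

theorem exists_contraction {A : Fin N → Mat2} (h : ∀ i, IsContracting (A i)) :
    ∃ κ, 0 < κ ∧ κ < 1 ∧ ∀ i, sv1 (A i) ≤ κ := by
  have h1 : ∀ i, sv1 (A i) < 1 := fun i => by rw [sv1_eq_norm]; exact h i
  rcases isEmpty_or_nonempty (Fin N) with he | hne
  · exact ⟨1 / 2, by norm_num, by norm_num, fun i => (he.false i).elim⟩
  obtain ⟨i₀, hi₀⟩ := Finite.exists_max fun i => sv1 (A i)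
  refine ⟨max (1 / 2) (sv1 (A i₀)), by positivity, max_lt (by norm_num) (h1 i₀), fun i => ?_⟩
  exact (hi₀ i).trans (le_max_right _ _)

theorem sv1_one : sv1 1 = 1 := by
  obtain ⟨u, hu, h⟩ := exists_norm_act_eq_sv1 1
  rw [← h, act_one, hu]

theorem sv1_wordProd_le {A : Fin N → Mat2} {κ : ℝ} (hκ0 : 0 < κ) (hκ : ∀ i, sv1 (A i) ≤ κ)
    (i : ℕ → Fin N) (n : ℕ) : sv1 (wordProd A i n) ≤ κ ^ n := by
  induction n with
  | zero => rw [wordProd, sv1_one, pow_zero]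
  | succ n ih =>
    rw [wordProd, pow_succ]
    exact (sv1_mul_le _ _).trans (mul_le_mul ih (hκ _) (sv1_nonneg _) (by positivity))

theorem sv2_mul_le' {M L : Mat2} (hM : M.det ≠ 0) (hL : L.det ≠ 0) :
    sv2 (M * L) ≤ sv2 M * sv1 L := by
  have h1 : sv1 M * sv2 L ≤ sv1 (M * L) := le_sv1_mul.resolve_right hL
  have h2 : sv1 (M * L) * sv2 (M * L) = (sv1 M * sv2 L) * (sv2 M * sv1 L) := by
    rw [sv1_mul_sv2, Matrix.det_mul, abs_mul, ← sv1_mul_sv2, ← sv1_mul_sv2]; ring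
  have h3 : 0 < sv1 M * sv2 L := mul_pos (sv1_pos hM) (sv2_pos hL)
  refine le_of_mul_le_mul_left ?_ h3
  rw [← h2]
  exact mul_le_mul_of_nonneg_right h1 (sv2_nonneg _)

theorem antitone_sv2_wordProd {A : Fin N → Mat2} (hA : ∀ i, (A i).det ≠ 0)
    (h1 : ∀ i, sv1 (A i) ≤ 1) (i : ℕ → Fin N) : Antitone fun n => sv2 (wordProd A i n) := by
  refine antitone_nat_of_succ_le fun n => ?_
  refine (sv2_mul_le' (det_wordProd_ne_zero hA i n) (hA _)).trans ?_
  exact mul_le_of_le_one_right (sv2_nonneg _) (h1 _)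

theorem tendsto_wordMap {A : Fin N → Mat2} (h : ∀ i, IsContracting (A i)) (t : Fin N → Plane)
    (i : ℕ → Fin N) (x : Plane) :
    Tendsto (fun n => wordMap A t i n x) atTop (𝓝 (naturalProjection A t i)) := by
  obtain ⟨κ, hκ0, hκ1, hκ⟩ := exists_contraction h
  have key : ∀ n (x y : Plane), ‖wordMap A t i n x - wordMap A t i n y‖ ≤ κ ^ n * ‖x - y‖ := by
    intro n x y
    rw [wordMap_sub]
    exact (norm_act_le_sv1 _ _).trans
      (mul_le_mul_of_nonneg_right (sv1_wordProd_le hκ0 hκ i n) (norm_nonneg _))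
  obtain ⟨B, hB⟩ := (Set.finite_range fun a => ‖t a‖).bddAbove
  have hcauchy : CauchySeq fun n => wordMap A t i n 0 := by
    refine cauchySeq_of_le_geometric κ B hκ1 fun n => ?_
    rw [dist_eq_norm]
    have h1 := key n 0 (affMap A t (i n) 0)
    have h2 : ‖(0 : Plane) - affMap A t (i n) 0‖ ≤ B := by
      rw [zero_sub, norm_neg, affMap, map_zero, zero_add]
      exact hB ⟨i n, rfl⟩
    refine h1.trans ?_
    rw [mul_comm]
    gcongr
  have h0 : Tendsto (fun n => wordMap A t i n 0) atTop (𝓝 (naturalProjection A t i)) :=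
    tendsto_nhds_limUnder (cauchySeq_tendsto_of_complete hcauchy)
  have hdiff : Tendsto (fun n => wordMap A t i n x - wordMap A t i n 0) atTop (𝓝 0) := by
    refine squeeze_zero_norm (fun n => key n x 0) ?_
    simpa using (tendsto_pow_atTop_nhds_zero_of_lt_one hκ0.le hκ1).mul_const ‖x - 0‖
  simpa using hdiff.add h0

theorem continuous_wordMap (A : Fin N → Mat2) (t : Fin N → Plane) (i : ℕ → Fin N) (n : ℕ) :
    Continuous (wordMap A t i n) := by
  induction n with
  | zero => exact continuous_id
  | succ n ih =>
    refine ih.comp ?_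
    unfold affMap
    fun_prop

theorem naturalProjection_eq {A : Fin N → Mat2} (h : ∀ i, IsContracting (A i)) (t : Fin N → Plane)
    (i : ℕ → Fin N) (n : ℕ) :
    naturalProjection A t i = wordMap A t i n (naturalProjection A t (shiftBy n i)) := by
  have h1 := (tendsto_add_atTop_iff_nat n).2 (tendsto_wordMap h t i 0)
  have h2 := ((continuous_wordMap A t i n).tendsto _).comp (tendsto_wordMap h t (shiftBy n i) 0)
  refine tendsto_nhds_unique h1 (h2.congr fun m => ?_)
  rw [add_comm m n, wordMap_add]; rfl

theorem naturalProjection_mem_closure {A : Fin N → Mat2} (h : ∀ i, IsContracting (A i))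
    {t : Fin N → Plane} {O : Set Plane} (hne : O.Nonempty)
    (hO : ∀ i, affMap A t i '' closure O ⊆ O) (i : ℕ → Fin N) :
    naturalProjection A t i ∈ closure O := by
  obtain ⟨x, hx⟩ := hne
  have hmem : ∀ n, ∀ y ∈ closure O, wordMap A t i n y ∈ closure O := by
    intro n
    induction n with
    | zero => exact fun y hy => hy
    | succ n ih => exact fun y hy => ih _ (subset_closure (hO _ ⟨y, hy, rfl⟩))
  exact isClosed_closure.mem_of_tendsto (tendsto_wordMap h t i x)
    (Eventually.of_forall fun n => hmem n x (subset_closure hx))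

theorem exists_norm_naturalProjection_le {A : Fin N → Mat2} {t : Fin N → Plane}
    (h : ∀ i, IsContracting (A i)) (hssc : StrongSeparation A t) :
    ∃ R, 0 < R ∧ ∀ i, ‖naturalProjection A t i‖ ≤ R := by
  obtain ⟨O, -, hne, hb, hO, -⟩ := hssc
  obtain ⟨R, hR⟩ := hb.closure.exists_norm_le
  refine ⟨max R 1, by positivity, fun i => ?_⟩
  exact (hR _ (naturalProjection_mem_closure h hne hO i)).trans (le_max_left _ _)

theorem dist_naturalProjection_le {A : Fin N → Mat2} {t : Fin N → Plane}
    (h : ∀ i, IsContracting (A i)) {R : ℝ} (hR : ∀ i, ‖naturalProjection A t i‖ ≤ R)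
    {i j : ℕ → Fin N} {n : ℕ} (hij : ∀ k < n, i k = j k) :
    dist (naturalProjection A t i) (naturalProjection A t j) ≤ sv1 (wordProd A i n) * (2 * R) := by
  rw [naturalProjection_eq h t i n, naturalProjection_eq h t j n, ← wordMap_congr A t hij,
    dist_eq_norm, wordMap_sub]
  refine (norm_act_le_sv1 _ _).trans (mul_le_mul_of_nonneg_left ?_ (sv1_nonneg _))
  refine (norm_sub_le _ _).trans ?_
  linarith [hR (shiftBy n i), hR (shiftBy n j)]

theorem continuous_naturalProjection {A : Fin N → Mat2} {t : Fin N → Plane}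
    (h : ∀ i, IsContracting (A i)) (hssc : StrongSeparation A t) :
    Continuous (naturalProjection A t) := by
  obtain ⟨R, hR0, hR⟩ := exists_norm_naturalProjection_le h hssc
  obtain ⟨κ, hκ0, hκ1, hκ⟩ := exists_contraction h
  rw [continuous_iff_continuousAt]
  intro i
  rw [ContinuousAt, Metric.tendsto_nhds]
  intro ε hε
  have ht : Tendsto (fun n : ℕ => κ ^ n * (2 * R)) atTop (𝓝 0) := by
    simpa using (tendsto_pow_atTop_nhds_zero_of_lt_one hκ0.le hκ1).mul_const (2 * R)
  obtain ⟨n, hn⟩ := (ht.eventually_lt_const hε).exists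
  have hnb : ∀ᶠ j in 𝓝 i, ∀ k < n, i k = j k := by
    have : ∀ k : ℕ, ∀ᶠ j in 𝓝 i, i k = j k := fun k =>
      ((continuous_apply k).continuousAt.eventually_mem
        ((isOpen_discrete {i k}).mem_nhds rfl)).mono fun j hj => Eq.symm hj
    exact (Filter.eventually_all_finite (Set.finite_lt_nat n)).2 fun k _ => this k
  filter_upwards [hnb] with j hj
  rw [dist_comm]
  refine ((dist_naturalProjection_le h hR hj).trans ?_).trans_lt hn
  exact mul_le_mul_of_nonneg_right (sv1_wordProd_le hκ0 hκ i n) (by positivity)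

theorem exists_dist_lower_bound_of_compact {X : Type*} [MetricSpace X] {K L : Set X}
    (hK : IsCompact K) (hL : IsCompact L) (hd : Disjoint K L) :
    ∃ c > 0, ∀ x ∈ K, ∀ y ∈ L, c ≤ dist x y := by
  rcases (K ×ˢ L).eq_empty_or_nonempty with h0 | hne
  · exact ⟨1, one_pos, fun x hx y hy => absurd
      (h0 ▸ Set.mk_mem_prod hx hy : (x, y) ∈ (∅ : Set _)) (Set.notMem_empty _)⟩
  obtain ⟨⟨a, b⟩, ⟨ha, hb⟩, hmin⟩ := (hK.prod hL).exists_isMinOn hne continuous_dist.continuousOn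
  refine ⟨dist a b, dist_pos.2 fun hab => Set.disjoint_left.1 hd ha (hab ▸ hb), fun x hx y hy => ?_⟩
  exact hmin (Set.mk_mem_prod hx hy)

theorem exists_separation {A : Fin N → Mat2} {t : Fin N → Plane}
    (h : ∀ i, IsContracting (A i)) (hssc : StrongSeparation A t) :
    ∃ c > 0, ∀ i j : ℕ → Fin N, i 0 ≠ j 0 →
      c ≤ dist (naturalProjection A t i) (naturalProjection A t j) := by
  obtain ⟨O, -, hne, hb, hO, hdisj⟩ := hssc
  have hcpt : ∀ a, IsCompact (affMap A t a '' closure O) := fun a =>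
    hb.isCompact_closure.image (by unfold affMap; fun_prop)
  have hpair : ∀ q : Fin N × Fin N, ∃ c > 0, q.1 ≠ q.2 →
      ∀ x ∈ affMap A t q.1 '' closure O, ∀ y ∈ affMap A t q.2 '' closure O, c ≤ dist x y := by
    rintro ⟨a, b⟩
    by_cases hab : a = b
    · exact ⟨1, one_pos, fun hne => absurd hab hne⟩
    · obtain ⟨c, hc, hcd⟩ := exists_dist_lower_bound_of_compact (hcpt a) (hcpt b) (hdisj a b hab)
      exact ⟨c, hc, fun _ => hcd⟩
  choose c hc hcd using hpair
  obtain ⟨B, hB⟩ := (Set.finite_range fun q => (c q)⁻¹).bddAbove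
  refine ⟨(max B 1)⁻¹, by positivity, fun i j hij => ?_⟩
  have hmem : ∀ i : ℕ → Fin N, naturalProjection A t i ∈ affMap A t (i 0) '' closure O := by
    intro i
    rw [naturalProjection_eq h t i 1]
    exact ⟨_, naturalProjection_mem_closure h hne hO (shiftBy 1 i), rfl⟩
  refine le_trans ?_ (hcd (i 0, j 0) hij _ (hmem i) _ (hmem j))
  rw [inv_le_comm₀ (by positivity) (hc _)]
  exact (hB ⟨(i 0, j 0), rfl⟩).trans (le_max_left _ _)

/-- At the first disagreement, at position m < n, the shifted words have images at distance at least
c. The common map shrinks this by no more than α₂ of its linear part, which is at least α₂ at time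
n. -/
theorem agree_of_dist_lt {A : Fin N → Mat2} {t : Fin N → Plane} (h : ∀ i, IsContracting (A i))
    (hA : ∀ i, (A i).det ≠ 0) {c : ℝ} (hc : 0 < c)
    (hsep : ∀ i j : ℕ → Fin N, i 0 ≠ j 0 →
      c ≤ dist (naturalProjection A t i) (naturalProjection A t j))
    {i j : ℕ → Fin N} {n : ℕ}
    (hd : dist (naturalProjection A t i) (naturalProjection A t j) < c * sv2 (wordProd A i n)) :
    ∀ k < n, i k = j k := by
  by_contra hcon
  push Not at hcon
  classical
  have hex : ∃ k, k < n ∧ i k ≠ j k := hcon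
  set m := Nat.find hex
  obtain ⟨hmn, hm⟩ := Nat.find_spec hex
  have hagree : ∀ k < m, i k = j k := by
    intro k hk
    have := Nat.find_min hex hk
    push Not at this
    exact this (hk.trans hmn)
  have h1 := hsep (shiftBy m i) (shiftBy m j) hm
  rw [naturalProjection_eq h t i m, naturalProjection_eq h t j m, ← wordMap_congr A t hagree,
    dist_eq_norm, wordMap_sub] at hd
  have h2 := sv2_le_norm_act (wordProd A i m)
    (naturalProjection A t (shiftBy m i) - naturalProjection A t (shiftBy m j))
  rw [← dist_eq_norm] at h2
  have hle : ∀ a, sv1 (A a) ≤ 1 := fun a => by rw [sv1_eq_norm]; exact (h a).le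
  have h3 : sv2 (wordProd A i n) ≤ sv2 (wordProd A i m) := antitone_sv2_wordProd hA hle i hmn.le
  have h4 := mul_le_mul_of_nonneg_left h1 (sv2_nonneg (wordProd A i m))
  have h5 := mul_le_mul_of_nonneg_left h3 hc.le
  linarith

/-- The measure of the cylinder of the first `n` symbols of a word. -/
def wordWeight (p : PMF (Fin N)) (i : ℕ → Fin N) (n : ℕ) : ℝ≥0∞ := ∏ k ∈ Finset.range n, p (i k)

theorem bernoulliMeas_cylinder_inter (p : PMF (Fin N)) (i : ℕ → Fin N) (n : ℕ)
    {S : Set (ℕ → Fin N)} (hS : MeasurableSet S) :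
    bernoulliMeas p ({j | ∀ k < n, i k = j k} ∩ shiftBy n ⁻¹' S) =
      wordWeight p i n * bernoulliMeas p S := by
  have := bernoulliMeas_pi_inter_shift p n (fun k => {i k}) hS
  simp only [Set.mem_singleton_iff, PMF.toMeasure_apply_singleton _ _ (MeasurableSet.singleton _)]
    at this
  rw [wordWeight, ← this]
  congr 2
  ext j
  exact forall₂_congr fun k _ => eq_comm

theorem selfAffineMeasure_apply {A : Fin N → Mat2} {t : Fin N → Plane} (p : PMF (Fin N))
    (h : ∀ i, IsContracting (A i)) (hssc : StrongSeparation A t) {S : Set Plane}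
    (hS : MeasurableSet S) :
    selfAffineMeasure A t p S = bernoulliMeas p (naturalProjection A t ⁻¹' S) :=
  Measure.map_apply (continuous_naturalProjection h hssc).measurable hS

theorem isProbabilityMeasure_selfAffineMeasure {A : Fin N → Mat2} {t : Fin N → Plane}
    (p : PMF (Fin N)) (h : ∀ i, IsContracting (A i)) (hssc : StrongSeparation A t) :
    IsProbabilityMeasure (selfAffineMeasure A t p) :=
  Measure.isProbabilityMeasure_map (continuous_naturalProjection h hssc).measurable.aemeasurable

/-- Small balls are contained in cylinders, where they look like tubes. -/
theorem selfAffineMeasure_closedBall_le {A : Fin N → Mat2} {t : Fin N → Plane} (p : PMF (Fin N))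
    (h : ∀ i, IsContracting (A i)) (hA : ∀ i, (A i).det ≠ 0) (hssc : StrongSeparation A t)
    {c : ℝ} (hc : 0 < c) (hsep : ∀ i j : ℕ → Fin N, i 0 ≠ j 0 →
      c ≤ dist (naturalProjection A t i) (naturalProjection A t j))
    {K : ℝ} {i : ℕ → Fin N} {n : ℕ} {l : ℙ ℝ Plane}
    (hl : ‖act (wordProd A i n) (dir l)‖ ≤ K * sv2 (wordProd A i n))
    {r : ℝ} (hr : r < c * sv2 (wordProd A i n)) :
    selfAffineMeasure A t p (closedBall (naturalProjection A t i) r) ≤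
      wordWeight p i n * selfAffineMeasure A t p
        {z | distToLine l (z - naturalProjection A t (shiftBy n i)) ≤
          K * c * (sv2 (wordProd A i n) / sv1 (wordProd A i n))} := by
  set M := wordProd A i n
  have hM : M.det ≠ 0 := det_wordProd_ne_zero hA i n
  have hs1 := sv1_pos hM
  have hs2 := sv2_pos hM
  set S := {z | distToLine l (z - naturalProjection A t (shiftBy n i)) ≤ K * c * (sv2 M / sv1 M)}
  have hS : MeasurableSet S := (isClosed_le (continuous_distToLine.comp
    (continuous_const.prodMk (continuous_id.sub continuous_const))) continuous_const).measurableSet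
  have hπ := (continuous_naturalProjection h hssc).measurable
  rw [selfAffineMeasure_apply p h hssc isClosed_closedBall.measurableSet,
    selfAffineMeasure_apply p h hssc hS, ← bernoulliMeas_cylinder_inter p i n (hπ hS)]
  refine measure_mono fun j hj => ?_
  have hj' : dist (naturalProjection A t i) (naturalProjection A t j) ≤ r := by
    rw [dist_comm]; exact hj
  have hagree := agree_of_dist_lt h hA hc hsep (hj'.trans_lt hr)
  refine ⟨hagree, ?_⟩
  change distToLine l (naturalProjection A t (shiftBy n j) - naturalProjection A t (shiftBy n i)) ≤ _
  rw [naturalProjection_eq h t i n, naturalProjection_eq h t j n, ← wordMap_congr A t hagree,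
    dist_comm, dist_eq_norm, wordMap_sub] at hj'
  set w := naturalProjection A t (shiftBy n j) - naturalProjection A t (shiftBy n i)
  -- Area comparison: the line is contracted to about α₂ and Mw is shorter than cα₂, so dividing by
  -- |det M| = α₁α₂ bounds the distance of w to l by Kcα₂/α₁.
  have h1 := abs_det_mul_cross_le M (dir l) w
  rw [distToLine_eq, ← mul_div_assoc, le_div_iff₀ hs1]
  refine le_of_mul_le_mul_right ?_ hs2
  calc |cross (dir l) w| * sv1 M * sv2 M = |M.det| * |cross (dir l) w| := by
        rw [← sv1_mul_sv2]; ring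
    _ ≤ ‖act M (dir l)‖ * ‖act M w‖ := h1
    _ ≤ (K * sv2 M) * (c * sv2 M) :=
        mul_le_mul hl (hj'.trans hr.le) (norm_nonneg _) ((norm_nonneg _).trans hl)
    _ = _ := by ring

/-! ### Inequalities between entropy and Lyapunov exponents -/

theorem measure_affMap_image (A : Fin N → Mat2) (t : Fin N → Plane) (a : Fin N) (S : Set Plane) :
    volume (affMap A t a '' S) = ENNReal.ofReal |(A a).det| * volume S := by
  have h1 : affMap A t a '' S = (fun x => x + t a) '' (act (A a) '' S) := by
    rw [Set.image_image]; rfl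
  rw [h1, Set.image_add_right, measure_preimage_add_right,
    show (act (A a) '' S) = ((act (A a) : Plane →L[ℝ] Plane) : Plane →ₗ[ℝ] Plane) '' S from rfl,
    Measure.addHaar_image_linearMap]
  congr 3
  have : ((act (A a) : Plane →L[ℝ] Plane) : Plane →ₗ[ℝ] Plane) = Matrix.toEuclideanLin (A a) := rfl
  rw [this, show Matrix.toEuclideanLin (A a) = Matrix.toLin (PiLp.basisFun 2 ℝ (Fin 2))
    (PiLp.basisFun 2 ℝ (Fin 2)) (A a) by rw [← Matrix.toLpLin_eq_toLin 2 2],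
    LinearMap.det_toLin]

/-- The disjoint images of the closure of O lie inside it, and it has positive finite area. -/
theorem sum_abs_det_le_one {A : Fin N → Mat2} {t : Fin N → Plane} (hssc : StrongSeparation A t) :
    ∑ a, |(A a).det| ≤ 1 := by
  obtain ⟨O, hopen, hne, hb, hO, hdisj⟩ := hssc
  have hcl : IsCompact (closure O) := hb.isCompact_closure
  have hpos : 0 < volume (closure O) :=
    (hopen.measure_pos volume hne).trans_le (measure_mono subset_closure)
  have hfin : volume (closure O) ≠ ∞ := hcl.measure_lt_top.ne
  have hmeas : ∀ a, MeasurableSet (affMap A t a '' closure O) := fun a =>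
    (hcl.image (by unfold affMap; fun_prop)).isClosed.measurableSet
  have h1 : ∑ a, volume (affMap A t a '' closure O) ≤ volume (closure O) := by
    rw [← tsum_fintype (L := SummationFilter.unconditional _),
      ← measure_iUnion (fun a b hab => hdisj a b hab) hmeas]
    exact measure_mono (Set.iUnion_subset fun a => (hO a).trans subset_closure)
  simp_rw [measure_affMap_image] at h1
  rw [← Finset.sum_mul, ← ENNReal.ofReal_sum_of_nonneg fun a _ => abs_nonneg _] at h1
  have h2 : ENNReal.ofReal (∑ a, |(A a).det|) ≤ 1 := by
    by_contra hcon
    rw [not_le] at hcon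
    have := ENNReal.mul_lt_mul_left hpos.ne' hfin hcon
    rw [one_mul] at this
    exact absurd h1 (not_le.2 this)
  rwa [ENNReal.ofReal_le_one] at h2

theorem sum_pmf_toReal (p : PMF (Fin N)) : ∑ a, (p a).toReal = 1 := by
  have h := p.tsum_coe
  rw [tsum_fintype] at h
  rw [← ENNReal.toReal_sum fun a _ => p.apply_ne_top a, h, ENNReal.toReal_one]

/-- Gibbs' inequality, from log x ≤ x-1 at x = |det A_a|/p_a. Its right-hand side is the sum of the
two exponents. -/
theorem entropy_le {A : Fin N → Mat2} {t : Fin N → Plane} (p : PMF (Fin N))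
    (hA : ∀ i, (A i).det ≠ 0) (hssc : StrongSeparation A t) :
    entropy p ≤ -∑ a, (p a).toReal * Real.log |(A a).det| := by
  have h1 := sum_abs_det_le_one hssc
  have h2 := sum_pmf_toReal p
  rw [entropy, ← Finset.sum_neg_distrib]
  have key : ∀ a, Real.negMulLog (p a).toReal ≤
      -((p a).toReal * Real.log |(A a).det|) + (|(A a).det| - (p a).toReal) := by
    intro a
    have hd := abs_pos.2 (hA a)
    rcases (ENNReal.toReal_nonneg (a := p a)).eq_or_lt with h0 | h0
    · rw [← h0]; simp
    · have h3 := Real.log_le_sub_one_of_pos (div_pos hd h0)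
      rw [Real.log_div hd.ne' h0.ne'] at h3
      have h4 := mul_le_mul_of_nonneg_left h3 h0.le
      rw [Real.negMulLog]
      have h5 : (p a).toReal * (|(A a).det| / (p a).toReal - 1) = |(A a).det| - (p a).toReal := by
        field_simp
      rw [h5] at h4
      linarith
  refine (Finset.sum_le_sum fun a _ => key a).trans ?_
  rw [Finset.sum_add_distrib, Finset.sum_sub_distrib]
  linarith

theorem entropy_nonneg (p : PMF (Fin N)) : 0 ≤ entropy p := by
  refine Finset.sum_nonneg fun a _ => Real.negMulLog_nonneg ENNReal.toReal_nonneg ?_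
  have := ENNReal.toReal_mono ENNReal.one_ne_top (p.coe_le_one a)
  simpa using this

theorem lyapS_pos_and_lt {A : Fin N → Mat2} {L C δ : ℝ} (p : PMF (Fin N))
    (hcontr : ∀ i, IsContracting (A i))
    (h : UniformlyDominated A L C δ) (h' : UniformlyDominated (fun i => (A i)⁻¹) L C δ) :
    0 < lyapS A p ∧ lyapS A p < lyapSS A p := by
  obtain ⟨t1, t2, -⟩ := ae_tendsto_lyapunov p h h'
  obtain ⟨i, h1, h2⟩ := (t1.and t2).exists
  obtain ⟨κ, hκ0, hκ1, hκ⟩ := exists_contraction hcontr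
  have hd := det_wordProd_ne_zero h.det_ne i
  constructor
  · have h3 : -lyapS A p ≤ Real.log κ := by
      refine le_of_tendsto h1 ?_
      filter_upwards [eventually_gt_atTop 0] with n hn
      have hn' : (0:ℝ) < n := by exact_mod_cast hn
      rw [div_le_iff₀ hn', mul_comm, ← Real.log_pow]
      exact Real.log_le_log (sv1_pos (hd n)) (sv1_wordProd_le hκ0 hκ i n)
    have := Real.log_neg hκ0 hκ1
    linarith
  · have h3 := h1.sub h2
    have h4 : Tendsto (fun n : ℕ => δ - Real.log C / (n : ℝ)) atTop (𝓝 (δ - 0)) :=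
      (tendsto_const_div_atTop_nhds_zero_nat _).const_sub δ
    have h5 : δ - 0 ≤ -lyapS A p - -lyapSS A p := by
      refine le_of_tendsto_of_tendsto h4 h3 ?_
      filter_upwards [eventually_gt_atTop 0] with n hn
      have hn' : (0:ℝ) < n := by exact_mod_cast hn
      have h6 := h.dom (prependRev n i i) n
      rw [← wordProd_eq_coc_prependRev] at h6
      have h7 := Real.log_le_log (sv2_pos (hd n)) h6
      rw [Real.log_mul (mul_pos h.C_pos (Real.exp_pos _)).ne' (sv1_pos (hd n)).ne',
        Real.log_mul h.C_pos.ne' (Real.exp_pos _).ne', Real.log_exp] at h7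
      rw [← sub_div, le_div_iff₀ hn', sub_mul, div_mul_cancel₀ _ hn'.ne']
      linarith
    linarith [h.δ_pos]

end

noncomputable section

/-! ### The law of the slow lines -/

open Metric

theorem frostmanAt_of_small {X : Type*} [MetricSpace X] [MeasurableSpace X] {μ : Measure X}
    [IsFiniteMeasure μ] {s C r₀ : ℝ} (hs : 0 ≤ s) (h0 : 0 < r₀) {x : X}
    (h : ∀ r, 0 < r → r ≤ r₀ → μ (closedBall x r) ≤ ENNReal.ofReal (C * r ^ s)) :
    FrostmanAt μ s x := by
  set M := (μ Set.univ).toReal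
  have hM : 0 ≤ M := ENNReal.toReal_nonneg
  refine ⟨|C| + M * r₀⁻¹ ^ s, fun r hr _ => ?_⟩
  have hrs : 0 ≤ r ^ s := Real.rpow_nonneg hr.le s
  rcases le_or_gt r r₀ with h1 | h1
  · refine (h r hr h1).trans (ENNReal.ofReal_le_ofReal ?_)
    refine mul_le_mul_of_nonneg_right ?_ hrs
    have : 0 ≤ M * r₀⁻¹ ^ s := by positivity
    linarith [le_abs_self C]
  · calc μ (closedBall x r) ≤ μ Set.univ := measure_mono (Set.subset_univ _)
      _ = ENNReal.ofReal M := (ENNReal.ofReal_toReal (measure_ne_top _ _)).symm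
      _ ≤ _ := ENNReal.ofReal_le_ofReal ?_
    have h2 : 1 ≤ (r₀⁻¹ * r) ^ s := by
      refine Real.one_le_rpow ?_ hs
      rw [inv_mul_eq_div, one_le_div h0]; exact h1.le
    rw [Real.mul_rpow (by positivity) hr.le] at h2
    have h3 := mul_le_mul_of_nonneg_left h2 hM
    have h4 : 0 ≤ |C| * r ^ s := by positivity
    nlinarith

/-- The inverse of an invertible matrix acts on lines as a Lipschitz map. -/
theorem dist_le_of_cross_act_eq_zero {M : Mat2} (hM : M.det ≠ 0) {l m l' m' : ℙ ℝ Plane}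
    (hl : cross (dir l') (act M (dir l)) = 0) (hm : cross (dir m') (act M (dir m)) = 0) :
    dist l m ≤ sv1 M / sv2 M * dist l' m' := by
  obtain ⟨a, ha⟩ : ∃ a : ℝ, act M (dir l) = a • dir l' :=
    ⟨_, exists_smul_of_cross_eq_zero (norm_dir l') hl⟩
  obtain ⟨b, hb⟩ : ∃ b : ℝ, act M (dir m) = b • dir m' :=
    ⟨_, exists_smul_of_cross_eq_zero (norm_dir m') hm⟩
  have hna : |a| ≤ sv1 M := by
    have := norm_act_le_sv1 M (dir l)
    rwa [ha, norm_smul, norm_dir, norm_dir, mul_one, mul_one, Real.norm_eq_abs] at this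
  have hnb : |b| ≤ sv1 M := by
    have := norm_act_le_sv1 M (dir m)
    rwa [hb, norm_smul, norm_dir, norm_dir, mul_one, mul_one, Real.norm_eq_abs] at this
  have h1 : cross (act M (dir l)) (act M (dir m)) = a * b * cross (dir l') (dir m') := by
    rw [ha, hb]; simp [cross]; ring
  rw [cross_act] at h1
  have h2 : |M.det| * dist l m = |a| * |b| * dist l' m' := by
    rw [dist_eq_abs_cross, dist_eq_abs_cross, ← abs_mul, ← abs_mul, ← abs_mul, h1]
  rw [← sv1_mul_sv2] at h2
  have p1 := sv1_pos hM
  have p2 := sv2_pos hM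
  have h3 : |a| * |b| * dist l' m' ≤ sv1 M * sv1 M * dist l' m' := by gcongr
  rw [div_mul_eq_mul_div, le_div_iff₀ p2]
  refine le_of_mul_le_mul_left ?_ p1
  nlinarith

variable {N : ℕ}

theorem ae_ne_zero (p : PMF (Fin N)) : ∀ᵐ i ∂(bernoulliMeas p), ∀ k, p (i k) ≠ 0 := by
  rw [ae_all_iff]
  intro k
  have h1 : ∀ᵐ a ∂p.toMeasure, p a ≠ 0 := by
    rw [ae_iff, PMF.toMeasure_apply_eq_zero_iff _ .of_discrete, Set.disjoint_left]
    intro a ha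
    simpa [PMF.mem_support_iff] using ha
  have h2 : MeasurePreserving (fun j : ℕ → Fin N => j k) (bernoulliMeas p) p.toMeasure := by
    refine (measurePreserving_fst.comp (measurePreserving_uncons p)).comp
      (measurePreserving_shiftBy p k)
  exact h2.quasiMeasurePreserving.ae h1

/-- The law of the slow lines satisfies a Frostman bound with every exponent below its
dimension. -/
theorem frostmanAE_slowLine {A : Fin N → Mat2} {L C δ : ℝ} (p : PMF (Fin N))
    (h : UniformlyDominated A L C δ) {s : ℝ} (hs : 0 < s)
    (hdim : ENNReal.ofReal s < dimHMeasure ((bernoulliMeas p).map (slowLine A))) :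
    FrostmanAE ((bernoulliMeas p).map (slowLine A)) s := by
  have hE : Continuous (slowLine A) := h.continuous_slowLine
  set ν := bernoulliMeas p
  set η := ν.map (slowLine A) with hη
  have : IsProbabilityMeasure η := Measure.isProbabilityMeasure_map hE.measurable.aemeasurable
  have hms := measurableSet_frostmanAt η hs.le
  set G : Set (ℕ → Fin N) := slowLine A ⁻¹' {l | FrostmanAt η s l} with hG
  have hGm : MeasurableSet G := hE.measurable hms
  have hpos : ∀ᵐ j ∂ν, p (j 0) ≠ 0 := (ae_ne_zero p).mono fun j hj => hj 0
  -- The inverse of A_{j_0} maps slow lines near that of the shifted word to slow lines near that of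
  -- j, with Lipschitz constant Λ. The words starting with j_0 carry a fraction p(j_0) of the
  -- measure, so the bound survives with a worse constant.
  have hstep : ∀ j, p (j 0) ≠ 0 → j ∈ G → shiftBy 1 j ∈ G := by
    rintro j hj ⟨c, hc⟩
    set M := A (j 0)
    have hM : M.det ≠ 0 := h.det_ne _
    set Λ := sv1 M / sv2 M
    have hΛ : 0 < Λ := div_pos (sv1_pos hM) (sv2_pos hM)
    have hp : 0 < (p (j 0)).toReal := ENNReal.toReal_pos hj (p.apply_ne_top _)
    refine frostmanAt_of_small (C := |c| * Λ ^ s / (p (j 0)).toReal) (r₀ := Λ⁻¹) hs.le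
      (by positivity) fun r hr hr1 => ?_
    have hΛr : Λ * r ≤ 1 := by
      calc Λ * r ≤ Λ * Λ⁻¹ := by gcongr
        _ = 1 := mul_inv_cancel₀ hΛ.ne'
    have h1 := hc (Λ * r) (by positivity) hΛr
    have h2 : p (j 0) * η (closedBall (slowLine A (shiftBy 1 j)) r) ≤
        η (closedBall (slowLine A j) (Λ * r)) := by
      rw [hη, Measure.map_apply hE.measurable isClosed_closedBall.measurableSet,
        Measure.map_apply hE.measurable isClosed_closedBall.measurableSet]
      have h3 := bernoulliMeas_cylinder_inter p j 1
        (hE.measurable (isClosed_closedBall (x := slowLine A (shiftBy 1 j)) (ε := r)).measurableSet)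
      rw [wordWeight, Finset.prod_range_one] at h3
      rw [← h3]
      refine measure_mono ?_
      rintro k ⟨hk, hk2⟩
      have hk0 : j 0 = k 0 := hk 0 one_pos
      have e1 := h.slowLine_invariant j
      have e2 := h.slowLine_invariant k
      rw [← hk0] at e2
      rw [Set.mem_preimage, mem_closedBall]
      refine (dist_le_of_cross_act_eq_zero hM e2 e1).trans ?_
      gcongr
      exact hk2
    have h4 : p (j 0) = ENNReal.ofReal (p (j 0)).toReal :=
      (ENNReal.ofReal_toReal (p.apply_ne_top _)).symm
    rw [mul_comm, ← ENNReal.le_div_iff_mul_le (Or.inl hj) (Or.inl (p.apply_ne_top _))] at h2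
    refine h2.trans ((ENNReal.div_le_div_right h1 _).trans ?_)
    rw [h4, ← ENNReal.ofReal_div_of_pos hp]
    refine ENNReal.ofReal_le_ofReal ?_
    rw [← h4, Real.mul_rpow hΛ.le hr.le, div_mul_eq_mul_div]
    refine div_le_div_of_nonneg_right ?_ hp.le
    have : 0 ≤ Λ ^ s * r ^ s := by positivity
    nlinarith [le_abs_self c]
  have h01 : ν G = 0 ∨ ν G = 1 := by
    refine bernoulliMeas_zero_or_one p hGm ?_
    refine measure_mono_null ?_ (ae_iff.1 hpos)
    rintro j ⟨hj1, hj2⟩ hj3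
    exact hj2 (hstep j hj3 hj1)
  have hmap : η {l | FrostmanAt η s l} = ν G := Measure.map_apply hE.measurable hms
  rcases h01 with h0 | h1
  -- Otherwise almost every line violates the Frostman bound, and the set of such lines has
  -- dimension at most s.
  · exfalso
    have h2 : dimHMeasure η ≤ dimH {l | ¬ FrostmanAt η s l} := by
      refine iInf₂_le _ ?_
      rw [show {l | ¬ FrostmanAt η s l}ᶜ = {l | FrostmanAt η s l} by ext; simp, hmap, h0]
    exact absurd (h2.trans (dimH_not_frostmanAt_le η hs)) (not_le.2 hdim)
  · refine (prob_compl_eq_zero_iff hms).2 ?_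
    rw [hmap, h1]

end

noncomputable section

/-! ### Frostman bounds from visits to good scales -/

open Metric

theorem eventually_le_exp_of_tendsto_log_div {a : ℕ → ℝ} {l b : ℝ} (ha : ∀ n, 0 < a n)
    (h : Tendsto (fun n : ℕ => Real.log (a n) / n) atTop (𝓝 l)) (hb : l < b) :
    ∀ᶠ n : ℕ in atTop, a n ≤ Real.exp (b * n) := by
  filter_upwards [h.eventually_lt_const hb, eventually_gt_atTop 0] with n hn hn0
  have : (0 : ℝ) < n := by exact_mod_cast hn0
  rw [div_lt_iff₀ this] at hn
  rw [← Real.exp_log (ha n)]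
  exact Real.exp_le_exp.2 hn.le

theorem eventually_exp_le_of_tendsto_log_div {a : ℕ → ℝ} {l b : ℝ} (ha : ∀ n, 0 < a n)
    (h : Tendsto (fun n : ℕ => Real.log (a n) / n) atTop (𝓝 l)) (hb : b < l) :
    ∀ᶠ n : ℕ in atTop, Real.exp (b * n) ≤ a n := by
  filter_upwards [h.eventually_const_lt hb, eventually_gt_atTop 0] with n hn hn0
  have : (0 : ℝ) < n := by exact_mod_cast hn0
  rw [lt_div_iff₀ this] at hn
  rw [← Real.exp_log (ha n)]
  exact Real.exp_le_exp.2 hn.le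

/-- A Frostman bound at a point, from bounds along a sequence of scales which is visited with
asymptotically full frequency. -/
theorem frostmanAt_of_visits {X : Type*} [MetricSpace X] [MeasurableSpace X] {μ : Measure X}
    [IsFiniteMeasure μ] {x : X} {a b W : ℕ → ℝ} {χ₁ χ₂ h c k D s u : ℝ}
    (ha : ∀ n, 0 < a n) (hb : ∀ n, 0 < b n) (hanti : Antitone a)
    (hta : Tendsto (fun n : ℕ => Real.log (a n) / n) atTop (𝓝 (-χ₂)))
    (htb : Tendsto (fun n : ℕ => Real.log (b n) / n) atTop (𝓝 (-χ₁)))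
    (hW : Tendsto (fun n : ℕ => W n / n) atTop (𝓝 (-h)))
    (hχ : 0 < χ₂) (hc : 0 < c) (hk : 0 ≤ k) (hD : 0 ≤ D) (hs : 0 ≤ s) (hu : 0 ≤ u)
    (huh : u * χ₂ < h + (χ₂ - χ₁) * s)
    (hvis : ∀ ε : ℝ, 0 < ε → ∀ᶠ m : ℕ in atTop, ∃ n ≤ m, (m : ℝ) ≤ (1 + ε) * n ∧
      ∀ r, 0 < r → r < c * a n →
        μ (closedBall x r) ≤ ENNReal.ofReal (k * (Real.exp (W n) * (D * (a n / b n)) ^ s))) :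
    FrostmanAt μ u x := by
  -- One ε absorbs every loss: the errors in both exponents and in h, and the gaps 1+ε between good
  -- times.
  obtain ⟨ε, hε, hε1⟩ : ∃ ε : ℝ, 0 < ε ∧
      u * (χ₂ + ε) * (1 + ε) < (h - ε) + ((χ₂ - ε) - (χ₁ + ε)) * s := by
    have hcont1 : Tendsto (fun ε : ℝ => u * (χ₂ + ε) * (1 + ε)) (𝓝[>] 0) (𝓝 (u * χ₂)) := by
      have : Continuous (fun ε : ℝ => u * (χ₂ + ε) * (1 + ε)) := by fun_prop
      exact tendsto_nhdsWithin_of_tendsto_nhds (by simpa using this.tendsto 0)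
    have hcont2 : Tendsto (fun ε : ℝ => (h - ε) + ((χ₂ - ε) - (χ₁ + ε)) * s) (𝓝[>] 0)
        (𝓝 (h + (χ₂ - χ₁) * s)) := by
      have : Continuous (fun ε : ℝ => (h - ε) + ((χ₂ - ε) - (χ₁ + ε)) * s) := by fun_prop
      exact tendsto_nhdsWithin_of_tendsto_nhds (by simpa using this.tendsto 0)
    obtain ⟨ε, h1, h2⟩ := ((hcont1.eventually_lt hcont2 huh).and self_mem_nhdsWithin).exists
    exact ⟨ε, h2, h1⟩
  set γ := (h - ε) + ((χ₂ - ε) - (χ₁ + ε)) * s with hγ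
  have hγ0 : 0 ≤ γ := le_trans (by positivity) hε1.le
  have ea1 := eventually_exp_le_of_tendsto_log_div ha hta (show -(χ₂ + ε) < -χ₂ by linarith)
  have ea2 := eventually_le_exp_of_tendsto_log_div ha hta (show -χ₂ < -(χ₂ - ε) by linarith)
  have eb := eventually_exp_le_of_tendsto_log_div hb htb (show -(χ₁ + ε) < -χ₁ by linarith)
  have eW : ∀ᶠ n : ℕ in atTop, W n ≤ -(h - ε) * n := by
    filter_upwards [hW.eventually_lt_const (show -h < -(h - ε) by linarith),
      eventually_gt_atTop 0] with n hn hn0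
    have : (0 : ℝ) < n := by exact_mod_cast hn0
    rw [div_lt_iff₀ this] at hn
    exact hn.le
  obtain ⟨n₀, hn₀⟩ := eventually_atTop.1 (ea1.and (ea2.and (eb.and eW)))
  obtain ⟨m₁, hm₁⟩ := eventually_atTop.1 (hvis ε hε)
  -- Since m ≤ (1+ε)n, taking m ≥ m₂ forces the good time n to be at least n₀.
  obtain ⟨m₂, hm₂⟩ := exists_nat_ge ((1 + ε) * n₀)
  set m₀ := max m₁ (max m₂ n₀)
  have hlim : Tendsto a atTop (𝓝 0) := by
    have e3 := eventually_le_exp_of_tendsto_log_div ha hta (show -χ₂ < -(χ₂ / 2) by linarith)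
    refine squeeze_zero' (.of_forall fun n => (ha n).le) e3 ?_
    refine Real.tendsto_exp_atBot.comp ?_
    exact tendsto_natCast_atTop_atTop.const_mul_atTop_of_neg (by linarith)
  refine frostmanAt_of_small (r₀ := c * a m₀ / 2)
    (C := k * D ^ s * (c⁻¹ ^ u * Real.exp (u * (χ₂ + ε)))) hu
    (by have := ha m₀; positivity) fun r hr hr0 => ?_
  have hrm : r < c * a m₀ := by have := mul_pos hc (ha m₀); linarith
  have hex : ∃ m, c * a m ≤ r := by
    have : Tendsto (fun m => c * a m) atTop (𝓝 0) := by simpa using hlim.const_mul c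
    exact ((this.eventually_lt_const hr).exists).imp fun _ => le_of_lt
  classical
  -- The time m is read off from the radius. The mass is estimated at the last good time n ≤ m,
  -- where r is still below c·a(n), while r is bounded below through a(m+1).
  obtain ⟨m, hm1, hm2, hm3⟩ : ∃ m, m₀ ≤ m ∧ r < c * a m ∧ c * a (m + 1) ≤ r := by
    have hlt : m₀ < Nat.find hex := by
      by_contra hcon
      exact absurd ((mul_le_mul_of_nonneg_left (hanti (not_lt.1 hcon)) hc.le).trans
        (Nat.find_spec hex)) (not_le.2 hrm)
    refine ⟨Nat.find hex - 1, by omega, ?_, ?_⟩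
    · exact not_le.1 (Nat.find_min hex (by omega))
    · rw [Nat.sub_add_cancel (by omega)]; exact Nat.find_spec hex
  obtain ⟨n, hnm, hmn, hn⟩ := hm₁ m ((le_max_left _ _).trans hm1)
  have hmm2 : (m₂ : ℝ) ≤ m := by
    exact_mod_cast ((le_max_left _ _).trans (le_max_right _ _)).trans hm1
  have hnn : n₀ ≤ n := by
    have : (1 + ε) * (n₀ : ℝ) ≤ (1 + ε) * n := by linarith
    exact_mod_cast le_of_mul_le_mul_left this (by linarith)
  obtain ⟨-, fa2, fb, fW⟩ := hn₀ n hnn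
  obtain ⟨fa1, -⟩ := hn₀ (m + 1)
    ((((le_max_right m₂ n₀).trans (le_max_right _ _)).trans hm1).trans (Nat.le_succ _))
  refine (hn r hr (hm2.trans_le (mul_le_mul_of_nonneg_left (hanti hnm) hc.le))).trans
    (ENNReal.ofReal_le_ofReal ?_)
  have q1 : (a n / b n) ^ s ≤ Real.exp (-((χ₂ - ε) - (χ₁ + ε)) * s * n) := by
    have : a n / b n ≤ Real.exp (-((χ₂ - ε) - (χ₁ + ε)) * n) := by
      rw [div_le_iff₀ (hb n)]
      refine fa2.trans ?_
      calc Real.exp (-(χ₂ - ε) * n)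
          = Real.exp (-((χ₂ - ε) - (χ₁ + ε)) * n) * Real.exp (-(χ₁ + ε) * n) := by
            rw [← Real.exp_add]; ring_nf
        _ ≤ _ := by gcongr
    calc (a n / b n) ^ s ≤ Real.exp (-((χ₂ - ε) - (χ₁ + ε)) * n) ^ s :=
          Real.rpow_le_rpow (div_pos (ha n) (hb n)).le this hs
      _ = _ := by rw [← Real.exp_mul]; ring_nf
  have q2 : Real.exp (W n) * (a n / b n) ^ s ≤ Real.exp (-γ * n) := by
    calc Real.exp (W n) * (a n / b n) ^ s
        ≤ Real.exp (-(h - ε) * n) * Real.exp (-((χ₂ - ε) - (χ₁ + ε)) * s * n) :=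
          mul_le_mul (Real.exp_le_exp.2 fW) q1
            (Real.rpow_nonneg (div_pos (ha n) (hb n)).le s) (Real.exp_pos _).le
      _ = _ := by rw [← Real.exp_add, hγ]; ring_nf
  have q3 : Real.exp (-γ * n) ≤ Real.exp (-(u * (χ₂ + ε)) * m) := by
    refine Real.exp_le_exp.2 ?_
    have w1 : u * (χ₂ + ε) * m ≤ u * (χ₂ + ε) * ((1 + ε) * n) := by gcongr
    have w2 : u * (χ₂ + ε) * (1 + ε) * n ≤ γ * n := by gcongr
    linarith
  have q4 : Real.exp (-(u * (χ₂ + ε)) * m) ≤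
      c⁻¹ ^ u * Real.exp (u * (χ₂ + ε)) * r ^ u := by
    have w1 : Real.exp (-(χ₂ + ε) * (m + 1 : ℕ)) ≤ c⁻¹ * r := by
      refine fa1.trans ?_
      rw [inv_mul_eq_div, le_div_iff₀ hc, mul_comm]; exact hm3
    have w2 := Real.rpow_le_rpow (Real.exp_pos _).le w1 hu
    rw [← Real.exp_mul, Real.mul_rpow (by positivity) hr.le] at w2
    calc Real.exp (-(u * (χ₂ + ε)) * m)
        = Real.exp (u * (χ₂ + ε)) * Real.exp (-(χ₂ + ε) * (m + 1 : ℕ) * u) := by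
          rw [← Real.exp_add]; push_cast; ring_nf
      _ ≤ Real.exp (u * (χ₂ + ε)) * (c⁻¹ ^ u * r ^ u) := by gcongr
      _ = _ := by ring
  have hab : 0 ≤ a n / b n := (div_pos (ha n) (hb n)).le
  calc k * (Real.exp (W n) * (D * (a n / b n)) ^ s)
      = k * D ^ s * (Real.exp (W n) * (a n / b n) ^ s) := by
        rw [Real.mul_rpow hD hab]; ring
    _ ≤ k * D ^ s * (c⁻¹ ^ u * Real.exp (u * (χ₂ + ε)) * r ^ u) := by
        exact mul_le_mul_of_nonneg_left (q2.trans (q3.trans q4)) (by positivity)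
    _ = _ := by ring

end

noncomputable section

/-! ### The lower bound for the dimension -/

open Metric

variable {N : ℕ}

/-- Only an inequality, because log 0 = 0 makes the right-hand factor 1 at a symbol of probability
zero. -/
theorem wordWeight_le_exp (p : PMF (Fin N)) (i : ℕ → Fin N) (n : ℕ) :
    wordWeight p i n ≤
      ENNReal.ofReal (Real.exp (∑ k ∈ Finset.range n, Real.log (p (i k)).toReal)) := by
  rw [Real.exp_sum, ENNReal.ofReal_prod_of_nonneg fun _ _ => (Real.exp_pos _).le, wordWeight]
  refine Finset.prod_le_prod' fun k _ => ?_
  rw [← ENNReal.ofReal_toReal (p.apply_ne_top (i k))]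
  exact ENNReal.ofReal_le_ofReal
    (by rw [ENNReal.toReal_ofReal ENNReal.toReal_nonneg]; exact Real.le_exp_log _)

theorem ae_tendsto_entropy (p : PMF (Fin N)) :
    ∀ᵐ i ∂(bernoulliMeas p), Tendsto
      (fun n : ℕ => (∑ k ∈ Finset.range n, Real.log (p (i k)).toReal) / n) atTop
      (𝓝 (-entropy p)) := by
  have h := ae_tendsto_average p fun a => Real.log (p a).toReal
  have he : ∑ a, (p a).toReal * Real.log (p a).toReal = -entropy p := by
    rw [entropy, ← Finset.sum_neg_distrib]
    refine Finset.sum_congr rfl fun a _ => ?_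
    rw [Real.negMulLog]; ring
  rwa [he] at h

/-- The tube through `π i` in the slow direction of `j` has measure at most `k ρ ^ s` at all dyadic
scales. -/
def tubeSet (A : Fin N → Mat2) (t : Fin N → Plane) (p : PMF (Fin N)) (s : ℝ) (k : ℕ) :
    Set ((ℕ → Fin N) × (ℕ → Fin N)) :=
  {q | ∀ m : ℕ, selfAffineMeasure A t p
    {z | distToLine (slowLine A q.2) (z - naturalProjection A t q.1) ≤ (1 / 2) ^ m} ≤
      ENNReal.ofReal (k * ((1 / 2) ^ m) ^ s)}

theorem measurable_measure_tube (μ : Measure Plane) [SFinite μ] (r : ℝ) :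
    Measurable fun q : Plane × ℙ ℝ Plane => μ {z | distToLine q.2 (z - q.1) ≤ r} :=
  measurable_measure_prodMk_left (ν := μ) (measurableSet_tube r)

theorem measurable_measure_tube_comp (μ : Measure Plane) [SFinite μ] {Y : Type*}
    [MeasurableSpace Y] {f : Y → Plane} {g : Y → ℙ ℝ Plane} (hf : Measurable f)
    (hg : Measurable g) (r : ℝ) :
    Measurable fun q => μ {z | distToLine (g q) (z - f q) ≤ r} := by
  have h := (measurable_measure_tube μ r).comp (hf.prodMk hg)
  simp only [Function.comp_def] at h
  exact h

theorem measurableSet_tubeSet {A : Fin N → Mat2} {t : Fin N → Plane} (p : PMF (Fin N))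
    (hπ : Measurable (naturalProjection A t)) (hE : Measurable (slowLine A)) (s : ℝ) (k : ℕ)
    [SFinite (selfAffineMeasure A t p)] :
    MeasurableSet (tubeSet A t p s k) := by
  have h : tubeSet A t p s k = ⋂ m : ℕ, {q | selfAffineMeasure A t p
      {z | distToLine (slowLine A q.2) (z - naturalProjection A t q.1) ≤ (1 / 2) ^ m} ≤
        ENNReal.ofReal (k * ((1 / 2) ^ m) ^ s)} := by
    rw [tubeSet, Set.ofPred_forall]
  rw [h]
  exact .iInter fun m => measurableSet_le (measurable_measure_tube_comp _ (hπ.comp measurable_fst)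
    (hE.comp measurable_snd) ((1 / 2) ^ m)) measurable_const

theorem tube_le_of_mem_tubeSet {A : Fin N → Mat2} {t : Fin N → Plane} {p : PMF (Fin N)} {s : ℝ}
    (hs : 0 ≤ s) {k : ℕ} [IsProbabilityMeasure (selfAffineMeasure A t p)]
    {q : (ℕ → Fin N) × (ℕ → Fin N)} (hq : q ∈ tubeSet A t p s k) {ρ : ℝ} (hρ : 0 < ρ) :
    selfAffineMeasure A t p
      {z | distToLine (slowLine A q.2) (z - naturalProjection A t q.1) ≤ ρ} ≤
      ENNReal.ofReal ((k * 2 ^ s + 1) * ρ ^ s) := by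
  have hk : (0 : ℝ) ≤ k * 2 ^ s := by positivity
  rcases le_or_gt ρ 1 with h1 | h1
  · obtain ⟨m, hm1, hm2⟩ := exists_dyadic hρ h1
    refine (measure_mono fun z hz => le_trans hz hm1).trans ((hq m).trans ?_)
    refine ENNReal.ofReal_le_ofReal ?_
    calc (k : ℝ) * ((1 / 2) ^ m) ^ s ≤ k * (2 * ρ) ^ s := by gcongr
      _ = k * 2 ^ s * ρ ^ s := by rw [Real.mul_rpow (by norm_num) hρ.le]; ring
      _ ≤ (k * 2 ^ s + 1) * ρ ^ s := by gcongr; linarith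
  · refine prob_le_one.trans ?_
    rw [← ENNReal.ofReal_one]
    refine ENNReal.ofReal_le_ofReal ?_
    have := Real.one_le_rpow h1.le hs
    nlinarith

/-- The bootstrap step. At a good time n a ball of radius α₂ ≈ exp(-χ₂n) has mass at most exp(-hn),
the weight of its cylinder, times (α₂/α₁)^s, the mass of a tube. Comparing exponents gives every u
with uχ₂ < h+(χ₂-χ₁)s. -/
theorem frostmanAE_selfAffineMeasure_of_tube {A : Fin N → Mat2} {t : Fin N → Plane}
    (p : PMF (Fin N)) {L C δ : ℝ} (hcontr : ∀ i, IsContracting (A i))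
    (h : UniformlyDominated A L C δ) (h' : UniformlyDominated (fun i => (A i)⁻¹) L C δ)
    (hssc : StrongSeparation A t) {s u : ℝ} (hs : 0 ≤ s)
    (htube : ∀ᵐ q ∂((selfAffineMeasure A t p).prod ((bernoulliMeas p).map (slowLine A))),
      ∃ c : ℝ, ∀ ρ, 0 < ρ → ρ ≤ 1 →
        selfAffineMeasure A t p {z | distToLine q.2 (z - q.1) ≤ ρ} ≤ ENNReal.ofReal (c * ρ ^ s))
    (hu : u * lyapSS A p < entropy p + (lyapSS A p - lyapS A p) * s) :
    FrostmanAE (selfAffineMeasure A t p) u := by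
  have : IsProbabilityMeasure (selfAffineMeasure A t p) :=
    isProbabilityMeasure_selfAffineMeasure p hcontr hssc
  rcases le_or_gt u 0 with hu0 | hu0
  · exact .of_forall fun x => frostmanAt_of_nonpos hu0 x
  have hπ := (continuous_naturalProjection hcontr hssc).measurable
  have hE := h.continuous_slowLine.measurable
  set ν := bernoulliMeas p with hν
  set μ := selfAffineMeasure A t p with hμ
  obtain ⟨c, hc, hsep⟩ := exists_separation hcontr hssc
  obtain ⟨K, hK1, hK⟩ := h.exists_slowNorm_le_sv2 h'
  obtain ⟨hχ0, hχ1⟩ := lyapS_pos_and_lt p hcontr h h'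
  obtain ⟨tS, tSS, -⟩ := ae_tendsto_lyapunov p h h'
  have tH := ae_tendsto_entropy p
  obtain ⟨κ, hκ0, hκ1, hκ⟩ := exists_contraction hcontr
  have hpull : ∀ᵐ q ∂(ν.prod ν), ∃ c : ℝ, ∀ ρ, 0 < ρ → ρ ≤ 1 →
      μ {z | distToLine (slowLine A q.2) (z - naturalProjection A t q.1) ≤ ρ} ≤
        ENNReal.ofReal (c * ρ ^ s) := by
    have hm : μ.prod (ν.map (slowLine A)) =
        (ν.prod ν).map (Prod.map (naturalProjection A t) (slowLine A)) := by
      rw [hμ, selfAffineMeasure, Measure.map_prod_map ν ν hπ hE]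
    rw [hm] at htube
    exact ae_of_ae_map (hπ.prodMap hE).aemeasurable htube
  have hexh : ∀ᵐ q ∂(ν.prod ν), ∃ k : ℕ, q ∈ tubeSet A t p s k := by
    filter_upwards [hpull] with q hq
    obtain ⟨c, hc⟩ := hq
    obtain ⟨k, hk⟩ := exists_nat_ge c
    refine ⟨k, fun m => (hc _ (by positivity) (pow_le_one₀ (by norm_num) (by norm_num))).trans
      (ENNReal.ofReal_le_ofReal ?_)⟩
    gcongr
  -- The tube constant k depends on the pair, so recurrence is secured for all k at once; each pair
  -- then uses its own.
  have hvis : ∀ᵐ q ∂(ν.prod ν), ∀ k : ℕ, q ∈ tubeSet A t p s k → ∀ ε : ℝ, 0 < ε →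
      ∀ᶠ n : ℕ in atTop, ∃ m ≤ n, (n : ℝ) ≤ (1 + ε) * m ∧ natExt^[m] q ∈ tubeSet A t p s k :=
    ae_all_iff.2 fun k => ae_exists_visit (measurePreserving_natExt p)
      (measurableSet_tubeSet p hπ hE s k)
  have hfst : ∀ᵐ q ∂(ν.prod ν), FrostmanAt μ u (naturalProjection A t q.1) := by
    have qfst := (measurePreserving_fst (μ := ν) (ν := ν)).quasiMeasurePreserving
    filter_upwards [hexh, hvis, qfst.ae tS, qfst.ae tSS, qfst.ae tH] with q ⟨k, hk⟩ hv t1 t2 t3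
    obtain ⟨i, j⟩ := q
    have hd := det_wordProd_ne_zero h.det_ne i
    refine frostmanAt_of_visits (a := fun n => sv2 (wordProd A i n))
      (b := fun n => sv1 (wordProd A i n))
      (W := fun n => ∑ k ∈ Finset.range n, Real.log (p (i k)).toReal)
      (k := k * 2 ^ s + 1) (D := K * c) (fun n => sv2_pos (hd n)) (fun n => sv1_pos (hd n))
      (antitone_sv2_wordProd h.det_ne (fun a => (hκ a).trans hκ1.le) i) t2 t1 t3
      (hχ0.trans hχ1) hc (by positivity) (by positivity) hs hu0.le hu fun ε hε => ?_
    filter_upwards [hv k hk ε hε] with m hm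
    obtain ⟨n, hnm, hmn, hn⟩ := hm
    refine ⟨n, hnm, hmn, fun r hr hra => ?_⟩
    rw [natExt_iterate] at hn
    -- The tube direction at time n is the slow line of the second coordinate of the natural
    -- extension, and A_{i_0}⋯A_{i_{n-1}} contracts it by about α₂.
    have hl : ‖act (wordProd A i n) (dir (slowLine A (prependRev n i j)))‖ ≤
        K * sv2 (wordProd A i n) := by
      rw [wordProd_eq_coc_prependRev A i j n]
      exact hK _ _
    have hpos : 0 < K * c * (sv2 (wordProd A i n) / sv1 (wordProd A i n)) := by
      have := sv2_pos (hd n)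
      have := sv1_pos (hd n)
      positivity
    refine (selfAffineMeasure_closedBall_le p hcontr h.det_ne hssc hc hsep hl hra).trans ?_
    refine (mul_le_mul' (wordWeight_le_exp p i n) (tube_le_of_mem_tubeSet hs hn hpos)).trans ?_
    rw [← ENNReal.ofReal_mul (Real.exp_pos _).le]
    exact ENNReal.ofReal_le_ofReal (le_of_eq (by ring))
  -- The conclusion does not involve the auxiliary word j, so one good j for each i suffices.
  have hi : ∀ᵐ i ∂ν, FrostmanAt μ u (naturalProjection A t i) := by
    have := Measure.ae_ae_of_ae_prod hfst
    filter_upwards [this] with i hi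
    exact hi.exists.choose_spec
  rw [FrostmanAE, hμ, selfAffineMeasure, ae_map_iff hπ.aemeasurable]
  · exact hi
  · exact measurableSet_frostmanAt μ hu0.le

/-- The Frostman exponents of the measure exceed every number below the Lyapunov dimension, if the
strong stable directions are sufficiently spread out. -/
theorem frostmanAE_selfAffineMeasure {A : Fin N → Mat2} {t : Fin N → Plane}
    (p : PMF (Fin N)) {L C δ : ℝ} (hcontr : ∀ i, IsContracting (A i))
    (h : UniformlyDominated A L C δ) (h' : UniformlyDominated (fun i => (A i)⁻¹) L C δ)
    (hssc : StrongSeparation A t)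
    (hdir : ∀ s, 0 < s → s < 1 → s < dimLyap A p →
      FrostmanAE ((bernoulliMeas p).map (slowLine A)) s)
    {d : ℝ} (hd : d < dimLyap A p) :
    FrostmanAE (selfAffineMeasure A t p) d := by
  set μ := selfAffineMeasure A t p with hμ
  have : IsProbabilityMeasure μ := isProbabilityMeasure_selfAffineMeasure p hcontr hssc
  obtain ⟨hχ0, hχ1⟩ := lyapS_pos_and_lt p hcontr h h'
  set χ₁ := lyapS A p
  set χ₂ := lyapSS A p
  have hχ2 : 0 < χ₂ := hχ0.trans hχ1
  by_contra hcon
  have hd0 : 0 ≤ d := by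
    by_contra hneg
    exact hcon (.of_forall fun x => frostmanAt_of_nonpos (not_le.1 hneg).le x)
  -- Under the contrary assumption these exponents are bounded by d, so their supremum D lies below
  -- the Lyapunov dimension; the bootstrap inequality at D will contradict this.
  set S : Set ℝ := {s | 0 ≤ s ∧ FrostmanAE μ s}
  have hS0 : (0 : ℝ) ∈ S := ⟨le_rfl, .of_forall fun x => frostmanAt_of_nonpos le_rfl x⟩
  have hSd : ∀ s ∈ S, s ≤ d := fun s hs => by
    by_contra hlt
    exact hcon (hs.2.mono (not_le.1 hlt).le)
  have hbdd : BddAbove S := ⟨d, hSd⟩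
  set D := sSup S
  have hD0 : 0 ≤ D := le_csSup hbdd hS0
  have hDd : D ≤ d := csSup_le ⟨0, hS0⟩ hSd
  have hstep : ∀ s, 0 ≤ s → (∀ᵐ q ∂(μ.prod ((bernoulliMeas p).map (slowLine A))),
      ∃ c : ℝ, ∀ ρ, 0 < ρ → ρ ≤ 1 →
        μ {z | distToLine q.2 (z - q.1) ≤ ρ} ≤ ENNReal.ofReal (c * ρ ^ s)) →
      entropy p + (χ₂ - χ₁) * s ≤ D * χ₂ := by
    intro s hs htube
    by_contra hlt
    obtain ⟨u, hu1, hu2⟩ : ∃ u, D < u ∧ u * χ₂ < entropy p + (χ₂ - χ₁) * s := by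
      have : D < (entropy p + (χ₂ - χ₁) * s) / χ₂ := by
        rw [lt_div_iff₀ hχ2]; exact not_le.1 hlt
      obtain ⟨u, h1, h2⟩ := exists_between this
      exact ⟨u, h1, by rwa [lt_div_iff₀ hχ2] at h2⟩
    have := frostmanAE_selfAffineMeasure_of_tube p hcontr h h' hssc hs htube hu2
    exact absurd (le_csSup hbdd ⟨hD0.trans hu1.le, this⟩) (not_le.2 hu1)
  have hzero : entropy p + (χ₂ - χ₁) * 0 ≤ D * χ₂ := by
    refine hstep 0 le_rfl (.of_forall fun q => ⟨1, fun ρ _ _ => ?_⟩)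
    rw [Real.rpow_zero, mul_one, ENNReal.ofReal_one]
    exact prob_le_one
  -- The projection theorem needs s < s₁ < s₂, with s₁ an exponent for the directions, hence s₁ < 1
  -- and s₁ < D, and s₂ an exponent of μ itself.
  have hmin : ∀ s, 0 ≤ s → s < min D 1 → entropy p + (χ₂ - χ₁) * s ≤ D * χ₂ := by
    intro s hs hs1
    obtain ⟨s₁, h1, h2⟩ := exists_between hs1
    have h2D := h2.trans_le (min_le_left _ _)
    obtain ⟨s₂, hs₂, h3⟩ := exists_lt_of_lt_csSup ⟨0, hS0⟩ h2D
    exact hstep s hs (ae_exists_tube_le hs h1 h3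
      (hdir s₁ (hs.trans_lt h1) (h2.trans_le (min_le_right _ _)) (by linarith)) hs₂.2)
  have hfin : entropy p + (χ₂ - χ₁) * min D 1 ≤ D * χ₂ := by
    rcases (le_min hD0 zero_le_one).eq_or_lt with h0 | h0
    · rw [← h0]; exact hzero
    · have hc : Tendsto (fun s : ℝ => entropy p + (χ₂ - χ₁) * s) (𝓝[<] (min D 1))
          (𝓝 (entropy p + (χ₂ - χ₁) * min D 1)) := by
        have : Continuous fun s : ℝ => entropy p + (χ₂ - χ₁) * s := by fun_prop
        exact tendsto_nhdsWithin_of_tendsto_nhds (this.tendsto _)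
      refine le_of_tendsto hc ?_
      filter_upwards [Ioo_mem_nhdsLT h0] with s hs
      exact hmin s hs.1.le hs.2
  have hdd : D < min (entropy p / χ₁) (1 + (entropy p - χ₁) / χ₂) :=
    (hDd.trans_lt hd).trans_le (min_le_right _ _)
  obtain ⟨e1, e2⟩ := lt_min_iff.1 hdd
  -- If D ≤ 1 the inequality becomes h ≤ Dχ₁, otherwise h-χ₁ ≤ (D-1)χ₂; each contradicts one entry
  -- of the minimum.
  rcases le_total D 1 with hD1 | hD1
  · rw [min_eq_left hD1] at hfin
    rw [lt_div_iff₀ hχ0] at e1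
    nlinarith
  · rw [min_eq_right hD1] at hfin
    have : D - 1 < (entropy p - χ₁) / χ₂ := by linarith
    rw [lt_div_iff₀ hχ2] at this
    nlinarith

theorem dimLyap_eq {A : Fin N → Mat2} {t : Fin N → Plane}
    (p : PMF (Fin N)) {L C δ : ℝ} (hcontr : ∀ i, IsContracting (A i))
    (h : UniformlyDominated A L C δ) (h' : UniformlyDominated (fun i => (A i)⁻¹) L C δ)
    (hssc : StrongSeparation A t) :
    dimLyap A p = min (entropy p / lyapS A p) (1 + (entropy p - lyapS A p) / lyapSS A p) := by
  obtain ⟨hχ0, hχ1⟩ := lyapS_pos_and_lt p hcontr h h'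
  have hsum := (ae_tendsto_lyapunov p h h').2.2
  have hent := entropy_le p h.det_ne hssc
  rw [← hsum] at hent
  refine min_eq_right ((min_le_right _ _).trans ?_)
  have : (entropy p - lyapS A p) / lyapSS A p ≤ 1 := by
    rw [div_le_one (hχ0.trans hχ1)]; linarith
  linarith

end

noncomputable section

/-! ### The upper bound for the dimension -/

open Metric

theorem exists_cover_of_code {Ω X β : Type*} [PseudoMetricSpace X] {f : Ω → X} {G : Set Ω}
    {code : Ω → β} {T : Finset β} {D : ℝ} (hT : ∀ j ∈ G, code j ∈ T)
    (hD : ∀ j ∈ G, ∀ k ∈ G, code j = code k → dist (f j) (f k) ≤ D) :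
    ∃ t : Fin T.card → Set X, f '' G ⊆ (⋃ i, t i) ∧ ∀ i, ediam (t i) ≤ ENNReal.ofReal D := by
  refine ⟨fun i => f '' {j ∈ G | code j = T.equivFin.symm i}, ?_, fun i => ?_⟩
  · rintro _ ⟨j, hj, rfl⟩
    refine Set.mem_iUnion.2 ⟨T.equivFin ⟨code j, hT j hj⟩, j, ⟨hj, ?_⟩, rfl⟩
    rw [Equiv.symm_apply_apply]
  · refine ediam_le_of_forall_dist_le ?_
    rintro _ ⟨j, ⟨hj, hj'⟩, rfl⟩ _ ⟨k, ⟨hk, hk'⟩, rfl⟩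
    exact hD j hj k hk (hj'.trans hk'.symm)

variable {N : ℕ}

/-- The words of length `n` whose probability is at least `exp (-(a n))`. -/
def heavyWords (p : PMF (Fin N)) (a : ℝ) (n : ℕ) : Finset (Fin n → Fin N) :=
  Finset.univ.filter fun w => Real.exp (-a * n) ≤ ∏ k, (p (w k)).toReal

/-- The probabilities of all words of length n sum to 1. -/
theorem card_heavyWords_le (p : PMF (Fin N)) (a : ℝ) (n : ℕ) :
    ((heavyWords p a n).card : ℝ) ≤ Real.exp (a * n) := by
  have h1 : ((heavyWords p a n).card : ℝ) * Real.exp (-a * n) ≤ 1 := by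
    calc ((heavyWords p a n).card : ℝ) * Real.exp (-a * n)
        = ∑ w ∈ heavyWords p a n, Real.exp (-a * n) := by rw [Finset.sum_const, nsmul_eq_mul]
      _ ≤ ∑ w ∈ heavyWords p a n, ∏ k, (p (w k)).toReal :=
          Finset.sum_le_sum fun w hw => (Finset.mem_filter.1 hw).2
      _ ≤ ∑ w : Fin n → Fin N, ∏ k, (p (w k)).toReal :=
          Finset.sum_le_sum_of_subset_of_nonneg (Finset.subset_univ _) fun w _ _ =>
            Finset.prod_nonneg fun k _ => ENNReal.toReal_nonneg
      _ = (∑ a, (p a).toReal) ^ n := (Fintype.sum_pow (fun a => (p a).toReal) n).symm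
      _ = 1 := by rw [sum_pmf_toReal, one_pow]
  have h2 : Real.exp (-a * n) * Real.exp (a * n) = 1 := by
    rw [← Real.exp_add]; simp
  have h3 := Real.exp_pos (a * n)
  nlinarith

/-- The infinite words with the typical probability and singular values up to time `n`. -/
def typicalAt (A : Fin N → Mat2) (p : PMF (Fin N)) (a b₁ b₂ : ℝ) (n : ℕ) : Set (ℕ → Fin N) :=
  {i | Real.exp (-a * n) ≤ ∏ k : Fin n, (p (i k)).toReal ∧
    sv1 (wordProd A i n) ≤ Real.exp (-b₁ * n) ∧ sv2 (wordProd A i n) ≤ Real.exp (-b₂ * n)}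

theorem isClosed_of_dependsOnFirst {n : ℕ} {S : Set (ℕ → Fin N)}
    (h : ∀ i j : ℕ → Fin N, (∀ k < n, i k = j k) → i ∈ S → j ∈ S) : IsClosed S := by
  have hc : Continuous fun (i : ℕ → Fin N) (k : Fin n) => i k := by fun_prop
  have hS : S = (fun (i : ℕ → Fin N) (k : Fin n) => i k) ⁻¹'
      ((fun (i : ℕ → Fin N) (k : Fin n) => i k) '' S) := by
    refine Set.Subset.antisymm (Set.subset_preimage_image _ _) ?_
    rintro j ⟨i, hi, hij⟩
    exact h i j (fun k hk => congrFun hij ⟨k, hk⟩) hi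
  rw [hS]
  exact (isClosed_discrete _).preimage hc

theorem isClosed_typicalAt (A : Fin N → Mat2) (p : PMF (Fin N)) (a b₁ b₂ : ℝ) (n : ℕ) :
    IsClosed (typicalAt A p a b₁ b₂ n) := by
  refine isClosed_of_dependsOnFirst (n := n) fun i j hij hi => ?_
  have h1 : ∏ k : Fin n, (p (i k)).toReal = ∏ k : Fin n, (p (j k)).toReal :=
    Finset.prod_congr rfl fun k _ => by rw [hij k k.2]
  simpa only [typicalAt, Set.mem_ofPred_eq, h1, wordProd_congr A hij] using hi

theorem ae_eventually_typicalAt {A : Fin N → Mat2} {L C δ : ℝ} (p : PMF (Fin N))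
    (h : UniformlyDominated A L C δ) (h' : UniformlyDominated (fun i => (A i)⁻¹) L C δ)
    {a b₁ b₂ : ℝ} (ha : entropy p < a) (h1 : b₁ < lyapS A p) (h2 : b₂ < lyapSS A p) :
    ∀ᵐ i ∂(bernoulliMeas p), ∃ m : ℕ, ∀ n, m ≤ n → i ∈ typicalAt A p a b₁ b₂ n := by
  obtain ⟨tS, tSS, -⟩ := ae_tendsto_lyapunov p h h'
  filter_upwards [tS, tSS, ae_tendsto_entropy p, ae_ne_zero p] with i t1 t2 t3 t4
  rw [← eventually_atTop]
  have hd := det_wordProd_ne_zero h.det_ne i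
  have hp : ∀ k, 0 < (p (i k)).toReal := fun k => ENNReal.toReal_pos (t4 k) (p.apply_ne_top _)
  have e1 := eventually_le_exp_of_tendsto_log_div (fun n => sv1_pos (hd n)) t1
    (neg_lt_neg h1)
  have e2 := eventually_le_exp_of_tendsto_log_div (fun n => sv2_pos (hd n)) t2
    (neg_lt_neg h2)
  have e3 := eventually_exp_le_of_tendsto_log_div
    (a := fun n => ∏ k ∈ Finset.range n, (p (i k)).toReal) (b := -a)
    (fun n => Finset.prod_pos fun k _ => hp k)
    (t3.congr fun n => by rw [Real.log_prod fun k _ => (hp k).ne']) (neg_lt_neg ha)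
  filter_upwards [e1, e2, e3] with n f1 f2 f3
  rw [Finset.prod_range] at f3
  exact ⟨f3, f1, f2⟩

/-- Almost every word is typical from some time m on, and Hausdorff dimension is stable under the
countable union over m. The sets of words are closed, so their images are compact and the union is
measurable. -/
theorem dimHMeasure_le_of_typical {A : Fin N → Mat2} {t : Fin N → Plane} {L C δ : ℝ}
    (p : PMF (Fin N)) (hcontr : ∀ i, IsContracting (A i)) (hssc : StrongSeparation A t)
    (h : UniformlyDominated A L C δ) (h' : UniformlyDominated (fun i => (A i)⁻¹) L C δ)
    {a b₁ b₂ d : ℝ} (ha : entropy p < a) (h1 : b₁ < lyapS A p) (h2 : b₂ < lyapSS A p)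
    (hd : ∀ m : ℕ, dimH (naturalProjection A t '' {i | ∀ n, m ≤ n → i ∈ typicalAt A p a b₁ b₂ n}) ≤
      ENNReal.ofReal d) :
    dimHMeasure (selfAffineMeasure A t p) ≤ ENNReal.ofReal d := by
  have hπ := continuous_naturalProjection hcontr hssc
  set F : ℕ → Set (ℕ → Fin N) := fun m => {i | ∀ n, m ≤ n → i ∈ typicalAt A p a b₁ b₂ n}
  have hFc : ∀ m, IsClosed (F m) := fun m => by
    have : F m = ⋂ n, ⋂ (_ : m ≤ n), typicalAt A p a b₁ b₂ n := by ext; simp [F]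
    rw [this]
    exact isClosed_iInter fun n => isClosed_iInter fun _ => isClosed_typicalAt A p a b₁ b₂ n
  have hm : MeasurableSet (⋃ m, naturalProjection A t '' F m) :=
    .iUnion fun m => ((hFc m).isCompact.image hπ).isClosed.measurableSet
  have hfull : selfAffineMeasure A t p (⋃ m, naturalProjection A t '' F m)ᶜ = 0 := by
    rw [selfAffineMeasure_apply p hcontr hssc hm.compl]
    refine measure_mono_null ?_ (ae_iff.1 (ae_eventually_typicalAt p h h' ha h1 h2))
    rintro i hi ⟨m, hm⟩
    exact hi (Set.mem_iUnion.2 ⟨m, i, hm, rfl⟩)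
  refine (iInf₂_le (f := fun (s : Set Plane) (_ : selfAffineMeasure A t p sᶜ = 0) => dimH s) _
    hfull).trans ?_
  rw [dimH_iUnion]
  exact iSup_le hd

theorem dimH_image_typical_le_one_scale {A : Fin N → Mat2} {t : Fin N → Plane}
    (p : PMF (Fin N)) (hcontr : ∀ i, IsContracting (A i)) (hssc : StrongSeparation A t)
    {a b₁ b₂ : ℝ} (ha : 0 ≤ a) (h1 : 0 < b₁) (m : ℕ) :
    dimH (naturalProjection A t '' {i | ∀ n, m ≤ n → i ∈ typicalAt A p a b₁ b₂ n}) ≤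
      ENNReal.ofReal (a / b₁) := by
  obtain ⟨R, hR0, hR⟩ := exists_norm_naturalProjection_le hcontr hssc
  refine dimH_le_of_covering (C := max 1 (2 * R)) ha h1 ?_
  filter_upwards [eventually_ge_atTop m] with n hn
  obtain ⟨T, hT1, hT2⟩ := exists_cover_of_code (f := naturalProjection A t)
    (G := {i | ∀ n, m ≤ n → i ∈ typicalAt A p a b₁ b₂ n})
    (code := fun (i : ℕ → Fin N) (k : Fin n) => i k) (T := heavyWords p a n)
    (D := max 1 (2 * R) * Real.exp (-b₁ * n))
    (fun j hj => Finset.mem_filter.2 ⟨Finset.mem_univ _, (hj n hn).1⟩) (by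
      intro j hj k hk hjk
      refine (dist_naturalProjection_le hcontr hR
        (n := n) fun l hl => congrFun hjk ⟨l, hl⟩).trans ?_
      rw [mul_comm]
      exact mul_le_mul (le_max_right _ _) (hj n hn).2.1 (sv1_nonneg _) (by positivity))
  refine ⟨_, T, hT1, (card_heavyWords_le p a n).trans ?_, hT2⟩
  exact le_mul_of_one_le_left (Real.exp_pos _).le (le_max_left _ _)

/-- Before the word map is applied, cut the attractor into strips of width θ = exp(-(b₂-b₁)n) in the
coordinate along the singular vector stretched by α₁. Each strip is mapped to size about α₁θ in that
direction and α₂ in the other, both at most exp(-b₂n) up to a constant; the price is about 1/θ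
strips per word. -/
theorem dimH_image_typical_le_two_scales {A : Fin N → Mat2} {t : Fin N → Plane}
    (p : PMF (Fin N)) (hcontr : ∀ i, IsContracting (A i)) (hssc : StrongSeparation A t)
    {a b₁ b₂ : ℝ} (ha : 0 ≤ a) (h1 : 0 < b₁) (h2 : b₁ ≤ b₂) (m : ℕ) :
    dimH (naturalProjection A t '' {i | ∀ n, m ≤ n → i ∈ typicalAt A p a b₁ b₂ n}) ≤
      ENNReal.ofReal ((a + (b₂ - b₁)) / b₂) := by
  obtain ⟨R, hR0, hR⟩ := exists_norm_naturalProjection_le hcontr hssc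
  refine dimH_le_of_covering (C := 1 + 2 * R) (by linarith) (h1.trans_le h2) ?_
  filter_upwards [eventually_ge_atTop m] with n hn
  choose b hb0 hb1 hb using exists_singular_basis
  set θ := Real.exp (-(b₂ - b₁) * n) with hθ
  have hθ0 : 0 < θ := Real.exp_pos _
  have hθ1 : θ * Real.exp ((b₂ - b₁) * n) = 1 := by
    rw [hθ, ← Real.exp_add, ← add_mul, neg_add_cancel, zero_mul, Real.exp_zero]
  set coord : (ℕ → Fin N) → ℝ := fun i =>
    inner ℝ (b (wordProd A i n) 0) (naturalProjection A t (shiftBy n i)) with hcoord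
  have hcoordR : ∀ i, |coord i| ≤ R := fun i => by
    refine (abs_real_inner_le_norm _ _).trans ?_
    rw [(b _).norm_eq_one, one_mul]
    exact hR _
  have hlt : ∀ i, 0 ≤ (coord i + R) / θ := fun i =>
    div_nonneg (by linarith [neg_le_of_abs_le (hcoordR i)]) hθ0.le
  -- The code records the word and its strip number; adding R makes the coordinate non-negative, as
  -- the natural-number floor requires.
  obtain ⟨T, hT1, hT2⟩ := exists_cover_of_code (f := naturalProjection A t)
    (G := {i | ∀ n, m ≤ n → i ∈ typicalAt A p a b₁ b₂ n})
    (code := fun i : ℕ → Fin N => ((fun k => i k : Fin n → Fin N), ⌊(coord i + R) / θ⌋₊))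
    (T := heavyWords p a n ×ˢ Finset.range (⌊2 * R / θ⌋₊ + 1))
    (D := (1 + 2 * R) * Real.exp (-b₂ * n))
    (fun j hj => by
      refine Finset.mem_product.2
        ⟨Finset.mem_filter.2 ⟨Finset.mem_univ _, (hj n hn).1⟩, Finset.mem_range_succ_iff.2 ?_⟩
      refine Nat.floor_le_floor ?_
      gcongr
      linarith [le_of_abs_le (hcoordR j)]) (by
      intro j hj k hk hjk
      obtain ⟨e1, e2⟩ := Prod.ext_iff.1 hjk
      have e1' : ∀ l < n, j l = k l := fun l hl => congrFun e1 ⟨l, hl⟩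
      have hM : wordProd A k n = wordProd A j n := (wordProd_congr A e1').symm
      have hclose : |coord j - coord k| ≤ θ := by
        have f1 := Nat.floor_le (hlt j)
        have f2 := Nat.lt_floor_add_one ((coord j + R) / θ)
        have f3 := Nat.floor_le (hlt k)
        have f4 := Nat.lt_floor_add_one ((coord k + R) / θ)
        simp only at e2
        rw [e2] at f1 f2
        rw [le_div_iff₀ hθ0] at f1 f3
        rw [div_lt_iff₀ hθ0] at f2 f4
        rw [abs_le]; constructor <;> linarith
      obtain ⟨-, g1, g2⟩ := hj n hn
      set M := wordProd A j n with hMdef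
      rw [naturalProjection_eq hcontr t j n, naturalProjection_eq hcontr t k n,
        ← wordMap_congr A t e1', dist_eq_norm, wordMap_sub]
      set v := naturalProjection A t (shiftBy n j) - naturalProjection A t (shiftBy n k) with hv
      have hv0 : |inner ℝ (b M 0) v| ≤ θ := by
        rw [hv, inner_sub_right]
        rw [hcoord] at hclose
        simp only [hM] at hclose
        exact hclose
      have hv1 : |inner ℝ (b M 1) v| ≤ 2 * R := by
        refine (abs_real_inner_le_norm _ _).trans ?_
        rw [(b _).norm_eq_one, one_mul]
        refine (norm_sub_le _ _).trans ?_
        linarith [hR (shiftBy n j), hR (shiftBy n k)]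
      have hsq := norm_sq_act_singular_basis (hb0 M) (hb1 M) (hb M) v
      have hle : ‖act M v‖ ≤ sv1 M * |inner ℝ (b M 0) v| + sv2 M * |inner ℝ (b M 1) v| := by
        have p1 : 0 ≤ sv1 M * |inner ℝ (b M 0) v| := mul_nonneg (sv1_nonneg _) (abs_nonneg _)
        have p2 : 0 ≤ sv2 M * |inner ℝ (b M 1) v| := mul_nonneg (sv2_nonneg _) (abs_nonneg _)
        refine le_of_sq_le_sq ?_ (add_nonneg p1 p2)
        rw [hsq, mul_pow, mul_pow, ← sq_abs (inner ℝ (b M 0) v), ← sq_abs (inner ℝ (b M 1) v)]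
        nlinarith [mul_nonneg p1 p2]
      have hexp : Real.exp (-b₁ * n) * θ = Real.exp (-b₂ * n) := by
        rw [hθ, ← Real.exp_add]; ring_nf
      have k1 : sv1 M * |inner ℝ (b M 0) v| ≤ Real.exp (-b₁ * n) * θ :=
        mul_le_mul g1 hv0 (abs_nonneg _) (Real.exp_pos _).le
      have k2 : sv2 M * |inner ℝ (b M 1) v| ≤ Real.exp (-b₂ * n) * (2 * R) :=
        mul_le_mul g2 hv1 (abs_nonneg _) (Real.exp_pos _).le
      linarith)
  refine ⟨_, T, hT1, ?_, hT2⟩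
  rw [Finset.card_product, Finset.card_range]
  push_cast
  have hfl : (⌊2 * R / θ⌋₊ : ℝ) + 1 ≤ (1 + 2 * R) * Real.exp ((b₂ - b₁) * n) := by
    have f1 := Nat.floor_le (show 0 ≤ 2 * R / θ by positivity)
    have f2 : 2 * R / θ = 2 * R * Real.exp ((b₂ - b₁) * n) := by
      rw [div_eq_iff hθ0.ne', mul_assoc, mul_comm (Real.exp _), hθ1, mul_one]
    have f3 : 1 ≤ Real.exp ((b₂ - b₁) * n) :=
      Real.one_le_exp (mul_nonneg (sub_nonneg.2 h2) (Nat.cast_nonneg n))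
    linarith
  calc ((heavyWords p a n).card : ℝ) * (⌊2 * R / θ⌋₊ + 1)
      ≤ Real.exp (a * n) * ((1 + 2 * R) * Real.exp ((b₂ - b₁) * n)) :=
        mul_le_mul (card_heavyWords_le p a n) hfl (by positivity) (Real.exp_pos _).le
    _ = (1 + 2 * R) * Real.exp ((a + (b₂ - b₁)) * n) := by
        rw [add_mul a, Real.exp_add]; ring

theorem dimHMeasure_selfAffineMeasure_le {A : Fin N → Mat2} {t : Fin N → Plane} {L C δ : ℝ}
    (p : PMF (Fin N)) (hcontr : ∀ i, IsContracting (A i)) (hssc : StrongSeparation A t)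
    (h : UniformlyDominated A L C δ) (h' : UniformlyDominated (fun i => (A i)⁻¹) L C δ) :
    dimHMeasure (selfAffineMeasure A t p) ≤ ENNReal.ofReal
      (min (entropy p / lyapS A p) (1 + (entropy p - lyapS A p) / lyapSS A p)) := by
  obtain ⟨hχ0, hχ1⟩ := lyapS_pos_and_lt p hcontr h h'
  have hent := entropy_nonneg p
  set χ₁ := lyapS A p
  set χ₂ := lyapSS A p
  have hχ2 : 0 < χ₂ := hχ0.trans hχ1
  have key : ∀ᶠ ε : ℝ in 𝓝[>] 0, dimHMeasure (selfAffineMeasure A t p) ≤ ENNReal.ofReal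
      (min ((entropy p + ε) / (χ₁ - ε))
        ((entropy p + ε + ((χ₂ - ε) - (χ₁ - ε))) / (χ₂ - ε))) := by
    filter_upwards [Ioo_mem_nhdsGT hχ0] with ε hε
    obtain ⟨hε0, hε1⟩ := hε
    rw [ENNReal.ofReal_min]
    refine le_min ?_ ?_
    · exact dimHMeasure_le_of_typical p hcontr hssc h h' (by linarith) (sub_lt_self χ₁ hε0)
        (sub_lt_self χ₂ hε0) fun m => dimH_image_typical_le_one_scale p hcontr hssc
          (by linarith) (by linarith) m
    · exact dimHMeasure_le_of_typical p hcontr hssc h h' (by linarith) (sub_lt_self χ₁ hε0)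
        (sub_lt_self χ₂ hε0) fun m => dimH_image_typical_le_two_scales p hcontr hssc
          (by linarith) (by linarith) (by linarith) m
  refine ge_of_tendsto ?_ key
  refine (ENNReal.continuous_ofReal.tendsto _).comp ?_
  have hid : Tendsto (fun ε : ℝ => ε) (𝓝[>] 0) (𝓝 0) :=
    tendsto_nhdsWithin_of_tendsto_nhds tendsto_id
  have hlim : Tendsto (fun ε : ℝ => min ((entropy p + ε) / (χ₁ - ε))
        ((entropy p + ε + ((χ₂ - ε) - (χ₁ - ε))) / (χ₂ - ε))) (𝓝[>] 0)
      (𝓝 (min ((entropy p + 0) / (χ₁ - 0))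
        ((entropy p + 0 + ((χ₂ - 0) - (χ₁ - 0))) / (χ₂ - 0)))) := by
    refine Tendsto.min ?_ ?_
    · exact (hid.const_add _).div (hid.const_sub _) (by simpa using hχ0.ne')
    · exact ((hid.const_add _).add ((hid.const_sub _).sub (hid.const_sub _))).div
        (hid.const_sub _) (by simpa using hχ2.ne')
  have he : (entropy p + 0 + ((χ₂ - 0) - (χ₁ - 0))) / (χ₂ - 0) =
      1 + (entropy p - χ₁) / χ₂ := by
    simp only [add_zero, sub_zero]
    rw [one_add_div hχ2.ne']
    congr 1
    ring
  rw [he, add_zero, sub_zero] at hlim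
  exact hlim

end

/-! ### The two bounds combined -/

theorem theorem2p7 {N : ℕ} (A : Fin N → Mat2) (t : Fin N → Plane) (p : PMF (Fin N))
    (hcontr : ∀ i, IsContracting (A i)) (hns : ∀ i, (A i).det ≠ 0)
    (hdom : DominatedSplitting A) (hssc : StrongSeparation A t)
    (hdir : ENNReal.ofReal (min 1 (dimLyap A p)) ≤ dimHMeasure (strongStableDistribution A p)) :
    dimHMeasure (selfAffineMeasure A t p) = ENNReal.ofReal (dimLyap A p) ∧
      dimLyap A p =
        min (entropy p / lyapS A p) (1 + (entropy p - lyapS A p) / lyapSS A p) := by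
  obtain ⟨L, C, δ, h, h'⟩ := exists_uniformlyDominated hns hdom
  have heq := dimLyap_eq p hcontr h h' hssc
  refine ⟨le_antisymm ?_ ?_, heq⟩
  · rw [heq]
    exact dimHMeasure_selfAffineMeasure_le p hcontr hssc h h'
  · have : IsProbabilityMeasure (selfAffineMeasure A t p) :=
      isProbabilityMeasure_selfAffineMeasure p hcontr hssc
    have hlaw : strongStableDistribution A p = (bernoulliMeas p).map (slowLine A) := by
      rw [strongStableDistribution, funext fun j => h.strongStableDir_eq_slowLine h' j]
    rw [hlaw] at hdir
    have hfrost : ∀ s, 0 < s → s < 1 → s < dimLyap A p →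
        FrostmanAE ((bernoulliMeas p).map (slowLine A)) s := fun s h0 h1 h2 => by
      refine frostmanAE_slowLine p h h0 (lt_of_lt_of_le ?_ hdir)
      exact (ENNReal.ofReal_lt_ofReal_iff (lt_min one_pos (h0.trans h2))).2 (lt_min h1 h2)
    -- Frostman bounds are available only strictly below the Lyapunov dimension, so the value itself
    -- is reached as a limit from the left.
    refine le_of_tendsto (x := 𝓝[<] (dimLyap A p)) (f := fun d => ENNReal.ofReal d)
      (tendsto_nhdsWithin_of_tendsto_nhds (ENNReal.continuous_ofReal.tendsto _)) ?_
    filter_upwards [self_mem_nhdsWithin] with d hd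
    exact (frostmanAE_selfAffineMeasure p hcontr h h' hssc hfrost hd).le_dimHMeasure
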